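/- **Chord diagrams.** A (rooted) chord diagram with $n$ chords is a perfect matching $C$ of $\{1,\dots,2n\}$, its chords being written $(x,y)$ with $x<y$; $x$ is the source and $y$ the sink. The root chord is the one with smallest source. A chord $(x_2,y_2)$ is a right neighbor of $(x_1,y_1)$ if $x_1<x_2<y_1<y_2$; the two chords are then said to cross. The intersection graph has the chords as vertices and the crossing pairs as edges, and $C$ is connected if this graph is. A subset of $C$ is regarded as a chord diagram after the order-preserving relabelling of its end points. For $m\ge 3$ the top cycle of size $m$ is the diagram $\{(2k+1,2k+4): 0\le k\le m-2\}\cup\{(2,2m-1)\}$; $C$ is top-cycle-free if no subset of $C$ is a top cycle. The intersection order of a connected diagram lists the root chord first, then, after removal of the root chord, the connected components that remain, in the order of their root chords, each listed recursively in the same way. A chord is terminal if it has no right neighbor, and $t_1(C)$ is the position (counted from $1$) of the first terminal chord in the intersection order. **Maps.** A rooted map consists of a finite set $H$ of half-edges, a permutation $\sigma$ and an involution $\alpha$ of $H$ generating a transitive group, where $\alpha$ has exactly one fixed point, the root. Maps are counted up to isomorphism preserving the root. Vertices, edges and faces are the cycles of $\sigma$, $\alpha$ and $\sigma\alpha$;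 in particular, the dangling root edge is counted as one of the $n$ edges. If $v$ and $f$ are the numbers of vertices and faces, the map is planar if $v-(n-1)+f=2$. It is bridgeless if cutting any one edge leaves the underlying graph connected. The rightmost depth-first search enters the root vertex through the root edge. On first entering a vertex through a half-edge $h$, it examines the other half-edges of that vertex in the order $\sigma h,\sigma^2h,\dots$: an edge not yet traversed is traversed and oriented in the direction of traversal; if it leads to a vertex not yet visited, the search continues there before returning. Let $\deg^-_{\mathrm{DFS},1}$ be the indegree of the root vertex in this orientation, the root edge being counted as incoming. **Statement.** Let $n\ge 2$ and $1\le i\le n$. The number of connected top-cycle-free chord diagrams with $n$ chords and $t_1=i$, and the number of planar bridgeless rooted maps with $n$ edges and $\deg^-_{\mathrm{DFS},1}=i$, are both finite and both equal to $$\frac{i-1}{(4n-2i-1)(2n-i-1)}\binom{2i-1}{i}\binom{4n-2i-1}{n-i},$$ and, for $i\ge 2$, both equal to $$\frac{2(2i-1)!\,(4n-2i-3)!}{(i-2)!\,i!\,(n-i)!\,(3n-i-1)!}.$$ -/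

import Mathlib

/-! ### Chord diagrams

A chord is a pair `(source, sink)` of natural numbers; a diagram is a finite set of chords. -/

namespace ChordDiagram

/-- `C` is a rooted chord diagram of size `n`: a perfect matching of `{1, …, 2n}`, each matched pair
being written as `(x, y)` with `x < y`. -/
structure IsDiagram (n : ℕ) (C : Finset (ℕ × ℕ)) : Prop where
  lt : ∀ c ∈ C, c.1 < c.2
  mem_Icc : ∀ c ∈ C, c.1 ∈ Set.Icc 1 (2 * n) ∧ c.2 ∈ Set.Icc 1 (2 * n)
  matching : ∀ k ∈ Set.Icc 1 (2 * n), ∃! c, c ∈ C ∧ (c.1 = k ∨ c.2 = k)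

/-- `d` is a right neighbor of `c`: a directed edge from `c` to `d` in the directed intersection
graph. -/
def RightNbr (c d : ℕ × ℕ) : Prop := c.1 < d.1 ∧ d.1 < c.2 ∧ c.2 < d.2

/-- The (undirected) intersection graph of a set of chords. -/
def intersectionGraph (C : Finset (ℕ × ℕ)) : SimpleGraph {c // c ∈ C} where
  Adj c d := RightNbr c.1 d.1 ∨ RightNbr d.1 c.1
  symm := ⟨fun _ _ h => h.symm⟩
  loopless := ⟨fun c h => by rcases h with h | h <;> exact lt_irrefl _ h.1⟩

/-- A diagram is connected if its intersection graph is. -/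
def Connected (C : Finset (ℕ × ℕ)) : Prop := (intersectionGraph C).Connected

/-- The top cycle diagram of size `m` (used for `m ≥ 3`): the nonnesting path
`(1,4), (3,6), …, (2m-3, 2m)` of `m - 1` chords, together with the chord `(2, 2m-1)`, which crosses
exactly the first and the last chord of the path. Its intersection graph is an `m`-cycle. -/
def topCycle (m : ℕ) : Finset (ℕ × ℕ) :=
  insert (2, 2 * m - 1) ((Finset.range (m - 1)).image fun k => (2 * k + 1, 2 * k + 4))

/-- `T`, a diagram of size `m`, occurs as a subdiagram of `C`: some subset of `C` becomes `T` after
the order-preserving relabelling of its end points by `1, …, 2m`. -/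
def HasSubdiagram (C : Finset (ℕ × ℕ)) (m : ℕ) (T : Finset (ℕ × ℕ)) : Prop :=
  ∃ f : ℕ → ℕ, StrictMonoOn f (Set.Icc 1 (2 * m)) ∧ ∀ c ∈ T, (f c.1, f c.2) ∈ C

/-- No top cycle of any size `m ≥ 3` occurs as a subdiagram. -/
def TopCycleFree (C : Finset (ℕ × ℕ)) : Prop :=
  ∀ m, 3 ≤ m → ¬ HasSubdiagram C m (topCycle m)

/-- The root chord of a nonempty set of chords: the one with the smallest source. -/
noncomputable def root (C : Finset (ℕ × ℕ)) (h : C.Nonempty) : ℕ × ℕ :=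
  (C.exists_min_image Prod.fst h).choose

lemma root_mem (C : Finset (ℕ × ℕ)) (h : C.Nonempty) : root C h ∈ C :=
  (C.exists_min_image Prod.fst h).choose_spec.1

open Classical in
/-- The connected component of the root chord. -/
noncomputable def rootComponent (C : Finset (ℕ × ℕ)) (h : C.Nonempty) : Finset (ℕ × ℕ) :=
  C.filter fun c => ∃ hc : c ∈ C,
    (intersectionGraph C).Reachable ⟨root C h, root_mem C h⟩ ⟨c, hc⟩

lemma rootComponent_subset (C : Finset (ℕ × ℕ)) (h : C.Nonempty) : rootComponent C h ⊆ C := by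
  classical
  exact Finset.filter_subset _ _

lemma root_mem_rootComponent (C : Finset (ℕ × ℕ)) (h : C.Nonempty) :
    root C h ∈ rootComponent C h := by
  classical
  exact Finset.mem_filter.2 ⟨root_mem C h, root_mem C h, SimpleGraph.Reachable.refl _⟩

/-- The chords listed in the intersection order. For connected `C` the root comes first, followed by
the connected components of `C` minus its root, taken in the order of their roots, each listed
recursively. (If `C` is disconnected, its components are listed in this way one after the other:
the component of the root first, then the rest.) -/
noncomputable def intersectionOrder (C : Finset (ℕ × ℕ)) : List (ℕ × ℕ) :=
  if h : C.Nonempty then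
    root C h :: (intersectionOrder ((rootComponent C h).erase (root C h)) ++
      intersectionOrder (C \ rootComponent C h))
  else []
termination_by C.card
decreasing_by
  · exact lt_of_lt_of_le (Finset.card_erase_lt_of_mem (root_mem_rootComponent C h))
      (Finset.card_le_card (rootComponent_subset C h))
  · exact Finset.card_lt_card (Finset.sdiff_ssubset (rootComponent_subset C h)
      ⟨_, root_mem_rootComponent C h⟩)

/-- A chord of `C` is terminal if it has no right neighbor in `C`. -/
def Terminal (C : Finset (ℕ × ℕ)) (c : ℕ × ℕ) : Prop := ∀ d ∈ C, ¬ RightNbr c d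

open Classical in
/-- `t₁(C)`: the position (counted from `1`) of the first terminal chord in the intersection
order. -/
noncomputable def firstTerminal (C : Finset (ℕ × ℕ)) : ℕ :=
  (intersectionOrder C).findIdx (fun c => decide (Terminal C c)) + 1

/-- The connected top-cycle-free diagrams with `n` chords and `t₁ = i`. -/
def TopCycleFreeDiagrams (n i : ℕ) : Type :=
  {C : Finset (ℕ × ℕ) // IsDiagram n C ∧ Connected C ∧ TopCycleFree C ∧ firstTerminal C = i}

end ChordDiagram

/-! ### Rooted combinatorial maps -/

/-- A (finite) rooted combinatorial map: a transitive action of `⟨σ, α ∣ α² = 1⟩` on a set of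
half-edges, such that `α` has exactly one fixed point, the dangling half-edge `root`. The cycles
of `σ` are the vertices, with their half-edges in counterclockwise order; the cycles of `α` are the
edges, the dangling root edge `{root}` being one of them. -/
structure RootedMap : Type 1 where
  HalfEdge : Type
  finite_halfEdge : Finite HalfEdge
  σ : Equiv.Perm HalfEdge
  α : Equiv.Perm HalfEdge
  root : HalfEdge
  α_α : ∀ h, α (α h) = h
  α_eq_self_iff : ∀ h, α h = h ↔ h = root
  transitive : MulAction.IsPretransitive (Subgroup.closure {σ, α}) HalfEdge

namespace RootedMap

/-- Two rooted maps are isomorphic if a bijection of the half-edges carries one to the other. -/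
def Iso (M N : RootedMap) : Prop :=
  ∃ e : M.HalfEdge ≃ N.HalfEdge, e M.root = N.root ∧
    (∀ h, e (M.σ h) = N.σ (e h)) ∧ ∀ h, e (M.α h) = N.α (e h)

/-- Isomorphism is an equivalence relation. -/
def isoSetoid : Setoid RootedMap where
  r := Iso
  iseqv :=
    { refl := fun _ => ⟨Equiv.refl _, rfl, fun _ => rfl, fun _ => rfl⟩
      symm := by
        rintro M N ⟨e, h1, h2, h3⟩
        refine ⟨e.symm, ?_, fun h => ?_, fun h => ?_⟩
        · rw [← h1, e.symm_apply_apply]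
        · rw [e.symm_apply_eq, h2, e.apply_symm_apply]
        · rw [e.symm_apply_eq, h3, e.apply_symm_apply]
      trans := by
        rintro M N P ⟨e, h1, h2, h3⟩ ⟨f, k1, k2, k3⟩
        refine ⟨e.trans f, ?_, fun h => ?_, fun h => ?_⟩
        · simp [h1, k1]
        · simp [h2, k2]
        · simp [h3, k3] }

variable (M : RootedMap)

/-- Two half-edges are incident to the same vertex. -/
def SameVertex (h k : M.HalfEdge) : Prop := M.σ.SameCycle h k

/-- The number of vertices. -/
noncomputable def numVertices : ℕ := Nat.card (Quotient (Equiv.Perm.SameCycle.setoid M.σ))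

/-- The number of edges, the dangling root edge included. -/
noncomputable def numEdges : ℕ := Nat.card (Quotient (Equiv.Perm.SameCycle.setoid M.α))

/-- The number of faces. -/
noncomputable def numFaces : ℕ :=
  Nat.card (Quotient (Equiv.Perm.SameCycle.setoid (M.σ * M.α)))

/-- The Euler characteristic. The dangling root edge has only one end attached to a vertex, and is
not counted as an edge here. -/
noncomputable def eulerChar : ℤ := M.numVertices - (M.numEdges - 1) + M.numFaces

/-- A map is planar if its Euler characteristic is `2`. -/
def Planar : Prop := M.eulerChar = 2

/-- A map is bridgeless if its underlying graph stays connected when any one edge `{h, α h}` is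
cut: any two half-edges `x`, `y` can still be linked by moving around vertices and along the
remaining edges. -/
def Bridgeless : Prop :=
  ∀ h x y : M.HalfEdge, Relation.EqvGen
    (fun a b => b = M.σ a ∨ (b = M.α a ∧ a ≠ h ∧ a ≠ M.α h)) x y

/-- The other half-edges at the vertex of `h`, in counterclockwise order starting right after `h`:
`σ h, σ² h, …`, stopping before `h` is reached again. -/
noncomputable def around (h : M.HalfEdge) : List M.HalfEdge :=
  List.iterate M.σ (M.σ h) (Function.minimalPeriod M.σ h - 1)

open Classical in
/-- One step of the rightmost depth-first search. The state consists of the stack of half-edges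
still to be examined, and of the set `S` of half-edges along which an edge has been traversed so far;
an edge traversed along `h` is oriented away from `h`, towards the vertex of `α h`. The vertices
visited so far are those at which some traversed edge has arrived. The top half-edge `h` of the stack
is discarded if its edge has already been traversed. Otherwise its edge is traversed along `h`; if
this leads to a new vertex, the half-edges of that vertex are explored next, from right to left
(counterclockwise after the half-edge of arrival), before the search returns. -/
noncomputable def dfsStep :
    List M.HalfEdge × Set M.HalfEdge → List M.HalfEdge × Set M.HalfEdge
  | ([], S) => ([], S)
  | (h :: stack, S) =>
    if h ∈ S ∨ M.α h ∈ S then (stack, S)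
    else if ∃ k ∈ S, M.SameVertex (M.α k) (M.α h) then (stack, insert h S)
    else (M.around (M.α h) ++ stack, insert h S)

/-- The rightmost depth-first search orientation: the set of half-edges `h` whose edge is oriented
from `h` to `α h`. The search starts by entering the root vertex through the root edge (which is thus
oriented towards the root vertex). A half-edge enters the stack at most once, so the search has ended
after as many steps as there are half-edges. -/
noncomputable def dfsOrientation : Set M.HalfEdge :=
  (M.dfsStep^[Nat.card M.HalfEdge] (M.around M.root, {M.root})).2

/-- The indegree of the root vertex under the rightmost depth-first search orientation, the root
edge included. -/
noncomputable def rootIndegree : ℕ :=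
  {h | h ∈ M.dfsOrientation ∧ M.SameVertex M.root (M.α h)}.ncard

/-- The planar bridgeless rooted maps with `n` edges and root indegree `i`, up to isomorphism. -/
def PlanarBridgelessMaps (n i : ℕ) : Type 1 :=
  Quotient (isoSetoid.comap (Subtype.val :
    {M : RootedMap // M.Planar ∧ M.Bridgeless ∧ M.numEdges = n ∧ M.rootIndegree = i} → RootedMap))

end RootedMap

/-!
Both families are in bijection with the same decomposition trees, and the trees are counted by
solving a functional equation. A tree (`Code`) is a leaf or a node with two subtrees `B`, `A` and a
label between `1` and the width of `B`. Its size is the number of leaves; its width is the width of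
`A` plus the label at a node, and `1` at a leaf; its spine is the number of vertices on the path
from the root to the leftmost leaf.

*Maps.* A bridgeless planar map is a transitive pair of permutations of genus zero in which no edge
has the same face on both sides. Let `l` be the last half-edge at the root vertex. The first edge
`{n, a}` along the root face that separates the root face from the face of `l` is cut, and `l` is
moved from the root vertex to the place before `a`. The result is a map with root `r` and a map with
root `a`, again planar and bridgeless, and the label is the number of steps from `r` to `n`
(`PermPair.CutData`). This can be undone for every label up to the degree of the root face of the
first map (`PermPair.GlueData`), so that the width is the degree of the root face. Hence maps
correspond to trees: see `PermPair.HasCode.exists_iso` and `PermPair.exists_map_of_valid`. The spine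
is the number of faces at the root vertex, as each cut removes one
(`PermPair.CutData.vertexFaces_eq`). This number is the indegree of the root vertex in the
depth-first search. Indeed the search leaves the root vertex exactly once for each component, apart
from the dangling root, that remains when this vertex is split into single half-edges
(`RootedMap.rootIndegree_add`), and in a planar map the number of these components is determined by
the degree of the vertex and the number of its faces (`PermPair.numClasses_splitRoot`). All
statements about genus and connectivity come from the effect of a transposition on the cycles of a
permutation.

*Chord diagrams.* Top-cycle-freeness is first expressed without paths
(`ChordDiagram.topCycleFree_iff`): if `e` is a right neighbor of `c`, then the part of `e` to the
right of `c` is not covered by chords that start after `e`. When the root chord of a connected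
diagram is removed, let `B` be the first component, and let `A` consist of the root chord and the
other components (`ChordDiagram.Split`). All end points of `A` but the first lie in a single gap of
`B`, and the whole diagram is top-cycle-free if and only if both parts are and this gap is good,
that is, closes no top cycle. The label counts the good gaps of `B` to the right of the end of the
root chord, the width counts all good gaps but the first (`ChordDiagram.Split.width_eq`), and the
position of the first terminal chord drops by one on passing to `B`
(`ChordDiagram.Split.firstTerminal_eq`), so that it is the spine. That diagrams correspond to trees
is `ChordDiagram.HasCode.exists_relabel` and `ChordDiagram.exists_cycleFree_hasCode`.

*Counting.* Let `G(x, y)` be the generating function of the trees, with `t` marking the size, `x`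
the width and `y` the spine. Summation over the label of the root gives
`(x - 1) G(x, y) = (x - 1) x y t + x y (G(x, y) - G(1, y)) G(x, 1)`, which has a unique solution.
With `B = 1 + t B ^ 4` and `z = t B ^ 3`, so that `t = z (1 - z) ^ 3`, the solution is a rational
function of `z` and of two Catalan series (`FussCatalan.closedForm`). For `x = 1` a difference of
two terms remains, whose coefficients are products of Catalan numbers and coefficients of powers of
`B` (`Code.count_eq_raney`), and these evaluate to the stated formulas (`Code.count_eq`,
`Code.count_eq_factorial`).
-/

set_option linter.unusedSectionVars false

/-! ### Decomposition trees -/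

/-- Binary trees whose inner nodes carry a natural number. The trees that are `Code.Valid` encode
both families of objects. -/
inductive Code : Type
  | leaf : Code
  | node (B A : Code) (p : ℕ) : Code

namespace Code

/-- The number of leaves, which is the size of the encoded object. -/
def size : Code → ℕ
  | leaf => 1
  | node B A _ => B.size + A.size

/-- The catalytic statistic: the number of ways in which an object can be the left part of a larger
one. -/
def width : Code → ℕ
  | leaf => 1
  | node _ A p => A.width + p

/-- The number of vertices of the left spine, the statistic that is counted in the end. -/
def spine : Code → ℕ
  | leaf => 1
  | node B _ _ => B.spine + 1

/-- The label of each node lies between `1` and the width of its left subtree. -/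
def Valid : Code → Prop
  | leaf => True
  | node B A p => B.Valid ∧ A.Valid ∧ 1 ≤ p ∧ p ≤ B.width

lemma size_pos : ∀ c : Code, 0 < c.size
  | leaf => Nat.one_pos
  | node B _ _ => Nat.add_pos_left B.size_pos _

lemma finite_valid_size (n : ℕ) : {c : Code | c.Valid ∧ c.size = n}.Finite := by
  induction n using Nat.strong_induction_on with
  | _ n ih =>
    have h : ({leaf} ∪ ⋃ k ∈ Set.Iio n, ⋃ l ∈ Set.Iio n,
        ⋃ B ∈ {c : Code | c.Valid ∧ c.size = k}, ⋃ A ∈ {c : Code | c.Valid ∧ c.size = l},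
          (fun p => node B A p) '' Set.Iic B.width).Finite := by
      refine (Set.finite_singleton _).union
        ((Set.finite_Iio n).biUnion fun k hk => (Set.finite_Iio n).biUnion fun l hl =>
          (ih k hk).biUnion fun B _ => (ih l hl).biUnion fun A _ => (Set.finite_Iic _).image _)
    refine h.subset ?_
    rintro (_ | ⟨B, A, p⟩) ⟨hv, hs⟩
    · exact Or.inl rfl
    · have := B.size_pos
      have := A.size_pos
      simp only [size] at hs
      refine Or.inr ?_
      simp only [Set.mem_iUnion]
      exact ⟨B.size, by simp; omega, A.size, by simp; omega, B, ⟨hv.1, rfl⟩, A, ⟨hv.2.1, rfl⟩,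
        p, hv.2.2.2, rfl⟩

/-- The valid trees of size `n`. -/
noncomputable def ofSize (n : ℕ) : Finset Code := (finite_valid_size n).toFinset

lemma mem_ofSize {n : ℕ} {c : Code} : c ∈ ofSize n ↔ c.Valid ∧ c.size = n := by
  simp [ofSize]

lemma ofSize_zero : ofSize 0 = ∅ := by
  ext c
  have := c.size_pos
  simp only [mem_ofSize, Finset.notMem_empty, iff_false]
  omega

lemma ofSize_one : ofSize 1 = {leaf} := by
  ext c
  rw [mem_ofSize, Finset.mem_singleton]
  constructor
  · rintro ⟨-, h⟩
    rcases c with _ | ⟨B, A, p⟩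
    · rfl
    · have := B.size_pos
      have := A.size_pos
      simp only [size] at h
      omega
  · rintro rfl
    exact ⟨trivial, rfl⟩

/-- A tree of size other than one is a node, so that a sum over trees runs over the subtrees and the
label. -/
lemma sum_ofSize {M : Type*} [AddCommMonoid M] {n : ℕ} (hn : n ≠ 1) (w : Code → M) :
    ∑ c ∈ ofSize n, w c = ∑ k ∈ Finset.HasAntidiagonal.antidiagonal n, ∑ B ∈ ofSize k.1,
      ∑ A ∈ ofSize k.2, ∑ p ∈ Finset.Icc 1 B.width, w (node B A p) := by
  symm
  simp only [Finset.sum_sigma']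
  refine Finset.sum_bij (fun x _ => node x.2.1 x.2.2.1 x.2.2.2) ?_ ?_ ?_ ?_
  · rintro ⟨⟨k, l⟩, B, A, p⟩ h
    simp only [Finset.mem_sigma, Finset.HasAntidiagonal.mem_antidiagonal, mem_ofSize,
      Finset.mem_Icc] at h
    exact mem_ofSize.2 ⟨⟨h.2.1.1, h.2.2.1.1, h.2.2.2⟩, by
      simp only [size]; omega⟩
  · rintro ⟨⟨k, l⟩, B, A, p⟩ h ⟨⟨k', l'⟩, B', A', p'⟩ h' e
    simp only [Finset.mem_sigma, Finset.HasAntidiagonal.mem_antidiagonal, mem_ofSize,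
      Finset.mem_Icc] at h h'
    simp only [node.injEq] at e
    obtain ⟨rfl, rfl, rfl⟩ := e
    obtain rfl : k = k' := by rw [← h.2.1.2, ← h'.2.1.2]
    obtain rfl : l = l' := by rw [← h.2.2.1.2, ← h'.2.2.1.2]
    rfl
  · intro c hc
    obtain ⟨hv, hs⟩ := mem_ofSize.1 hc
    rcases c with _ | ⟨B, A, p⟩
    · exact absurd hs.symm hn
    · refine ⟨⟨(B.size, A.size), B, A, p⟩, ?_, rfl⟩
      simp only [Finset.mem_sigma, Finset.HasAntidiagonal.mem_antidiagonal, mem_ofSize,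
        Finset.mem_Icc]
      exact ⟨hs, ⟨hv.1, trivial⟩, ⟨hv.2.1, trivial⟩, hv.2.2⟩
  · intros
    rfl

end Code

/-! ### The power series `B = 1 + t B ^ 4` -/

namespace FussCatalan

open PowerSeries

/-- The coefficient of `t ^ N` in `B ^ r`, where `B = 1 + t B ^ 4`; for `r > 0` it equals
`r / (4 N + r) * (4 N + r).choose N`. The equivalent difference of binomial coefficients in the
definition needs no division, and turns the recurrence in `r` into Pascal's rule. -/
def raney (r : ℕ) : ℕ → ℚ
  | 0 => 1
  | N + 1 => (4 * N + 4 + r).choose (N + 1) - 4 * (4 * N + 3 + r).choose N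

lemma raney_zero_succ (N : ℕ) : raney 0 (N + 1) = 0 := by
  have h := Nat.add_one_mul_choose_eq (4 * N + 3) N
  have h' : ((4 * N + 3 + 1 : ℕ) : ℚ) * ((4 * N + 3).choose N : ℕ) =
      ((4 * N + 3 + 1).choose (N + 1) : ℕ) * (N + 1 : ℕ) := by exact_mod_cast h
  have h0 : ((N : ℚ) + 1) ≠ 0 := by positivity
  simp only [raney, add_zero]
  push_cast at h'
  have : ((N : ℚ) + 1) * (((4 * N + 4).choose (N + 1) : ℚ) - 4 * (4 * N + 3).choose N) = 0 := by
    linear_combination -h'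
  exact (mul_eq_zero.1 this).resolve_left h0

lemma raney_succ_succ (r N : ℕ) : raney (r + 1) (N + 1) = raney r (N + 1) + raney (r + 4) N := by
  cases N with
  | zero => simp [raney]
  | succ N =>
    simp only [raney]
    have h1 := Nat.choose_succ_succ (4 * (N + 1) + 4 + r) (N + 1)
    have h2 := Nat.choose_succ_succ (4 * (N + 1) + 3 + r) N
    have e1 : 4 * (N + 1) + 4 + (r + 1) = (4 * (N + 1) + 4 + r) + 1 := by ring
    have e2 : 4 * (N + 1) + 3 + (r + 1) = (4 * (N + 1) + 3 + r) + 1 := by ring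
    have e3 : 4 * N + 4 + (r + 4) = 4 * (N + 1) + 4 + r := by ring
    have e4 : 4 * N + 3 + (r + 4) = 4 * (N + 1) + 3 + r := by ring
    rw [e1, e2, e3, e4, show N + 1 + 1 = (N + 1).succ from rfl, ← Nat.succ_eq_add_one, h1,
      ← Nat.succ_eq_add_one, h2]
    push_cast
    ring

/-- The series with coefficients `raney r`. -/
noncomputable def raneySeries (r : ℕ) : ℚ⟦X⟧ := mk (raney r)

lemma raneySeries_zero : raneySeries 0 = 1 := by
  ext N
  cases N with
  | zero => simp [raneySeries, raney]
  | succ N => simp [raneySeries, raney_zero_succ, coeff_one]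

lemma raneySeries_succ (r : ℕ) :
    raneySeries (r + 1) = raneySeries r + X * raneySeries (r + 4) := by
  ext N
  cases N with
  | zero => simp [raneySeries, raney]
  | succ N => simp [raneySeries, raney_succ_succ, coeff_succ_X_mul]

/-- A solution of the recurrence of the Raney series is determined by its first term. -/
lemma eq_of_recurrence {E E' : ℕ → ℚ⟦X⟧} (h : ∀ r, E (r + 1) = E r + X * E (r + 4))
    (h' : ∀ r, E' (r + 1) = E' r + X * E' (r + 4)) (h0 : E 0 = E' 0) (r : ℕ) : E r = E' r := by
  ext N
  induction N generalizing r with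
  | zero =>
    induction r with
    | zero => rw [h0]
    | succ r ih => rw [h, h', map_add, map_add, coeff_zero_X_mul, coeff_zero_X_mul, ih]
  | succ N ihN =>
    induction r with
    | zero => rw [h0]
    | succ r ih => rw [h, h', map_add, map_add, coeff_succ_X_mul, coeff_succ_X_mul, ih, ihN]

/-- For fixed `s`, both sides satisfy the recurrence of the Raney series in `r`. -/
lemma raneySeries_add (r s : ℕ) : raneySeries (r + s) = raneySeries r * raneySeries s :=
  eq_of_recurrence (E := fun r => raneySeries (r + s))
    (E' := fun r => raneySeries r * raneySeries s)
    (fun r => by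
      simp only [Nat.add_right_comm _ _ s]
      exact raneySeries_succ _)
    (fun r => by rw [raneySeries_succ]; ring) (by simp [raneySeries_zero]) r

lemma raneySeries_eq_pow (r : ℕ) : raneySeries r = raneySeries 1 ^ r := by
  induction r with
  | zero => rw [raneySeries_zero, pow_zero]
  | succ r ih => rw [raneySeries_add, ih, pow_succ]

lemma raneySeries_one : raneySeries 1 = 1 + X * raneySeries 1 ^ 4 := by
  have := raneySeries_succ 0
  rwa [raneySeries_zero, zero_add, zero_add, raneySeries_eq_pow 4] at this

end FussCatalan

/-! ### The generating function of decomposition trees -/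

namespace FussCatalan

open PowerSeries

section Parameters

variable (R : Type*) [CommRing R] [Algebra ℚ R]

/-- The series `B = 1 + t B ^ 4` over a `ℚ`-algebra. -/
noncomputable def quartic : R⟦X⟧ := PowerSeries.map (algebraMap ℚ R) (raneySeries 1)

/-- The parameter `z = t B ^ 3`, for which `t = z (1 - z) ^ 3`. -/
noncomputable def param : R⟦X⟧ := X * quartic R ^ 3

lemma quartic_eq : quartic R = 1 + X * quartic R ^ 4 := by
  have := congrArg (PowerSeries.map (algebraMap ℚ R)) raneySeries_one
  simpa [quartic] using this

lemma one_sub_param_mul : (1 - param R) * quartic R = 1 := by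
  have := quartic_eq R
  unfold param
  linear_combination this

lemma X_eq_param : (X : R⟦X⟧) = param R * (1 - param R) ^ 3 := by
  have h := one_sub_param_mul R
  have : (X : R⟦X⟧) = X * ((1 - param R) * quartic R) ^ 3 := by rw [h]; ring
  rw [this]
  unfold param
  ring

@[simp]
lemma constantCoeff_param : constantCoeff (param R) = 0 := by
  simp [param]

variable {R}

lemma map_param {S : Type*} [CommRing S] [Algebra ℚ S] (h : R →+* S) :
    PowerSeries.map h (param R) = param S := by
  have : h.comp (algebraMap ℚ R) = algebraMap ℚ S := RingHom.ext_rat _ _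
  simp only [param, quartic, map_mul, map_pow, map_X, ← this, PowerSeries.map_comp,
    RingHom.comp_apply]

/-- The Catalan series evaluated at `z (1 - z) r`. -/
noncomputable def cat (r : R) : R⟦X⟧ :=
  PowerSeries.subst (param R * (1 - param R) * C r : R⟦X⟧)
    (PowerSeries.map (Nat.castRingHom ℚ) catalanSeries)

lemma cat_eq (r : R) : cat r = 1 + param R * (1 - param R) * C r * cat r ^ 2 := by
  have ha : HasSubst (param R * (1 - param R) * C r : R⟦X⟧) :=
    HasSubst.of_constantCoeff_zero' (by simp)
  have h := congrArg (PowerSeries.subst (param R * (1 - param R) * C r : R⟦X⟧))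
    (congrArg (PowerSeries.map (Nat.castRingHom ℚ)) catalanSeries_sq_mul_X_add_one)
  rw [map_add, map_mul, map_pow, map_one, map_X, subst_add ha, subst_mul ha, subst_pow ha,
    subst_X ha] at h
  have h1 : PowerSeries.subst (param R * (1 - param R) * C r : R⟦X⟧) (1 : PowerSeries ℚ) = 1 := by
    rw [← coe_substAlgHom ha, map_one]
  rw [h1] at h
  have h' : cat r ^ 2 * (param R * (1 - param R) * C r) + 1 = cat r := h
  linear_combination -h'

omit [Algebra ℚ R] in
/-- The quadratic equation of the Catalan series has only one solution that is a power series. -/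
lemma eq_of_one_add_mul_sq {q c d : R⟦X⟧} (hq : constantCoeff q = 0) (hc : c = 1 + q * c ^ 2)
    (hd : d = 1 + q * d ^ 2) : c = d := by
  have hu : IsUnit (1 - q * (c + d)) := by
    rw [isUnit_iff_constantCoeff]
    simp [hq]
  have : (c - d) * (1 - q * (c + d)) = 0 := by linear_combination hc - hd
  exact sub_eq_zero.1 ((hu.mul_left_eq_zero).1 this)

lemma map_cat {S : Type*} [CommRing S] [Algebra ℚ S] (h : R →+* S) (r : R) :
    PowerSeries.map h (cat r) = cat (h r) := by
  refine eq_of_one_add_mul_sq (q := param S * (1 - param S) * C (h r)) (by simp) ?_ (cat_eq _)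
  conv_lhs => rw [cat_eq]
  simp [map_param]

lemma cat_one : cat (1 : R) = quartic R := by
  refine eq_of_one_add_mul_sq (q := param R * (1 - param R)) (by simp) ?_ ?_
  · have := cat_eq (1 : R)
    simpa using this
  · have h := quartic_eq R
    have h1 := one_sub_param_mul R
    unfold param at h1 ⊢
    linear_combination h - X * quartic R ^ 4 * h1

/-- The power series `1 + z u`, where `r = (1 + u) / (1 + z u) ^ 2`. -/
noncomputable def den (r : R) : R⟦X⟧ := (1 - param R) * cat r

lemma den_eq (r : R) : den r = 1 - param R + param R * C r * den r ^ 2 := by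
  have := cat_eq r
  unfold den
  linear_combination (1 - param R) * this

lemma den_one : den (1 : R) = 1 := by
  rw [den, cat_one, one_sub_param_mul]

lemma isUnit_den (r : R) : IsUnit (den r) := by
  rw [isUnit_iff_constantCoeff]
  have := congrArg constantCoeff (den_eq r)
  simp only [map_add, map_sub, map_mul, map_one, constantCoeff_param] at this
  rw [this]
  simp

lemma map_den {S : Type*} [CommRing S] [Algebra ℚ S] (h : R →+* S) (r : R) :
    PowerSeries.map h (den r) = den (h r) := by
  simp [den, map_param, map_cat]

/-- The parameter `u` with `r = (1 + u) / (1 + z u) ^ 2`. -/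
noncomputable def num (r : R) : R⟦X⟧ := C r * den r ^ 2 - 1

lemma map_num {S : Type*} [CommRing S] [Algebra ℚ S] (h : R →+* S) (r : R) :
    PowerSeries.map h (num r) = num (h r) := by
  simp [num, map_den]

lemma num_one : num (1 : R) = 0 := by
  simp [num, den_one]

lemma den_eq_num (r : R) : den r = 1 + param R * num r := by
  have := den_eq r
  unfold num
  linear_combination this

/-- The bivariate series that enumerates decomposition trees, in terms of the parameters. The
denominator has constant coefficient `1`, so that `Ring.inverse` is a genuine inverse. -/
noncomputable def closedForm (r s : R) : R⟦X⟧ :=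
  param R * C r * den r * C s * den s *
    (1 - 2 * param R - param R ^ 2 * (num r + num s + num r * num s)) *
    Ring.inverse (1 - param R * num r * num s)

lemma isUnit_kernel (r s : R) : IsUnit (1 - param R * num r * num s) := by
  rw [isUnit_iff_constantCoeff]
  simp

lemma map_closedForm {S : Type*} [CommRing S] [Algebra ℚ S] (h : R →+* S) (r s : R) :
    PowerSeries.map h (closedForm r s) = closedForm (h r) (h s) := by
  have hi : PowerSeries.map h (Ring.inverse (1 - param R * num r * num s)) =
      Ring.inverse (1 - param S * num (h r) * num (h s)) := by
    have h1 := Ring.mul_inverse_cancel _ (isUnit_kernel r s)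
    have h2 := congrArg (PowerSeries.map h) h1
    have e : PowerSeries.map h (1 - param R * num r * num s) =
      1 - param S * num (h r) * num (h s) := by simp [map_param, map_num]
    rw [map_mul, map_one, e] at h2
    have h3 := Ring.inverse_mul_cancel _ (isUnit_kernel (h r) (h s))
    calc _ = Ring.inverse (1 - param S * num (h r) * num (h s)) *
          ((1 - param S * num (h r) * num (h s)) *
            PowerSeries.map h (Ring.inverse (1 - param R * num r * num s))) := by
            rw [← mul_assoc, h3, one_mul]
      _ = _ := by rw [h2, mul_one]
  simp only [closedForm, map_mul, map_sub, map_add, map_pow, map_one, map_ofNat, map_param,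
    map_num, map_den, hi, map_C]

lemma closedForm_one_left (s : R) :
    closedForm 1 s = param R * C s * den s * (1 - 2 * param R - param R ^ 2 * num s) := by
  simp [closedForm, num_one, den_one]

lemma closedForm_one_right (r : R) :
    closedForm r 1 = param R * C r * den r * (1 - 2 * param R - param R ^ 2 * num r) := by
  simp [closedForm, num_one, den_one]

end Parameters

/-- The rational function identity behind the functional equation of the closed form. -/
lemma functional_identity {L : Type*} [Field L] {z u v : L} (hu : 1 + z * u ≠ 0)
    (hv : 1 + z * v ≠ 0) (hk : 1 - z * u * v ≠ 0) {x y G G₁ H : L}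
    (hx : x = (1 + u) / (1 + z * u) ^ 2) (hy : y = (1 + v) / (1 + z * v) ^ 2)
    (hG : G = z * x * (1 + z * u) * y * (1 + z * v) *
      (1 - 2 * z - z ^ 2 * (u + v + u * v)) / (1 - z * u * v))
    (hG₁ : G₁ = z * y * (1 + z * v) * (1 - 2 * z - z ^ 2 * v))
    (hH : H = z * x * (1 + z * u) * (1 - 2 * z - z ^ 2 * u)) :
    (x - 1) * G = (x - 1) * x * y * (z * (1 - z) ^ 3) + y * x * (G - G₁) * H := by
  obtain ⟨a, ha⟩ : ∃ a, a = 1 + z * u := ⟨_, rfl⟩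
  obtain ⟨b, hb⟩ : ∃ b, b = 1 + z * v := ⟨_, rfl⟩
  obtain ⟨k, hk'⟩ : ∃ k, k = 1 - z * u * v := ⟨_, rfl⟩
  rw [← ha] at hu hx hG hH
  rw [← hb] at hv hy hG hG₁
  rw [← hk'] at hk hG
  have e1 : x - 1 = ((1 + u) - a ^ 2) / a ^ 2 := by rw [hx]; field_simp
  have e2 : G = z * (1 + u) * (1 + v) * (1 - 2 * z - z ^ 2 * (u + v + u * v)) / (a * b * k) := by
    rw [hG, hx, hy]; field_simp
  have e3 : G - G₁ = z * (1 + v) * ((1 + u) * (1 - 2 * z - z ^ 2 * (u + v + u * v)) -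
      (1 - 2 * z - z ^ 2 * v) * a * k) / (a * b * k) := by
    rw [e2, hG₁, hy]; field_simp
  have e4 : H = z * (1 + u) * (1 - 2 * z - z ^ 2 * u) / a := by
    rw [hH, hx]; field_simp
  have e5 : ((1 + u) - a ^ 2) * b ^ 2 * (1 - 2 * z - z ^ 2 * (u + v + u * v)) * a =
      ((1 + u) - a ^ 2) * (1 - z) ^ 3 * b * k + (1 + v) * z * ((1 + u) *
        (1 - 2 * z - z ^ 2 * (u + v + u * v)) - (1 - 2 * z - z ^ 2 * v) * a * k) * (1 + u) *
        (1 - 2 * z - z ^ 2 * u) := by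
    rw [ha, hb, hk']; ring
  rw [e3, e2, e1, e4, hx, hy]
  field_simp
  linear_combination z * (1 + u) * (1 + v) * e5

lemma closedForm_functional {R : Type*} [CommRing R] [IsDomain R] [Algebra ℚ R] (r s : R) :
    C (r - 1) * closedForm r s = C ((r - 1) * r * s) * X +
      C (s * r) * (closedForm r s - closedForm 1 s) * closedForm r 1 := by
  let L := FractionRing R⟦X⟧
  obtain ⟨f, hf⟩ : ∃ f : R⟦X⟧ →+* L, Function.Injective f :=
    ⟨algebraMap R⟦X⟧ L, IsFractionRing.injective _ _⟩
  apply hf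
  have hz : ∀ w : R⟦X⟧, IsUnit w → f w ≠ 0 := fun w hw => (hw.map f).ne_zero
  have h2 : f 2 = 2 := map_ofNat f 2
  have du := den_eq_num r
  have dv := den_eq_num s
  have hu := hz _ (isUnit_den r)
  have hv := hz _ (isUnit_den s)
  have hk := hz _ (isUnit_kernel r s)
  have hx : f (C r) * f (den r) ^ 2 = 1 + f (num r) := by
    rw [← map_pow, ← map_mul, ← map_one f, ← map_add]
    congr 1
    unfold num
    ring
  have hy : f (C s) * f (den s) ^ 2 = 1 + f (num s) := by
    rw [← map_pow, ← map_mul, ← map_one f, ← map_add]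
    congr 1
    unfold num
    ring
  have du' : f (den r) = 1 + f (param R) * f (num r) := by rw [du]; simp
  have dv' : f (den s) = 1 + f (param R) * f (num s) := by rw [dv]; simp
  have hi : f (Ring.inverse (1 - param R * num r * num s)) =
      (f (1 - param R * num r * num s))⁻¹ := by
    apply eq_inv_of_mul_eq_one_left
    rw [← map_mul, Ring.inverse_mul_cancel _ (isUnit_kernel r s),
      map_one]
  have hXX : f X = f (param R) * (1 - f (param R)) ^ 3 := by
    conv_lhs => rw [X_eq_param]
    simp
  have key := functional_identity (z := f (param R)) (u := f (num r)) (v := f (num s))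
    (x := f (C r)) (y := f (C s)) (G := f (closedForm r s)) (G₁ := f (closedForm 1 s))
    (H := f (closedForm r 1))
    (by rw [← du']; exact hu) (by rw [← dv']; exact hv) (by simpa using hk)
    (by rw [← du', eq_div_iff (pow_ne_zero 2 hu), hx])
    (by rw [← dv', eq_div_iff (pow_ne_zero 2 hv), hy])
    (by rw [← du', ← dv', closedForm, map_mul, hi, div_eq_mul_inv]; simp [h2])
    (by rw [closedForm_one_left, ← dv']; simp [h2])
    (by rw [closedForm_one_right, ← du']; simp [h2])
  simp only [map_mul, map_sub, map_add, map_one, hXX] at key ⊢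
  linear_combination key

end FussCatalan

namespace Code

open PowerSeries FussCatalan

section

variable {K : Type*} [CommRing K]

/-- The generating function of decomposition trees, with the size marked by the power series
variable, the width by the polynomial variable, and the spine by `y`. -/
noncomputable def series (y : K) : (Polynomial K)⟦X⟧ :=
  mk fun n => ∑ c ∈ ofSize n, Polynomial.X ^ c.width * Polynomial.C (y ^ c.spine)

/-- The substitution `1` for the polynomial variable, as an endomorphism. -/
noncomputable def evalOne : Polynomial K →+* Polynomial K :=
  Polynomial.C.comp (Polynomial.evalRingHom 1)

/-- The functional equation of the generating function, obtained by removing the root of a tree. The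
geometric sum over the label of the root is the reason for the factor `X - 1`. -/
lemma coeff_series_recurrence (y : K) (n : ℕ) :
    (Polynomial.X - 1) * coeff n (series y) =
      coeff n (C ((Polynomial.X - 1) * Polynomial.X * Polynomial.C y) * X +
        C (Polynomial.C y * Polynomial.X) *
        (series y - PowerSeries.map evalOne (series y)) * series 1) := by
  rw [map_add, coeff_C_mul, mul_assoc (C _), coeff_C_mul, coeff_mul]
  by_cases hn : n = 1
  · subst hn
    have h0 : coeff 0 (series y) = 0 := by simp [series, ofSize_zero]
    have h1 : coeff 0 (series (1 : K)) = 0 := by simp [series, ofSize_zero]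
    have : Finset.HasAntidiagonal.antidiagonal 1 = {(0, 1), (1, 0)} := rfl
    rw [this, Finset.sum_pair (by simp), h1, map_sub, h0]
    simp [series, ofSize_one, ofSize_zero, width, spine, mul_assoc]
  · rw [coeff_X, if_neg hn, mul_zero, zero_add]
    simp only [series, coeff_mk, map_sub, coeff_map]
    rw [sum_ofSize hn, Finset.mul_sum, Finset.mul_sum]
    refine Finset.sum_congr rfl fun k _ => ?_
    rw [map_sum, ← Finset.sum_sub_distrib, Finset.sum_mul, Finset.mul_sum, Finset.mul_sum]
    refine Finset.sum_congr rfl fun B _ => ?_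
    rw [Finset.mul_sum, Finset.mul_sum, Finset.mul_sum]
    refine Finset.sum_congr rfl fun A _ => ?_
    have hg : ∀ s : ℕ, ((Polynomial.X : Polynomial K) - 1) *
        ∑ p ∈ Finset.Icc 1 s, Polynomial.X ^ p = Polynomial.X * (Polynomial.X ^ s - 1) := by
      intro s
      induction s with
      | zero => simp
      | succ s ih =>
        rw [Finset.sum_Icc_succ_top (by omega), mul_add, ih]
        ring
    have hs : ∑ p ∈ Finset.Icc 1 B.width, (Polynomial.X : Polynomial K) ^ (node B A p).width *
        Polynomial.C (y ^ (node B A p).spine) =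
        (∑ p ∈ Finset.Icc 1 B.width, (Polynomial.X : Polynomial K) ^ p) *
          (Polynomial.X ^ A.width * Polynomial.C (y ^ (B.spine + 1))) := by
      rw [Finset.sum_mul]
      refine Finset.sum_congr rfl fun p _ => ?_
      simp only [width, spine, pow_add]
      ring
    rw [hs, ← mul_assoc, hg]
    simp only [evalOne, map_mul, map_pow, RingHom.comp_apply, Polynomial.coe_evalRingHom,
      Polynomial.eval_X, Polynomial.eval_C, one_pow,
      map_one, one_mul, mul_one, pow_succ]
    ring

end

section

variable {K : Type*} [CommRing K] [IsDomain K] [Algebra ℚ K]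

omit [IsDomain K] in
lemma coeff_closedForm_zero (r s : Polynomial K) : coeff 0 (closedForm r s) = 0 := by
  simp [closedForm]

omit [Algebra ℚ K] in
/-- The functional equation determines the coefficients of `E` up to `n` from those of `E₁` below
`n`: the factor `X - 1` can be cancelled, and `E₁` has no constant term, so that only smaller
coefficients of `E` occur on the right. -/
lemma eq_of_functional {y : K} {E E₁ F F₁ : (Polynomial K)⟦X⟧}
    (h : ∀ n, (Polynomial.X - 1) * coeff n E =
      coeff n (C ((Polynomial.X - 1) * Polynomial.X * Polynomial.C y) * X +
        C (Polynomial.C y * Polynomial.X) * (E - PowerSeries.map evalOne E) * E₁))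
    (h' : ∀ n, (Polynomial.X - 1) * coeff n F =
      coeff n (C ((Polynomial.X - 1) * Polynomial.X * Polynomial.C y) * X +
        C (Polynomial.C y * Polynomial.X) * (F - PowerSeries.map evalOne F) * F₁))
    (hE : coeff 0 E₁ = 0) (hF : coeff 0 F₁ = 0) (n : ℕ)
    (h1 : ∀ k < n, coeff k E₁ = coeff k F₁) : ∀ k ≤ n, coeff k E = coeff k F := by
  intro k
  induction k using Nat.strong_induction_on with
  | _ k ih =>
    intro hk
    have hX : (Polynomial.X : Polynomial K) - 1 ≠ 0 := by
      have := Polynomial.X_sub_C_ne_zero (1 : K)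
      simpa using this
    apply mul_left_cancel₀ hX
    rw [h, h', map_add, map_add]
    congr 1
    rw [mul_assoc (C _), coeff_C_mul, mul_assoc (C _), coeff_C_mul, coeff_mul, coeff_mul]
    congr 1
    refine Finset.sum_congr rfl fun a ha => ?_
    rw [Finset.HasAntidiagonal.mem_antidiagonal] at ha
    rcases Nat.eq_zero_or_pos a.2 with h0 | h0
    · rw [h0, hE, hF, mul_zero, mul_zero]
    rcases Nat.eq_zero_or_pos a.1 with h2 | h2
    · have e0 : coeff 0 E = 0 := by
        apply mul_left_cancel₀ hX
        rw [h, map_add, coeff_C_mul, mul_assoc (C _), coeff_C_mul, coeff_mul]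
        simp [hE]
      have f0 : coeff 0 F = 0 := by
        apply mul_left_cancel₀ hX
        rw [h', map_add, coeff_C_mul, mul_assoc (C _), coeff_C_mul, coeff_mul]
        simp [hF]
      rw [h2, map_sub, map_sub, coeff_map, coeff_map, e0, f0, map_zero, sub_zero, zero_mul,
        zero_mul]
    · rw [map_sub, map_sub, coeff_map, coeff_map, ih a.1 (by omega) (by omega), h1 a.2 (by omega)]

lemma closedForm_recurrence (y : K) (n : ℕ) :
    (Polynomial.X - 1) * coeff n (closedForm (Polynomial.X : Polynomial K) (Polynomial.C y)) =
      coeff n (C ((Polynomial.X - 1) * Polynomial.X * Polynomial.C y) * X +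
        C (Polynomial.C y * Polynomial.X) * (closedForm Polynomial.X (Polynomial.C y) -
          PowerSeries.map evalOne (closedForm Polynomial.X (Polynomial.C y))) *
          closedForm Polynomial.X (Polynomial.C 1)) := by
  have h := closedForm_functional (Polynomial.X : Polynomial K) (Polynomial.C y)
  rw [map_closedForm]
  have e1 : evalOne (Polynomial.X : Polynomial K) = 1 := by simp [evalOne]
  have e2 : evalOne (Polynomial.C y : Polynomial K) = Polynomial.C y := by simp [evalOne]
  rw [e1, e2, Polynomial.C_1, ← h, coeff_C_mul]

/-- For `y = 1` the second factor of the functional equation is the unknown series itself, and the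
coefficients are compared by induction. -/
lemma series_one_eq : series (1 : K) = closedForm Polynomial.X (Polynomial.C 1) := by
  have h0 : coeff 0 (series (1 : K)) = 0 := by simp [series, ofSize_zero]
  have : ∀ n, ∀ k ≤ n, coeff k (series (1 : K)) =
      coeff k (closedForm Polynomial.X (Polynomial.C 1)) := by
    intro n
    induction n with
    | zero =>
      exact eq_of_functional (coeff_series_recurrence 1) (closedForm_recurrence 1) h0
        (coeff_closedForm_zero _ _) 0 (by simp)
    | succ n ih =>
      exact eq_of_functional (coeff_series_recurrence 1) (closedForm_recurrence 1) h0
        (coeff_closedForm_zero _ _) (n + 1) (fun k hk => ih k (by omega))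
  ext1 n
  exact this n n le_rfl

theorem series_eq (y : K) : series y = closedForm Polynomial.X (Polynomial.C y) := by
  have h0 : coeff 0 (series (1 : K)) = 0 := by simp [series, ofSize_zero]
  ext1 n
  exact eq_of_functional (coeff_series_recurrence y) (closedForm_recurrence y) h0
    (coeff_closedForm_zero _ _) n (fun k _ => by rw [series_one_eq]) n le_rfl

end

/-- The enumeration of trees by size and spine, in terms of the Catalan series. It is obtained by
setting the variable that marks the width equal to `1`. -/
lemma spine_series :
    (mk fun n => ∑ c ∈ ofSize n, (Polynomial.X : Polynomial ℚ) ^ c.spine) =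
      (1 - param _) * (param _ * (1 - param _)) * C (Polynomial.X : Polynomial ℚ) *
        cat Polynomial.X - param _ * (1 - param _) * (cat Polynomial.X - 1) := by
  have h := congrArg (PowerSeries.map (Polynomial.evalRingHom 1))
    (series_eq (Polynomial.X : Polynomial ℚ))
  have h1 : PowerSeries.map (Polynomial.evalRingHom 1) (series (Polynomial.X : Polynomial ℚ)) =
      mk fun n => ∑ c ∈ ofSize n, (Polynomial.X : Polynomial ℚ) ^ c.spine := by
    ext1 n
    simp [series]
  rw [← h1, h, map_closedForm]
  simp only [Polynomial.coe_evalRingHom, Polynomial.eval_X, Polynomial.eval_C]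
  rw [closedForm_one_left]
  have hd := den_eq_num (Polynomial.X : Polynomial ℚ)
  have hc := cat_eq (Polynomial.X : Polynomial ℚ)
  have hn : 1 - 2 * param _ - param _ ^ 2 * num (Polynomial.X : Polynomial ℚ) =
      1 - param _ - param _ * den (Polynomial.X : Polynomial ℚ) := by
    rw [hd]; ring
  rw [hn]
  unfold den
  linear_combination (param (Polynomial ℚ) * (1 - param (Polynomial ℚ))) * hc

end Code

/-! ### Extraction of coefficients -/

namespace FussCatalan

open PowerSeries

/-- The coefficient of `Y ^ i` in a power series whose coefficients are polynomials in `Y`. -/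
noncomputable def polyCoeff (i : ℕ) : (Polynomial ℚ)⟦X⟧ →+ ℚ⟦X⟧ where
  toFun f := mk fun n => (coeff n f).coeff i
  map_zero' := by ext; simp
  map_add' f g := by ext; simp

lemma coeff_polyCoeff (i n : ℕ) (f : (Polynomial ℚ)⟦X⟧) :
    coeff n (polyCoeff i f) = (coeff n f).coeff i := by
  simp [polyCoeff]

lemma polyCoeff_mul (i : ℕ) (f g : (Polynomial ℚ)⟦X⟧) :
    polyCoeff i (f * g) =
      ∑ a ∈ Finset.HasAntidiagonal.antidiagonal i, polyCoeff a.1 f * polyCoeff a.2 g := by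
  ext n
  simp only [coeff_polyCoeff, coeff_mul, map_sum, Polynomial.finsetSum_coeff, Polynomial.coeff_mul]
  exact Finset.sum_comm

lemma polyCoeff_param_mul (i : ℕ) (h : ℚ⟦X⟧) (f : (Polynomial ℚ)⟦X⟧) :
    polyCoeff i (PowerSeries.map Polynomial.C h * f) = h * polyCoeff i f := by
  ext n
  simp [coeff_polyCoeff, coeff_mul]

lemma polyCoeff_X_mul_succ (i : ℕ) (f : (Polynomial ℚ)⟦X⟧) :
    polyCoeff (i + 1) (C (Polynomial.X : Polynomial ℚ) * f) = polyCoeff i f := by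
  ext n
  simp [coeff_polyCoeff]

lemma polyCoeff_X_mul_zero (f : (Polynomial ℚ)⟦X⟧) :
    polyCoeff 0 (C (Polynomial.X : Polynomial ℚ) * f) = 0 := by
  ext n
  simp [coeff_polyCoeff]

lemma polyCoeff_one (i : ℕ) : polyCoeff i 1 = if i = 0 then 1 else 0 := by
  ext n
  rw [coeff_polyCoeff, coeff_one]
  split_ifs <;> simp_all [Polynomial.coeff_one, coeff_one]

/-- The parameter `z (1 - z) = t B ^ 2`. -/
noncomputable def quad : ℚ⟦X⟧ := param ℚ * (1 - param ℚ)

lemma map_quad : PowerSeries.map Polynomial.C quad =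
    param (Polynomial ℚ) * (1 - param (Polynomial ℚ)) := by
  simp [quad, map_param]

lemma polyCoeff_cat (i : ℕ) :
    polyCoeff i (cat (Polynomial.X : Polynomial ℚ)) = C (catalan i : ℚ) * quad ^ i := by
  have h : cat (Polynomial.X : Polynomial ℚ) = 1 + PowerSeries.map Polynomial.C quad *
      (C (Polynomial.X : Polynomial ℚ) * (cat Polynomial.X * cat Polynomial.X)) := by
    conv_lhs => rw [cat_eq, ← map_quad]
    ring
  induction i using Nat.strong_induction_on with
  | _ i ih =>
    rw [h, map_add, polyCoeff_one, polyCoeff_param_mul]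
    cases i with
    | zero => simp [polyCoeff_X_mul_zero]
    | succ i =>
      rw [polyCoeff_X_mul_succ, polyCoeff_mul, if_neg (Nat.succ_ne_zero i), zero_add,
        catalan_succ', Nat.cast_sum, map_sum, Finset.sum_mul, Finset.mul_sum]
      refine Finset.sum_congr rfl fun a ha => ?_
      rw [Finset.HasAntidiagonal.mem_antidiagonal] at ha
      rw [ih a.1 (by omega), ih a.2 (by omega), ← ha]
      push_cast
      rw [map_mul]
      ring

lemma quartic_rat : quartic ℚ = raneySeries 1 := by
  ext
  simp [quartic]

lemma quad_eq : quad = X * raneySeries 2 := by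
  have h := one_sub_param_mul ℚ
  rw [quad, raneySeries_eq_pow, ← quartic_rat]
  unfold param at h ⊢
  linear_combination X * quartic ℚ ^ 2 * h

lemma quad_pow (i : ℕ) : quad ^ i = X ^ i * raneySeries (2 * i) := by
  rw [quad_eq, raneySeries_eq_pow, raneySeries_eq_pow (2 * i), mul_pow, ← pow_mul]

lemma one_sub_param_mul_quad_pow (i : ℕ) :
    (1 - param ℚ) * quad ^ (i + 1) = X ^ (i + 1) * raneySeries (2 * i + 1) := by
  have h := one_sub_param_mul ℚ
  rw [quad_pow, raneySeries_eq_pow, raneySeries_eq_pow (2 * i + 1), ← quartic_rat]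
  rw [show 2 * (i + 1) = (2 * i + 1) + 1 by ring, pow_succ (quartic ℚ)]
  linear_combination X ^ (i + 1) * quartic ℚ ^ (2 * i + 1) * h

lemma raney_eq (r N : ℕ) :
    raney (r + 1) N = (r + 1 : ℚ) / (4 * N + r + 1) * (4 * N + r + 1).choose N := by
  have hpos : (4 * (N : ℚ) + r + 1) ≠ 0 := by positivity
  cases N with
  | zero =>
    have : ((r : ℚ) + 1) ≠ 0 := by positivity
    simp [raney]
    field_simp
  | succ N =>
    have h := Nat.add_one_mul_choose_eq (4 * N + 4 + r) N
    have h' : ((4 * N + 4 + r + 1 : ℕ) : ℚ) * ((4 * N + 4 + r).choose N : ℕ) =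
      ((4 * N + 4 + r + 1).choose (N + 1) : ℕ) * (N + 1 : ℕ) := by exact_mod_cast h
    simp only [raney]
    rw [show 4 * N + 4 + (r + 1) = 4 * N + 4 + r + 1 by ring,
      show 4 * N + 3 + (r + 1) = 4 * N + 4 + r by ring,
      show 4 * (N + 1) + r + 1 = 4 * N + 4 + r + 1 by ring, div_mul_eq_mul_div, eq_div_iff hpos]
    push_cast at h' ⊢
    linear_combination (-4) * h'

end FussCatalan

namespace Code

open PowerSeries FussCatalan

open Classical in
/-- The number of valid trees of size `n` whose spine is `i`. -/
noncomputable def count (n i : ℕ) : ℕ := ((ofSize n).filter fun c => c.spine = i).card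

lemma count_eq_coeff (n i : ℕ) :
    (count n i : ℚ) = coeff n (polyCoeff i
      (mk fun n => ∑ c ∈ ofSize n, (Polynomial.X : Polynomial ℚ) ^ c.spine)) := by
  classical
  rw [coeff_polyCoeff, coeff_mk, Polynomial.finsetSum_coeff]
  simp only [Polynomial.coeff_X_pow, count, Finset.card_filter, Nat.cast_sum]
  refine Finset.sum_congr rfl fun c _ => ?_
  by_cases h : c.spine = i
  · simp [h]
  · simp [h, Ne.symm h]

/-- The coefficients are those of the Catalan series, and the powers of `z (1 - z) = t B ^ 2` and of
`1 - z = B⁻¹` combine to powers of `B`. -/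
lemma count_eq_raney (n i : ℕ) :
    (count (n + i + 1) (i + 1) : ℚ) = catalan i * raney (2 * i + 1) n -
      catalan (i + 1) * coeff (n + i + 1) (X ^ (i + 2) * raneySeries (2 * i + 4)) := by
  rw [count_eq_coeff, spine_series, map_sub, ← map_quad,
    show (1 - param (Polynomial ℚ)) * PowerSeries.map Polynomial.C quad * C (Polynomial.X) *
      cat Polynomial.X = PowerSeries.map Polynomial.C ((1 - param ℚ) * quad) *
      (C (Polynomial.X) * cat Polynomial.X) by
        simp only [map_mul, map_sub, map_one, map_param]; ring,
    polyCoeff_param_mul, polyCoeff_param_mul, polyCoeff_X_mul_succ, map_sub, map_sub (polyCoeff _),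
    polyCoeff_one, if_neg (Nat.succ_ne_zero i), sub_zero, polyCoeff_cat, polyCoeff_cat,
    show (1 - param ℚ) * quad * (C (catalan i : ℚ) * quad ^ i) =
      C (catalan i : ℚ) * ((1 - param ℚ) * quad ^ (i + 1)) by ring,
    show quad * (C (catalan (i + 1) : ℚ) * quad ^ (i + 1)) =
      C (catalan (i + 1) : ℚ) * quad ^ (i + 2) by ring,
    one_sub_param_mul_quad_pow, quad_pow, coeff_C_mul, coeff_C_mul, add_assoc n i 1,
    coeff_X_pow_mul]
  rw [raneySeries, coeff_mk, show 2 * (i + 2) = 2 * i + 4 by ring, ← add_assoc]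

lemma catalan_succ_mul (i : ℕ) : ((i : ℚ) + 2) * catalan (i + 1) = 2 * (2 * i + 1) * catalan i := by
  have h1 := succ_mul_catalan_eq_centralBinom i
  have h2 := succ_mul_catalan_eq_centralBinom (i + 1)
  have h3 := Nat.succ_mul_centralBinom_succ i
  have h1' : ((i : ℚ) + 1) * catalan i = i.centralBinom := by exact_mod_cast h1
  have h2' : ((i : ℚ) + 2) * catalan (i + 1) = (i + 1).centralBinom := by
    have : (((i + 1 + 1) * catalan (i + 1) : ℕ) : ℚ) = (i + 1).centralBinom := by rw [h2]
    push_cast at this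
    linear_combination this
  have h3' : ((i : ℚ) + 1) * (i + 1).centralBinom = 2 * (2 * i + 1) * i.centralBinom := by
    exact_mod_cast h3
  have hi : ((i : ℚ) + 1) ≠ 0 := by positivity
  apply mul_left_cancel₀ hi
  rw [h2', h3', ← h1']
  ring

lemma catalan_mul_eq_choose (i : ℕ) :
    (2 * (i : ℚ) + 1) * catalan i = (2 * i + 1).choose (i + 1) := by
  have h1 := succ_mul_catalan_eq_centralBinom i
  have h1' : ((i : ℚ) + 1) * catalan i = i.centralBinom := by exact_mod_cast h1
  have h2 := Nat.add_one_mul_choose_eq (2 * i) i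
  have h2' : ((2 * i + 1 : ℕ) : ℚ) * ((2 * i).choose i : ℕ) =
      ((2 * i + 1).choose (i + 1) : ℕ) * (i + 1 : ℕ) := by exact_mod_cast h2
  rw [Nat.centralBinom_eq_two_mul_choose] at h1'
  have hi : ((i : ℚ) + 1) ≠ 0 := by positivity
  apply mul_left_cancel₀ hi
  push_cast at h2'
  linear_combination (2 * (i : ℚ) + 1) * h1' + h2'

/-- The number of trees, with `n = m + j + 1` and `i = j + 1`. The assumption excludes `n = 1`,
where the second factor of the denominator vanishes. -/
lemma count_eq_aux (m j : ℕ) (h : 0 < 2 * m + j) :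
    (count (m + j + 1) (j + 1) : ℚ) = (j : ℚ) / ((4 * m + 2 * j + 1) * (2 * m + j)) *
      (2 * j + 1).choose (j + 1) * (4 * m + 2 * j + 1).choose m := by
  rw [count_eq_raney, ← catalan_mul_eq_choose]
  have hc := catalan_succ_mul j
  have h0 : (2 * (m : ℚ) + j) ≠ 0 := by exact_mod_cast h.ne'
  have h1 : (4 * (m : ℚ) + 2 * j + 1) ≠ 0 := by positivity
  have h2 : ((j : ℚ) + 2) ≠ 0 := by positivity
  have hc' : (catalan (j + 1) : ℚ) = 2 * (2 * j + 1) * catalan j / (j + 2) := by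
    rw [eq_div_iff h2, ← hc]; ring
  rw [raney_eq (2 * j) m, hc']
  cases m with
  | zero =>
    have hj : (j : ℚ) ≠ 0 := by simpa using h0
    rw [zero_add, coeff_X_pow_mul', if_neg (by omega)]
    push_cast
    simp
    field_simp
  | succ m =>
    have e : m + 1 + j + 1 = m + (j + 2) := by ring
    rw [e, coeff_X_pow_mul, raneySeries, coeff_mk, raney_eq (2 * j + 3) m]
    have hch := Nat.add_one_mul_choose_eq (4 * m + 2 * j + 4) m
    have hch' : ((4 * m + 2 * j + 4 + 1 : ℕ) : ℚ) * ((4 * m + 2 * j + 4).choose m : ℕ) =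
      ((4 * m + 2 * j + 4 + 1).choose (m + 1) : ℕ) * (m + 1 : ℕ) := by exact_mod_cast hch
    rw [show 4 * m + (2 * j + 3) + 1 = 4 * m + 2 * j + 4 by ring,
      show 4 * (m + 1) + 2 * j + 1 = 4 * m + 2 * j + 4 + 1 by ring]
    have h3 : (4 * (m : ℚ) + 2 * j + 4) ≠ 0 := by positivity
    push_cast at *
    have h4 : (4 * (m : ℚ) + 2 * j + 4 + 1) ≠ 0 := by positivity
    have hx : ((4 * m + 2 * j + 4).choose m : ℚ) =
        (4 * m + 2 * j + 4 + 1).choose (m + 1) * (m + 1) / (4 * m + 2 * j + 4 + 1) := by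
      rw [eq_div_iff h4, ← hch']; ring
    rw [hx]
    have h5 : 4 * ((m : ℚ) + 1) + 2 * j + 1 = 4 * m + 2 * j + 4 + 1 := by ring
    have h6 : 2 * ((m : ℚ) + 1) + j = (4 * m + 2 * j + 4) / 2 := by ring
    have h7 : 4 * (m : ℚ) + (2 * j + 3) + 1 = 4 * m + 2 * j + 4 := by ring
    rw [h5, h6, h7]
    field_simp
    ring

theorem count_eq {n i : ℕ} (hn : 2 ≤ n) (hi : 1 ≤ i) (hin : i ≤ n) :
    (count n i : ℚ) = ((i : ℚ) - 1) / ((4 * (n : ℚ) - 2 * i - 1) * (2 * (n : ℚ) - i - 1)) *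
        (2 * i - 1).choose i * (4 * n - 2 * i - 1).choose (n - i) := by
  obtain ⟨j, rfl⟩ : ∃ j, i = j + 1 := ⟨i - 1, by omega⟩
  obtain ⟨m, rfl⟩ : ∃ m, n = m + j + 1 := ⟨n - (j + 1), by omega⟩
  rw [count_eq_aux m j (by omega), show 2 * (j + 1) - 1 = 2 * j + 1 by omega,
    show 4 * (m + j + 1) - 2 * (j + 1) - 1 = 4 * m + 2 * j + 1 by omega,
    show m + j + 1 - (j + 1) = m by omega]
  push_cast
  ring_nf

theorem count_eq_factorial {n i : ℕ} (hn : 2 ≤ n) (hi : 2 ≤ i) (hin : i ≤ n) :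
    (count n i : ℚ) = 2 * (2 * i - 1).factorial * (4 * n - 2 * i - 3).factorial /
          ((i - 2).factorial * i.factorial * (n - i).factorial * (3 * n - i - 1).factorial) := by
  obtain ⟨k, rfl⟩ : ∃ k, i = k + 2 := ⟨i - 2, by omega⟩
  obtain ⟨m, rfl⟩ : ∃ m, n = m + (k + 1) + 1 := ⟨n - (k + 2), by omega⟩
  have h := count_eq_aux m (k + 1) (by omega)
  rw [show k + 2 = k + 1 + 1 from rfl, h,
    Nat.cast_choose ℚ (by omega : k + 1 + 1 ≤ 2 * (k + 1) + 1),
    Nat.cast_choose ℚ (by omega : m ≤ 4 * m + 2 * (k + 1) + 1),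
    show 2 * (k + 1 + 1) - 1 = 2 * (k + 1) + 1 by omega,
    show 4 * (m + (k + 1) + 1) - 2 * (k + 1 + 1) - 3 = 4 * m + 2 * k + 1 by omega,
    show k + 1 + 1 - 2 = k by omega, show m + (k + 1) + 1 - (k + 1 + 1) = m by omega,
    show 3 * (m + (k + 1) + 1) - (k + 1 + 1) - 1 = 3 * m + 2 * k + 3 by omega,
    show 2 * (k + 1) + 1 - (k + 1 + 1) = k + 1 by omega,
    show 4 * m + 2 * (k + 1) + 1 = 4 * m + 2 * k + 1 + 1 + 1 by ring,
    show 4 * m + 2 * k + 1 + 1 + 1 - m = 3 * m + 2 * k + 3 by omega]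
  rw [Nat.factorial_succ (4 * m + 2 * k + 1 + 1), Nat.factorial_succ (4 * m + 2 * k + 1),
    Nat.factorial_succ k]
  have h1 := Nat.cast_ne_zero (R := ℚ).2 (Nat.factorial_ne_zero k)
  have h2 := Nat.cast_ne_zero (R := ℚ).2 (Nat.factorial_ne_zero (k + 1 + 1))
  have h3 := Nat.cast_ne_zero (R := ℚ).2 (Nat.factorial_ne_zero m)
  have h4 := Nat.cast_ne_zero (R := ℚ).2 (Nat.factorial_ne_zero (3 * m + 2 * k + 3))
  have h5 : (4 * (m : ℚ) + 2 * (k + 1) + 1) ≠ 0 := by positivity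
  have h6 : (2 * (m : ℚ) + (k + 1)) ≠ 0 := by positivity
  have h7 : ((k : ℚ) + 1) ≠ 0 := by positivity
  push_cast
  rw [show 4 * (m : ℚ) + 2 * k + 1 + 1 + 1 = 4 * m + 2 * (k + 1) + 1 by ring,
    show 4 * (m : ℚ) + 2 * k + 1 + 1 = 2 * (2 * m + (k + 1)) by ring]
  field_simp

end Code

/-! ### Counting classes of an equivalence relation after a merger -/

namespace Setoid

variable {H : Type*}

/-- The equivalence relation obtained from `s` by merging the classes of `x` and `y`. -/
def mergeClasses (s : Setoid H) (x y : H) : Setoid H where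
  r a b := s a b ∨ (s a x ∨ s a y) ∧ (s b x ∨ s b y)
  iseqv :=
    { refl := fun a => Or.inl (s.refl a)
      symm := by
        rintro a b (h | h)
        · exact Or.inl (s.symm h)
        · exact Or.inr h.symm
      trans := by
        rintro a b c (h | h) (k | k)
        · exact Or.inl (s.trans h k)
        · exact Or.inr ⟨k.1.imp (s.trans h) (s.trans h), k.2⟩
        · exact Or.inr ⟨h.1, h.2.imp (s.trans (s.symm k)) (s.trans (s.symm k))⟩
        · exact Or.inr ⟨h.1, k.2⟩ }

lemma mergeClasses_iff {s : Setoid H} {x y a b : H} :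
    s.mergeClasses x y a b ↔ s a b ∨ (s a x ∨ s a y) ∧ (s b x ∨ s b y) := Iff.rfl

lemma mergeClasses_of_rel {s : Setoid H} {x y : H} (h : s x y) : s.mergeClasses x y = s := by
  ext a b
  rw [mergeClasses_iff]
  refine ⟨?_, Or.inl⟩
  rintro (k | ⟨k, k'⟩)
  · exact k
  · have h1 : s a x := k.elim id fun k => s.trans k (s.symm h)
    have h2 : s b x := k'.elim id fun k => s.trans k (s.symm h)
    exact s.trans h1 (s.symm h2)

/-- The number of classes of `s` that meet the set `V`. -/
noncomputable def classesMeeting (s : Setoid H) (V : Set H) : ℕ := (Quotient.mk s '' V).ncard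

/-- The number of classes of `s`. -/
noncomputable def numClasses (s : Setoid H) : ℕ := Nat.card (Quotient s)

lemma classesMeeting_univ (s : Setoid H) : s.classesMeeting Set.univ = s.numClasses := by
  rw [classesMeeting, Set.image_univ, Set.range_eq_univ.2 Quotient.mk_surjective, Set.ncard_univ,
    numClasses]

lemma classesMeeting_congr {s t : Setoid H} {V : Set H}
    (h : ∀ a ∈ V, ∀ b ∈ V, (s a b ↔ t a b)) : s.classesMeeting V = t.classesMeeting V := by
  unfold classesMeeting
  refine Set.ncard_congr' (Equiv.ofBijective (fun q => ⟨Quotient.mk t q.2.choose,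
    ⟨_, q.2.choose_spec.1, rfl⟩⟩) ⟨?_, ?_⟩)
  · intro q q' e
    have e1 := Quotient.exact (congrArg Subtype.val e)
    have e2 := (h _ q.2.choose_spec.1 _ q'.2.choose_spec.1).2 e1
    ext
    rw [← q.2.choose_spec.2, ← q'.2.choose_spec.2]
    exact Quotient.sound e2
  · rintro ⟨_, ⟨a, ha, rfl⟩⟩
    have hq : Quotient.mk s a ∈ Quotient.mk s '' V := ⟨a, ha, rfl⟩
    refine ⟨⟨_, hq⟩, Subtype.ext (Quotient.sound ?_)⟩
    exact (h _ hq.choose_spec.1 _ ha).1 (Quotient.exact hq.choose_spec.2)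

/-- An element may be left out of `V` if its class is met elsewhere. -/
lemma classesMeeting_eq_of_subset {s : Setoid H} {V W : Set H} (hW : W ⊆ V)
    (h : ∀ v ∈ V, ∃ w ∈ W, s v w) : s.classesMeeting V = s.classesMeeting W := by
  unfold classesMeeting
  congr 1
  refine Set.Subset.antisymm ?_ (Set.image_mono hW)
  rintro _ ⟨v, hv, rfl⟩
  obtain ⟨w, hw, h⟩ := h v hv
  exact ⟨w, hw, Quotient.sound (s.symm h)⟩

/-- A merger of two classes that meet `V` lowers the number of classes meeting `V` by one. -/
lemma classesMeeting_mergeClasses [Finite H] {s : Setoid H} {x y : H} (h : ¬ s x y) {V : Set H}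
    (hx : x ∈ V) (hy : y ∈ V) :
    (s.mergeClasses x y).classesMeeting V + 1 = s.classesMeeting V := by
  have h1 : (s.mergeClasses x y).classesMeeting V =
      (s.mergeClasses x y).classesMeeting {v ∈ V | ¬ s v y} := by
    refine classesMeeting_eq_of_subset (Set.sep_subset _ _) fun v hv => ?_
    by_cases k : s v y
    · exact ⟨x, ⟨hx, h⟩, Or.inr ⟨Or.inr k, Or.inl (s.refl x)⟩⟩
    · exact ⟨v, ⟨hv, k⟩, Setoid.refl' _ v⟩
  have h2 : (s.mergeClasses x y).classesMeeting {v ∈ V | ¬ s v y} =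
      s.classesMeeting {v ∈ V | ¬ s v y} := by
    refine classesMeeting_congr fun a ha b hb => ⟨?_, Or.inl⟩
    rintro (k | ⟨k, k'⟩)
    · exact k
    · exact s.trans (k.resolve_right ha.2) (s.symm (k'.resolve_right hb.2))
  rw [h1, h2]
  unfold classesMeeting
  have h3 : Quotient.mk s '' V = insert (Quotient.mk s y) (Quotient.mk s '' {v ∈ V | ¬ s v y}) := by
    ext q
    constructor
    · rintro ⟨v, hv, rfl⟩
      by_cases k : s v y
      · exact Or.inl (Quotient.sound k)
      · exact Or.inr ⟨v, ⟨hv, k⟩, rfl⟩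
    · rintro (rfl | ⟨v, hv, rfl⟩)
      · exact ⟨y, hy, rfl⟩
      · exact ⟨v, hv.1, rfl⟩
  rw [h3, Set.ncard_insert_of_notMem _ (Set.toFinite _)]
  rintro ⟨v, hv, e⟩
  exact hv.2 (Quotient.exact e)

lemma numClasses_mergeClasses [Finite H] {s : Setoid H} {x y : H} (h : ¬ s x y) :
    (s.mergeClasses x y).numClasses + 1 = s.numClasses := by
  rw [← classesMeeting_univ, ← classesMeeting_univ]
  exact classesMeeting_mergeClasses h trivial trivial

/-- The class numbers of a relation on a disjoint union of two sets and a point add up. -/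
lemma numClasses_option_sum {X Y : Type*} [Finite X] [Finite Y] {s : Setoid (Option (X ⊕ Y))}
    {t : Setoid X} {u : Setoid Y}
    (ht : ∀ a b, s (some (Sum.inl a)) (some (Sum.inl b)) ↔ t a b)
    (hu : ∀ a b, s (some (Sum.inr a)) (some (Sum.inr b)) ↔ u a b)
    (htu : ∀ a b, ¬ s (some (Sum.inl a)) (some (Sum.inr b))) (hn : ∀ a, ¬ s (some a) none) :
    s.numClasses = t.numClasses + u.numClasses + 1 := by
  have e : Option (Quotient t ⊕ Quotient u) ≃ Quotient s := by
    refine Equiv.ofBijective (fun o => o.elim (Quotient.mk s none) (Sum.elim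
      (Quotient.map (sa := t) (sb := s) (fun a : X => some (Sum.inl a)) fun a b h => (ht a b).2 h)
      (Quotient.map (sa := u) (sb := s) (fun a : Y => some (Sum.inr a)) fun a b h => (hu a b).2 h)))
      ⟨?_, ?_⟩
    · have key : ∀ o : Option (Quotient t ⊕ Quotient u), ∃ p : Option (X ⊕ Y),
          o = p.map (Sum.map (Quotient.mk t) (Quotient.mk u)) := by
        rintro (_ | q | q)
        · exact ⟨none, rfl⟩
        · obtain ⟨a, rfl⟩ := Quotient.mk_surjective q
          exact ⟨some (Sum.inl a), rfl⟩
        · obtain ⟨a, rfl⟩ := Quotient.mk_surjective q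
          exact ⟨some (Sum.inr a), rfl⟩
      intro o o' h
      obtain ⟨p, rfl⟩ := key o
      obtain ⟨p', rfl⟩ := key o'
      rcases p with _ | a | a <;> rcases p' with _ | b | b
      · rfl
      · exact absurd (Setoid.symm' _ (Quotient.exact h)) (hn _)
      · exact absurd (Setoid.symm' _ (Quotient.exact h)) (hn _)
      · exact absurd (Quotient.exact h) (hn _)
      · exact congrArg (fun q => some (Sum.inl q)) (Quotient.sound ((ht a b).1 (Quotient.exact h)))
      · exact absurd (Quotient.exact h) (htu _ _)
      · exact absurd (Quotient.exact h) (hn _)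
      · exact absurd (Setoid.symm' _ (Quotient.exact h)) (htu _ _)
      · exact congrArg (fun q => some (Sum.inr q)) (Quotient.sound ((hu a b).1 (Quotient.exact h)))
    · rintro ⟨_ | a | a⟩
      · exact ⟨none, rfl⟩
      · exact ⟨some (Sum.inl (Quotient.mk t a)), rfl⟩
      · exact ⟨some (Sum.inr (Quotient.mk u a)), rfl⟩
  unfold numClasses
  rw [← Nat.card_congr e, Finite.card_option, Nat.card_sum]

end Setoid

/-! ### Cycles of a permutation and transpositions -/

namespace Equiv.Perm

variable {H : Type*} [DecidableEq H] [Finite H]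

/-- The cycles of a permutation, as an equivalence relation. -/
abbrev cycles (π : Perm H) : Setoid H := SameCycle.setoid π

omit [DecidableEq H] [Finite H] in
lemma sameCycle_of_rel {s : Setoid H} {π : Perm H} (h : ∀ a, s a (π a)) {a b : H}
    (hab : π.SameCycle a b) : s a b := by
  have key : ∀ n : ℕ, ∀ a, s a ((π ^ n) a) := by
    intro n
    induction n with
    | zero => exact fun a => s.refl a
    | succ n ih =>
      intro a
      rw [pow_succ', mul_apply]
      exact s.trans (ih a) (h _)
  obtain ⟨i, rfl⟩ := hab
  obtain ⟨n, rfl | rfl⟩ := i.eq_nat_or_neg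
  · exact key n a
  · have := key n ((π ^ (-(n : ℤ))) a)
    rw [← mul_apply, zpow_neg, zpow_natCast, mul_inv_cancel, one_apply] at this
    exact s.symm (by simpa using this)

omit [Finite H] in
lemma swap_mul_pow_apply {π : Perm H} {x y z : H} {k : ℕ}
    (h : ∀ j, 1 ≤ j → j ≤ k → (π ^ j) z ≠ x ∧ (π ^ j) z ≠ y) :
    ((swap x y * π) ^ k) z = (π ^ k) z := by
  induction k with
  | zero => rfl
  | succ k ih =>
    rw [pow_succ', mul_apply, ih fun j h1 h2 => h j h1 (by omega), mul_apply, ← mul_apply π,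
      ← pow_succ']
    exact swap_apply_of_ne_of_ne (h (k + 1) (by omega) le_rfl).1 (h (k + 1) (by omega) le_rfl).2

lemma sameCycle_swap_mul_self {π : Perm H} {x y : H} (h : ¬ π.SameCycle x y) :
    (swap x y * π).SameCycle x y := by
  obtain ⟨k, hk, hk'⟩ : ∃ k, 0 < k ∧ (π ^ k) y = y ∧ ∀ j, 0 < j → j < k → (π ^ j) y ≠ y := by
    have hex : ∃ k, 0 < k ∧ (π ^ k) y = y := by
      obtain ⟨k, hk, h⟩ := (isOfFinOrder_of_finite π).exists_pow_eq_one
      exact ⟨k, hk, by rw [h]; rfl⟩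
    classical
    exact ⟨Nat.find hex, (Nat.find_spec hex).1, (Nat.find_spec hex).2, fun j h1 h2 h3 =>
      Nat.find_min hex h2 ⟨h1, h3⟩⟩
  obtain ⟨k, rfl⟩ : ∃ j, k = j + 1 := ⟨k - 1, by omega⟩
  have h1 : ((swap x y * π) ^ k) y = (π ^ k) y := by
    refine swap_mul_pow_apply fun j h1 h2 => ⟨fun e => h ?_, hk'.2 j (by omega) (by omega)⟩
    exact (SameCycle.symm ⟨j, by simpa using e⟩)
  have h2 : ((swap x y * π) ^ (k + 1)) y = x := by
    rw [pow_succ', mul_apply, h1, mul_apply, ← mul_apply π, ← pow_succ', hk'.1, swap_apply_right]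
  exact SameCycle.symm ⟨(k + 1 : ℕ), by rw [zpow_natCast]; exact h2⟩

lemma SameCycle.swap_mul_of_not {π : Perm H} {x y : H} (h : ¬ π.SameCycle x y) {a b : H}
    (hab : π.SameCycle a b) : (swap x y * π).SameCycle a b := by
  have hxy := sameCycle_swap_mul_self h
  refine sameCycle_of_rel (s := (swap x y * π).cycles) (fun a => ?_) hab
  have h1 : (swap x y * π).SameCycle a ((swap x y * π) a) := ⟨1, by simp⟩
  by_cases e : π a = x
  · rw [mul_apply, e, swap_apply_left] at h1
    rw [e]
    exact h1.trans hxy.symm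
  by_cases e' : π a = y
  · rw [mul_apply, e', swap_apply_right] at h1
    rw [e']
    exact h1.trans hxy
  rwa [mul_apply, swap_apply_of_ne_of_ne e e'] at h1

omit [Finite H] in
lemma SameCycle.mergeClasses_of_swap_mul {π : Perm H} {x y a b : H}
    (hab : (swap x y * π).SameCycle a b) : π.cycles.mergeClasses x y a b := by
  refine sameCycle_of_rel (fun a => ?_) hab
  have h1 : π.SameCycle a (π a) := ⟨1, by simp⟩
  by_cases e : π a = x
  · rw [mul_apply, e, swap_apply_left]
    exact Or.inr ⟨Or.inl (e ▸ h1), Or.inr (SameCycle.refl _ _)⟩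
  by_cases e' : π a = y
  · rw [mul_apply, e', swap_apply_right]
    exact Or.inr ⟨Or.inr (e' ▸ h1), Or.inl (SameCycle.refl _ _)⟩
  rw [mul_apply, swap_apply_of_ne_of_ne e e']
  exact Or.inl h1

/-- Multiplication by a transposition of elements of distinct cycles merges the two cycles. -/
lemma cycles_swap_mul {π : Perm H} {x y : H} (h : ¬ π.SameCycle x y) :
    (swap x y * π).cycles = π.cycles.mergeClasses x y := by
  have hxy := sameCycle_swap_mul_self h
  ext a b
  refine ⟨SameCycle.mergeClasses_of_swap_mul, ?_⟩
  have up : ∀ {a b}, π.SameCycle a b → (swap x y * π).SameCycle a b :=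
    fun hab => SameCycle.swap_mul_of_not h hab
  have h1 : ∀ a, π.SameCycle a x ∨ π.SameCycle a y → (swap x y * π).SameCycle a x := by
    rintro a (k | k)
    · exact up k
    · exact (up k).trans hxy.symm
  rintro (k | ⟨k, k'⟩)
  · exact up k
  · exact (h1 a k).trans (h1 b k').symm

/-- Multiplication by a transposition of elements of the same cycle separates the two. -/
lemma not_sameCycle_swap_mul {π : Perm H} {x y : H} (hne : x ≠ y) (h : π.SameCycle x y) :
    ¬ (swap x y * π).SameCycle x y := by
  classical
  have hex : ∃ k : ℕ, (π ^ k) x = y := by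
    obtain ⟨k, -, hk⟩ := h.exists_pow_eq'
    exact ⟨k, hk⟩
  obtain ⟨k, hk, hmin⟩ : ∃ k, (π ^ k) x = y ∧ ∀ j < k, (π ^ j) x ≠ y :=
    ⟨Nat.find hex, Nat.find_spec hex, fun j hj => Nat.find_min hex hj⟩
  obtain ⟨k, rfl⟩ : ∃ j, k = j + 1 := by
    rcases k with _ | k
    · exact absurd hk hne
    · exact ⟨k, rfl⟩
  have h1 : ∀ i ≤ k, ((swap x y * π) ^ i) x = (π ^ i) x := by
    intro i hi
    refine swap_mul_pow_apply fun j h1 h2 => ⟨fun e => ?_, hmin j (by omega)⟩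
    refine hmin (k + 1 - j) (by omega) ?_
    rw [← hk, show k + 1 = (k + 1 - j) + j by omega, pow_add, mul_apply, e]
    congr 2
    omega
  have h2 : ((swap x y * π) ^ (k + 1)) x = x := by
    rw [pow_succ', mul_apply, h1 k le_rfl, mul_apply, ← mul_apply π, ← pow_succ', hk,
      swap_apply_right]
  intro hs
  obtain ⟨i, -, hi⟩ := hs.exists_pow_eq'
  have h3 : ((swap x y * π) ^ (i % (k + 1))) x = y := by
    refine Eq.trans ?_ hi
    conv_rhs => rw [← Nat.mod_add_div i (k + 1), pow_add, mul_apply, pow_mul]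
    have : ∀ m : ℕ, (((swap x y * π) ^ (k + 1)) ^ m) x = x := by
      intro m
      induction m with
      | zero => rfl
      | succ m ih => rw [pow_succ, mul_apply, h2, ih]
    rw [this]
  have hlt : i % (k + 1) < k + 1 := Nat.mod_lt i (Nat.succ_pos k)
  rw [h1 _ (by omega)] at h3
  exact hmin _ hlt h3

lemma cycles_eq_of_sameCycle {π : Perm H} {x y : H} (hne : x ≠ y) (h : π.SameCycle x y) :
    π.cycles = (swap x y * π).cycles.mergeClasses x y := by
  have := cycles_swap_mul (not_sameCycle_swap_mul hne h)
  rwa [← mul_assoc, swap_mul_self, one_mul] at this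

lemma numClasses_swap_mul_of_not {π : Perm H} {x y : H} (h : ¬ π.SameCycle x y) :
    (swap x y * π).cycles.numClasses + 1 = π.cycles.numClasses := by
  rw [cycles_swap_mul h]
  exact Setoid.numClasses_mergeClasses h

lemma numClasses_swap_mul_of_sameCycle {π : Perm H} {x y : H} (hne : x ≠ y)
    (h : π.SameCycle x y) : (swap x y * π).cycles.numClasses = π.cycles.numClasses + 1 := by
  rw [cycles_eq_of_sameCycle hne h]
  exact (Setoid.numClasses_mergeClasses (not_sameCycle_swap_mul hne h)).symm

/-- Multiplication by `swap x (π x)` takes `x` out of its cycle. -/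
lemma sameCycle_swap_apply_mul_iff {π : Perm H} {x a b : H} (ha : a ≠ x) (hb : b ≠ x) :
    (swap x (π x) * π).SameCycle a b ↔ π.SameCycle a b := by
  by_cases hx : π x = x
  · rw [hx, swap_self]
    rfl
  have hfix : (swap x (π x) * π) x = x := by simp
  have hs : π.SameCycle x (π x) := ⟨1, by simp⟩
  have e := cycles_eq_of_sameCycle (Ne.symm hx) hs
  have hcl : ∀ {c}, (swap x (π x) * π).SameCycle c x → c = x := fun h => h.eq_of_right hfix
  constructor
  · intro h
    change π.cycles a b
    rw [e]
    exact Or.inl h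
  · intro h
    change π.cycles a b at h
    rw [e] at h
    rcases h with h | ⟨h, h'⟩
    · exact h
    · exact (h.resolve_left fun k => ha (hcl k)).trans (h'.resolve_left fun k => hb (hcl k)).symm

end Equiv.Perm

/-! ### The genus of a pair of permutations -/

namespace PermPair

open Equiv Equiv.Perm

variable {H : Type*}

/-- The orbits of the group generated by `σ` and `α`, as an equivalence relation. -/
def conn (σ α : Perm H) : Setoid H := Relation.EqvGen.setoid fun a b => b = σ a ∨ b = α a

lemma conn_apply_left (σ α : Perm H) (a : H) : conn σ α a (σ a) :=
  Relation.EqvGen.rel _ _ (Or.inl rfl)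

lemma conn_apply_right (σ α : Perm H) (a : H) : conn σ α a (α a) :=
  Relation.EqvGen.rel _ _ (Or.inr rfl)

lemma rel_of_conn {s : Setoid H} {σ α : Perm H} (h1 : ∀ a, s a (σ a)) (h2 : ∀ a, s a (α a))
    {a b : H} (h : conn σ α a b) : s a b := by
  refine (Setoid.eqvGen_le (s := s) (r := fun a b => b = σ a ∨ b = α a) ?_) h
  rintro a b (rfl | rfl)
  · exact h1 a
  · exact h2 a

lemma eq_of_conn_of_fixed {σ α : Perm H} {r x : H} (hσ : σ r = r) (hα : α r = r)
    (h : conn σ α r x) : x = r := by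
  have key : (r = r) = (x = r) := by
    refine rel_of_conn (s := Setoid.ker fun x => x = r) (fun x => ?_) (fun x => ?_) h
    · exact propext ⟨fun e => e ▸ hσ, fun e => σ.injective (e.trans hσ.symm)⟩
    · exact propext ⟨fun e => e ▸ hα, fun e => α.injective (e.trans hα.symm)⟩
  exact key.mp rfl

lemma conn_of_sameCycle {σ α : Perm H} {a b : H} (h : σ.SameCycle a b) : conn σ α a b :=
  sameCycle_of_rel (conn_apply_left σ α) h

lemma conn_of_sameCycle_right {σ α : Perm H} {a b : H} (h : α.SameCycle a b) : conn σ α a b :=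
  sameCycle_of_rel (conn_apply_right σ α) h

lemma conn_of_sameCycle_mul {σ α : Perm H} {a b : H} (h : (σ * α).SameCycle a b) :
    conn σ α a b :=
  sameCycle_of_rel (fun a => Setoid.trans' _ (conn_apply_right σ α a) (conn_apply_left σ α _)) h

lemma conn_inv (σ α : Perm H) : conn α⁻¹ σ⁻¹ = conn σ α := by
  ext a b
  constructor
  · refine rel_of_conn (fun a => ?_) fun a => ?_
    · have := conn_apply_right σ α (α⁻¹ a)
      rw [show α (α⁻¹ a) = a by simp] at this
      exact Setoid.symm' _ this
    · have := conn_apply_left σ α (σ⁻¹ a)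
      rw [show σ (σ⁻¹ a) = a by simp] at this
      exact Setoid.symm' _ this
  · refine rel_of_conn (fun a => ?_) fun a => ?_
    · have := conn_apply_right α⁻¹ σ⁻¹ (σ a)
      rw [show σ⁻¹ (σ a) = a by simp] at this
      exact Setoid.symm' _ this
    · have := conn_apply_left α⁻¹ σ⁻¹ (α a)
      rw [show α⁻¹ (α a) = a by simp] at this
      exact Setoid.symm' _ this

/-- Twice the total genus of the pair `(σ, α)`, by the Riemann–Hurwitz formula. Disconnected pairs
are admitted, and `α` need not be an involution. -/
noncomputable def genus (σ α : Perm H) : ℤ :=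
  2 * (conn σ α).numClasses + Nat.card H - σ.cycles.numClasses - α.cycles.numClasses -
    (σ * α).cycles.numClasses

lemma cycles_inv (π : Perm H) : (π⁻¹).cycles = π.cycles := by
  ext a b
  exact sameCycle_inv

/-- Exchange of the vertices and the edges: facts about multiplication of `σ` by transpositions on
the left become facts about multiplication of `α` on the right. -/
lemma genus_inv (σ α : Perm H) : genus α⁻¹ σ⁻¹ = genus σ α := by
  unfold genus
  rw [conn_inv, cycles_inv, cycles_inv, ← mul_inv_rev, cycles_inv]
  ring

variable [DecidableEq H] [Finite H]

omit [Finite H] in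
lemma conn_swap_mul_le {σ α : Perm H} {x y a b : H} (h : conn (swap x y * σ) α a b) :
    (conn σ α).mergeClasses x y a b := by
  refine rel_of_conn (fun a => ?_) (fun a => Or.inl (conn_apply_right σ α a)) h
  have h1 : (swap x y * σ).SameCycle a ((swap x y * σ) a) := ⟨1, by simp⟩
  rcases SameCycle.mergeClasses_of_swap_mul h1 with k | ⟨k, k'⟩
  · exact Or.inl (conn_of_sameCycle k)
  · exact Or.inr ⟨k.imp conn_of_sameCycle conn_of_sameCycle,
      k'.imp conn_of_sameCycle conn_of_sameCycle⟩

lemma conn_swap_mul {σ α : Perm H} {x y : H} (h : ¬ σ.SameCycle x y) :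
    conn (swap x y * σ) α = (conn σ α).mergeClasses x y := by
  have hxy : conn (swap x y * σ) α x y := conn_of_sameCycle (sameCycle_swap_mul_self h)
  ext a b
  refine ⟨conn_swap_mul_le, ?_⟩
  have up : ∀ {a b}, conn σ α a b → conn (swap x y * σ) α a b := by
    intro a b hab
    refine rel_of_conn (fun a => ?_) (fun a => conn_apply_right _ _ a) hab
    exact conn_of_sameCycle (SameCycle.swap_mul_of_not h ⟨1, by simp⟩)
  have h1 : ∀ a, conn σ α a x ∨ conn σ α a y → conn (swap x y * σ) α a x := by
    rintro a (k | k)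
    · exact up k
    · exact Setoid.trans' _ (up k) (Setoid.symm' _ hxy)
  rintro (k | ⟨k, k'⟩)
  · exact up k
  · exact Setoid.trans' _ (h1 a k) (Setoid.symm' _ (h1 b k'))

/-- The genus does not change if two vertices are merged at corners of a common face. -/
lemma genus_swap_mul_of_sameCycle {σ α : Perm H} {x y : H} (h : ¬ σ.SameCycle x y)
    (hf : (σ * α).SameCycle x y) : genus (swap x y * σ) α = genus σ α := by
  have hne : x ≠ y := fun e => h (e ▸ SameCycle.refl _ _)
  have h1 := numClasses_swap_mul_of_not h
  have h2 := numClasses_swap_mul_of_sameCycle hne hf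
  have h3 : conn (swap x y * σ) α = conn σ α := by
    rw [conn_swap_mul h, Setoid.mergeClasses_of_rel (conn_of_sameCycle_mul hf)]
  unfold genus
  rw [h3, mul_assoc, h2, ← h1]
  push_cast
  ring

/-- The genus does not change if two connected components are joined by merging vertices. -/
lemma genus_swap_mul_of_not_conn {σ α : Perm H} {x y : H} (hc : ¬ conn σ α x y) :
    genus (swap x y * σ) α = genus σ α := by
  have h : ¬ σ.SameCycle x y := fun k => hc (conn_of_sameCycle k)
  have hf : ¬ (σ * α).SameCycle x y := fun k => hc (conn_of_sameCycle_mul k)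
  have h1 := numClasses_swap_mul_of_not h
  have h2 := numClasses_swap_mul_of_not hf
  have h3 := Setoid.numClasses_mergeClasses hc
  unfold genus
  rw [conn_swap_mul h, mul_assoc, ← h1, ← h2, ← h3]
  push_cast
  ring

/-- The genus grows if two vertices of a component are merged at corners of distinct faces. -/
lemma genus_swap_mul_of_conn {σ α : Perm H} {x y : H} (h : ¬ σ.SameCycle x y)
    (hf : ¬ (σ * α).SameCycle x y) (hc : conn σ α x y) :
    genus (swap x y * σ) α = genus σ α + 2 := by
  have h1 := numClasses_swap_mul_of_not h
  have h2 := numClasses_swap_mul_of_not hf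
  unfold genus
  rw [conn_swap_mul h, Setoid.mergeClasses_of_rel hc, mul_assoc, ← h1, ← h2]
  push_cast
  ring

lemma genus_le_swap_mul {σ α : Perm H} {x y : H} (h : ¬ σ.SameCycle x y) :
    genus σ α ≤ genus (swap x y * σ) α := by
  by_cases hf : (σ * α).SameCycle x y
  · rw [genus_swap_mul_of_sameCycle h hf]
  by_cases hc : conn σ α x y
  · rw [genus_swap_mul_of_conn h hf hc]
    omega
  · rw [genus_swap_mul_of_not_conn hc]

omit [DecidableEq H] [Finite H] in
lemma genus_one_left (α : Perm H) : genus 1 α = 0 := by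
  have h1 : (1 : Perm H).cycles.numClasses = Nat.card H := by
    refine Nat.card_congr (Equiv.ofBijective (Quotient.mk _) ⟨fun a b e => ?_,
      Quotient.mk_surjective⟩).symm
    exact sameCycle_one.1 (Quotient.exact e)
  have h2 : conn 1 α = α.cycles := by
    ext a b
    exact ⟨rel_of_conn (s := α.cycles) (fun a => SameCycle.refl _ _) fun a => ⟨1, by simp⟩,
      conn_of_sameCycle_right⟩
  unfold genus
  rw [h1, h2, one_mul]
  ring

/-- The half-edges are isolated one after the other. None of these steps raises the genus, and in
the end `σ = 1`. -/
lemma genus_nonneg (σ α : Perm H) : 0 ≤ genus σ α := by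
  induction hk : {x | σ x ≠ x}.ncard using Nat.strong_induction_on generalizing σ with
  | _ k ih =>
    by_cases h : ∃ x, σ x ≠ x
    · obtain ⟨x, hx⟩ := h
      have hs : σ.SameCycle x (σ x) := ⟨1, by simp⟩
      have h1 := not_sameCycle_swap_mul (Ne.symm hx) hs
      have h2 := genus_le_swap_mul (α := α) h1
      rw [← mul_assoc, swap_mul_self, one_mul] at h2
      refine (ih _ ?_ _ rfl).trans h2
      rw [← hk]
      refine Set.ncard_lt_ncard ⟨fun y hy => ?_, fun hsub => ?_⟩ (Set.toFinite _)
      · intro e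
        have hy' : (swap x (σ x) * σ) y ≠ y := hy
        rw [mul_apply, e] at hy'
        by_cases e1 : y = x
        · exact hx (e1 ▸ e)
        by_cases e2 : y = σ x
        · rw [e2] at e
          exact hx (σ.injective e)
        · exact hy' (swap_apply_of_ne_of_ne e1 e2)
      · have : (swap x (σ x) * σ) x ≠ x := hsub hx
        simp at this
    · push Not at h
      have : σ = 1 := Equiv.ext h
      rw [this, genus_one_left]

/-- Splitting a vertex of a planar map yields a planar map. -/
lemma genus_swap_mul_eq_zero {σ α : Perm H} {x y : H} (hne : x ≠ y) (h : σ.SameCycle x y)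
    (h0 : genus σ α = 0) : genus (swap x y * σ) α = 0 := by
  have h1 := genus_le_swap_mul (α := α) (not_sameCycle_swap_mul hne h)
  rw [← mul_assoc, swap_mul_self, one_mul, h0] at h1
  exact le_antisymm h1 (genus_nonneg _ _)

/-- Splitting a vertex of a planar map at two corners of a common face disconnects the map. -/
lemma not_conn_swap_mul {σ α : Perm H} {x y : H} (hne : x ≠ y) (h : σ.SameCycle x y)
    (hf : (σ * α).SameCycle x y) (h0 : genus σ α = 0) : ¬ conn (swap x y * σ) α x y := by
  intro hc
  have h1 := not_sameCycle_swap_mul hne h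
  have h2 := not_sameCycle_swap_mul hne hf
  rw [← mul_assoc] at h2
  have h3 := genus_swap_mul_of_conn h1 h2 hc
  rw [← mul_assoc, swap_mul_self, one_mul, h0] at h3
  have := genus_nonneg (swap x y * σ) α
  omega

end PermPair

/-! ### Cutting a planar bridgeless map -/

namespace Equiv.Perm

variable {H : Type*} [Finite H]

/-- The length of the cycle of `x`. -/
noncomputable abbrev period (π : Perm H) (x : H) : ℕ := Function.minimalPeriod π x

lemma period_pos (π : Perm H) (x : H) : 0 < π.period x := by
  obtain ⟨k, hk, h⟩ := (isOfFinOrder_of_finite π).exists_pow_eq_one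
  refine Function.IsPeriodicPt.minimalPeriod_pos hk ?_
  change (π^[k]) x = x
  rw [iterate_eq_pow, h, one_apply]

lemma pow_period (π : Perm H) (x : H) : (π ^ π.period x) x = x := by
  rw [← iterate_eq_pow]
  exact Function.iterate_minimalPeriod

lemma pow_apply_inj {π : Perm H} {x : H} {i j : ℕ} (hi : i < π.period x) (hj : j < π.period x)
    (h : (π ^ i) x = (π ^ j) x) : i = j := by
  rw [← iterate_eq_pow, ← iterate_eq_pow] at h
  exact (Function.iterate_eq_iterate_iff_of_lt_minimalPeriod hi hj).1 h

lemma SameCycle.exists_pow_lt_period {π : Perm H} {x y : H} (h : π.SameCycle x y) :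
    ∃ i < π.period x, (π ^ i) x = y := by
  obtain ⟨i, -, hi⟩ := h.exists_pow_eq'
  refine ⟨i % π.period x, Nat.mod_lt _ (period_pos π x), ?_⟩
  rw [← hi, ← iterate_eq_pow, ← iterate_eq_pow, Function.iterate_mod_minimalPeriod_eq]

lemma sameCycle_pow_self (π : Perm H) (x : H) (k : ℕ) : π.SameCycle x ((π ^ k) x) :=
  ⟨k, by simp⟩

lemma sameCycle_apply_self (π : Perm H) (x : H) : π.SameCycle x (π x) := ⟨1, by simp⟩

lemma period_le {π : Perm H} {x : H} {k : ℕ} (hk : 0 < k) (h : (π ^ k) x = x) :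
    π.period x ≤ k := by
  refine Function.IsPeriodicPt.minimalPeriod_le hk ?_
  change (π^[k]) x = x
  rw [iterate_eq_pow, h]

lemma period_eq {π : Perm H} {x : H} {k : ℕ} (hk : 0 < k) (h : (π ^ k) x = x)
    (hmin : ∀ j, 0 < j → j < k → (π ^ j) x ≠ x) : π.period x = k := by
  refine le_antisymm (period_le hk h) ?_
  by_contra! hlt
  exact hmin _ (period_pos π x) hlt (pow_period π x)

lemma cycles_mul_swap [DecidableEq H] {π : Perm H} {x y : H} (h : ¬ π.SameCycle x y) :
    (π * swap x y).cycles = π.cycles.mergeClasses x y := by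
  have h1 := cycles_swap_mul (π := π⁻¹) (fun k => h (sameCycle_inv.1 k))
  rw [← PermPair.cycles_inv, mul_inv_rev, swap_inv, h1, PermPair.cycles_inv]

end Equiv.Perm

lemma Setoid.rel_swap {H : Type*} [DecidableEq H] {s : Setoid H} {x y : H} (h : s x y) (a : H) :
    s a (Equiv.swap x y a) := by
  by_cases h1 : a = x
  · rw [h1, Equiv.swap_apply_left]
    exact h
  by_cases h2 : a = y
  · rw [h2, Equiv.swap_apply_right]
    exact s.symm h
  rw [Equiv.swap_apply_of_ne_of_ne h1 h2]

namespace PermPair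

open Equiv Equiv.Perm

variable {H : Type*} [DecidableEq H] [Finite H]

/-- Cutting an edge of a planar map yields a planar map. -/
lemma genus_mul_swap_eq_zero {σ α : Perm H} {x y : H} (hne : x ≠ y) (h : α.SameCycle x y)
    (h0 : genus σ α = 0) : genus σ (α * swap x y) = 0 := by
  rw [← genus_inv] at h0 ⊢
  rw [mul_inv_rev, swap_inv]
  exact genus_swap_mul_eq_zero hne (sameCycle_inv.2 h) h0

/-- In a planar map, an edge with the same face on both sides is a bridge. -/
lemma not_conn_mul_swap {σ α : Perm H} {x y : H} (hne : x ≠ y) (h : α.SameCycle x y)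
    (hf : (σ * α).SameCycle x y) (h0 : genus σ α = 0) : ¬ conn σ (α * swap x y) x y := by
  rw [← genus_inv] at h0
  rw [← conn_inv, mul_inv_rev, swap_inv]
  refine not_conn_swap_mul hne (sameCycle_inv.2 h) ?_ h0
  rw [← mul_inv_rev]
  exact sameCycle_inv.2 hf

/-- Joining two half-edges at corners of a common face does not change the genus. -/
lemma genus_mul_swap_of_sameCycle {σ α : Perm H} {x y : H} (h : ¬ α.SameCycle x y)
    (hf : (σ * α).SameCycle x y) : genus σ (α * swap x y) = genus σ α := by
  rw [← genus_inv, ← genus_inv σ α, mul_inv_rev, swap_inv]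
  refine genus_swap_mul_of_sameCycle (fun k => h (sameCycle_inv.1 k)) ?_
  rw [← mul_inv_rev]
  exact sameCycle_inv.2 hf

/-- A pair of permutations, the second being an involution, which describes planar maps without
bridges: the genus vanishes, and no edge has the same face on both sides. Half-edges fixed by `α`
are dangling. -/
structure PlanarBridgeless (σ α : Perm H) : Prop where
  invol : ∀ h, α (α h) = h
  genus_eq : genus σ α = 0
  not_sameFace : ∀ h, α h ≠ h → ¬ (σ * α).SameCycle h (α h)

/-- The half-edge `r` is the only dangling one of its component. -/
structure RootAt (σ α : Perm H) (r : H) : Prop where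
  fixed : α r = r
  unique : ∀ h, conn σ α r h → α h = h → h = r

/-- The number of faces that are incident to the vertex of `r`. -/
noncomputable def vertexFaces (σ α : Perm H) (r : H) : ℕ :=
  (σ * α).cycles.classesMeeting {x | σ.SameCycle r x}

/-- The vertex permutation after a planar map has been cut along the edges of `l` and of `n`: the
half-edge `n` is isolated, and `l` is moved from its place before `r` to the place before `a`. -/
def cutVertex (σ : Perm H) (r l n a : H) : Perm H := swap l a * swap l r * swap n (σ n) * σ

/-- The situation in which a planar map with root `r` is cut: `l` is the last half-edge around the
root vertex, and `n` is the first half-edge along the root face such that the edge `{n, a}`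
separates the root face from the face of `l`. -/
structure CutData (σ α : Perm H) (r l n a : H) (p : ℕ) : Prop where
  good : PlanarBridgeless σ α
  root : RootAt σ α r
  ne_self : σ r ≠ r
  last : σ l = r
  left : ((σ * α) ^ p) r = n
  right : α n = a
  face : (σ * α).SameCycle l a
  first : ∀ i < p, ¬ (σ * α).SameCycle l (α (((σ * α) ^ i) r))

namespace CutData

variable {σ α : Perm H} {r l n a : H} {p : ℕ} (D : CutData σ α r l n a p)

include D

lemma ne_lr : l ≠ r := fun h => D.ne_self (h ▸ D.last)

lemma conn_rl : conn σ α r l := by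
  have := conn_apply_left σ α l
  rw [D.last] at this
  exact Setoid.symm' _ this

lemma face_r : (σ * α).SameCycle r (α l) := by
  have : (σ * α) (α l) = r := by rw [mul_apply, D.good.invol, D.last]
  have h := sameCycle_apply_self (σ * α) (α l)
  rw [this] at h
  exact h.symm

/-- The two sides of the edge of `l` are the root face and the face of `l`. They are distinct, since
the map is bridgeless. -/
lemma not_rl : ¬ (σ * α).SameCycle r l := by
  intro h
  refine D.good.not_sameFace l (fun e => D.ne_lr (D.root.unique l D.conn_rl e)) ?_
  exact h.symm.trans D.face_r

lemma face_rn : (σ * α).SameCycle r n := D.left ▸ sameCycle_pow_self _ _ _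

lemma not_na : ¬ (σ * α).SameCycle n a := fun h => D.not_rl (D.face_rn.trans (h.trans D.face.symm))

lemma not_ln : ¬ (σ * α).SameCycle l n := fun h => D.not_rl (D.face_rn.trans h.symm)

lemma not_ra : ¬ (σ * α).SameCycle r a := fun h => D.not_rl (h.trans D.face.symm)

lemma ne_na : n ≠ a := fun h => D.not_na (h ▸ SameCycle.refl _ _)

lemma ne_ln : l ≠ n := fun h => D.not_ln (h ▸ SameCycle.refl _ _)

lemma ne_ra : r ≠ a := fun h => D.not_ra (h ▸ SameCycle.refl _ _)

lemma alpha_a : α a = n := by rw [← D.right, D.good.invol]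

lemma ne_rn : r ≠ n := by
  rintro rfl
  exact D.ne_ra (D.root.fixed.symm.trans D.right)

lemma p_pos : 0 < p := by
  rcases Nat.eq_zero_or_pos p with rfl | h
  · exact absurd D.left D.ne_rn
  · exact h

lemma cutEdge_n : (α * swap n a) n = n := by rw [mul_apply, swap_apply_left, D.alpha_a]

lemma cutEdge_a : (α * swap n a) a = a := by rw [mul_apply, swap_apply_right, D.right]

omit D in
lemma cutEdge_of_ne {h : H} (h1 : h ≠ n) (h2 : h ≠ a) : (α * swap n a) h = α h := by
  rw [mul_apply, swap_apply_of_ne_of_ne h1 h2]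

lemma vertex_a : (σ * α) a = σ n := by rw [mul_apply, D.alpha_a]

lemma vertex_n_ne : σ n ≠ n := by
  intro h
  apply D.not_na
  have := sameCycle_apply_self (σ * α) a
  rw [D.vertex_a, h] at this
  exact this.symm

lemma vertex_n_ne_r : σ n ≠ r := fun h => D.ne_ln (σ.injective (D.last.trans h.symm))

lemma genus_cutEdge : genus σ (α * swap n a) = 0 := by
  refine genus_mul_swap_eq_zero D.ne_na ?_ D.good.genus_eq
  have := sameCycle_apply_self α n
  rwa [D.right] at this

lemma remove_n_l : (swap n (σ n) * σ) l = r := by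
  rw [mul_apply, D.last, swap_apply_of_ne_of_ne D.ne_rn (Ne.symm D.vertex_n_ne_r)]

lemma remove_n_n : (swap n (σ n) * σ) n = n := by simp

lemma remove_l_l : (swap l r * swap n (σ n) * σ) l = l := by
  rw [mul_assoc, mul_apply, D.remove_n_l, swap_apply_right]

lemma cut_l : cutVertex σ r l n a l = a := by
  rw [cutVertex, mul_assoc, mul_assoc, mul_apply, ← mul_assoc, D.remove_l_l, swap_apply_left]

lemma cut_n : cutVertex σ r l n a n = n := by
  rw [cutVertex, mul_assoc, mul_apply, D.remove_n_n, mul_apply,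
    swap_apply_of_ne_of_ne (Ne.symm D.ne_ln) (Ne.symm D.ne_rn),
    swap_apply_of_ne_of_ne (Ne.symm D.ne_ln) D.ne_na]

/-- When the edge `{n, a}` is cut, the root face and the face of `l` become one face. -/
lemma cycles_cutEdge : (σ * (α * swap n a)).cycles = (σ * α).cycles.mergeClasses n a := by
  rw [← mul_assoc]
  exact cycles_mul_swap D.not_na

lemma cutEdge_rl : (σ * (α * swap n a)).SameCycle l r := by
  change (σ * (α * swap n a)).cycles l r
  rw [D.cycles_cutEdge]
  exact Or.inr ⟨Or.inr D.face, Or.inl D.face_rn⟩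

/-- The isolation of the half-edge `n` removes it from its face, and changes nothing else. -/
lemma remove_n_iff {x y : H} (hx : x ≠ n) (hy : y ≠ n) :
    (swap n (σ n) * σ * (α * swap n a)).SameCycle x y ↔ (σ * (α * swap n a)).SameCycle x y := by
  have h : σ n = (σ * (α * swap n a)) n := by rw [mul_apply, D.cutEdge_n]
  conv_lhs => rw [h, mul_assoc]
  exact sameCycle_swap_apply_mul_iff hx hy

lemma remove_n_rl : (swap n (σ n) * σ * (α * swap n a)).SameCycle l r :=
  (D.remove_n_iff D.ne_ln D.ne_rn).2 D.cutEdge_rl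

lemma genus_remove_n : genus (swap n (σ n) * σ) (α * swap n a) = 0 :=
  genus_swap_mul_eq_zero (Ne.symm D.vertex_n_ne) (sameCycle_apply_self σ n) D.genus_cutEdge

lemma sameCycle_remove_n : (swap n (σ n) * σ).SameCycle l r := by
  have := sameCycle_apply_self (swap n (σ n) * σ) l
  rwa [D.remove_n_l] at this

lemma genus_remove_l : genus (swap l r * swap n (σ n) * σ) (α * swap n a) = 0 := by
  rw [mul_assoc]
  exact genus_swap_mul_eq_zero D.ne_lr D.sameCycle_remove_n D.genus_remove_n

/-- The removal of `l` from the root vertex splits this vertex at two corners of a common face,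
which disconnects a planar map. -/
lemma not_conn_remove_l : ¬ conn (swap l r * swap n (σ n) * σ) (α * swap n a) l r := by
  rw [mul_assoc]
  exact not_conn_swap_mul D.ne_lr D.sameCycle_remove_n D.remove_n_rl D.genus_remove_n

/-- The part of the face of `l` up to `a` stays a part of a face. -/
lemma remove_l_la : (swap l r * swap n (σ n) * σ * (α * swap n a)).SameCycle l a := by
  classical
  have hex : ∃ k : ℕ, ((σ * α) ^ k) l = a := by
    obtain ⟨k, -, hk⟩ := D.face.exists_pow_eq'
    exact ⟨k, hk⟩
  obtain ⟨m, hm, hmin⟩ : ∃ m, ((σ * α) ^ m) l = a ∧ ∀ j < m, ((σ * α) ^ j) l ≠ a :=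
    ⟨Nat.find hex, Nat.find_spec hex, fun j hj => Nat.find_min hex hj⟩
  have key : ∀ j ≤ m, ((swap l r * swap n (σ n) * σ * (α * swap n a)) ^ j) l =
      ((σ * α) ^ j) l := by
    intro j
    induction j with
    | zero => exact fun _ => rfl
    | succ j ih =>
      intro hj
      have hl : ∀ i, (σ * α).SameCycle l (((σ * α) ^ i) l) := sameCycle_pow_self _ _
      have h1 : ((σ * α) ^ j) l ≠ n := fun e => D.not_ln (e ▸ hl j)
      have h2 : ((σ * α) ^ (j + 1)) l ≠ n := fun e => D.not_ln (e ▸ hl (j + 1))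
      have h3 : ((σ * α) ^ (j + 1)) l ≠ r := fun e => D.not_rl (e ▸ hl (j + 1)).symm
      -- The predecessor of `σ n` on its face is `a`, which is not reached before the last step.
      have h4 : ((σ * α) ^ (j + 1)) l ≠ σ n := by
        intro e
        rw [← D.vertex_a, pow_succ', mul_apply] at e
        exact hmin j (by omega) ((σ * α).injective e)
      have h5 : ((σ * α) ^ (j + 1)) l ≠ l := by
        intro e
        refine hmin (m - (j + 1)) (by omega) ?_
        conv_rhs => rw [← hm, show m = (m - (j + 1)) + (j + 1) by omega, pow_add, mul_apply, e]
      rw [pow_succ', mul_apply, ih (by omega), mul_apply, cutEdge_of_ne h1 (hmin j (by omega)),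
        mul_apply, mul_apply, ← mul_apply σ, ← mul_apply (σ * α), ← pow_succ',
        swap_apply_of_ne_of_ne h2 h4, swap_apply_of_ne_of_ne h5 h3]
  refine ⟨m, ?_⟩
  rw [zpow_natCast, key m le_rfl, hm]

lemma genus_cut : genus (cutVertex σ r l n a) (α * swap n a) = 0 := by
  -- If `l = a`, the last transposition is trivial.
  by_cases h : l = a
  · rw [cutVertex, h, swap_self]
    have := D.genus_remove_l
    rw [h] at this
    exact this
  · rw [cutVertex, mul_assoc, mul_assoc, ← mul_assoc (swap l r), genus_swap_mul_of_sameCycle,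
      D.genus_remove_l]
    · exact fun k => h (k.eq_of_left D.remove_l_l)
    · exact D.remove_l_la

lemma conn_remove_l_of_conn_cut {x y : H} (h : conn (cutVertex σ r l n a) (α * swap n a) x y) :
    conn (swap l r * swap n (σ n) * σ) (α * swap n a) x y := by
  rw [cutVertex, mul_assoc, mul_assoc, ← mul_assoc (swap l r)] at h
  have := conn_swap_mul_le h
  rwa [Setoid.mergeClasses_of_rel (conn_of_sameCycle_mul D.remove_l_la)] at this

lemma conn_cut_la : conn (cutVertex σ r l n a) (α * swap n a) l a := by
  have := conn_apply_left (cutVertex σ r l n a) (α * swap n a) l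
  rwa [D.cut_l] at this

/-- The cut separates `r` from `a`. -/
lemma not_conn_ra : ¬ conn (cutVertex σ r l n a) (α * swap n a) r a := by
  intro h
  apply D.not_conn_remove_l
  refine D.conn_remove_l_of_conn_cut ?_
  exact Setoid.trans' _ D.conn_cut_la (Setoid.symm' _ h)

lemma eq_of_conn_n {x : H} (h : conn (cutVertex σ r l n a) (α * swap n a) n x) : x = n :=
  eq_of_conn_of_fixed D.cut_n D.cutEdge_n h

lemma p_lt : p < (σ * α).period r := by
  obtain ⟨i, hi, h⟩ := D.face_r.exists_pow_lt_period
  by_contra! hlt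
  refine D.first i (by omega) ?_
  rw [h, D.good.invol]

/-- Away from the places of the cut, the new face permutation agrees with the old one. -/
lemma cut_face_apply {x y : H} (h : σ ((α * swap n a) x) = y) (h1 : y ≠ n) (h2 : y ≠ σ n)
    (h3 : y ≠ r) (h4 : y ≠ l) (h5 : y ≠ a) :
    (cutVertex σ r l n a * (α * swap n a)) x = y := by
  rw [mul_apply, cutVertex, mul_apply, mul_apply, mul_apply, h, swap_apply_of_ne_of_ne h1 h2,
    swap_apply_of_ne_of_ne h4 h3, swap_apply_of_ne_of_ne h4 h5]

/-- The new root face starts like the old one. -/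
lemma cut_face_pow {i : ℕ} (hi : i < p) :
    ((cutVertex σ r l n a * (α * swap n a)) ^ i) r = ((σ * α) ^ i) r := by
  have hp := D.p_lt
  induction i with
  | zero => rfl
  | succ i ih =>
    have hr : ∀ i, (σ * α).SameCycle r (((σ * α) ^ i) r) := sameCycle_pow_self _ _
    have h1 : ((σ * α) ^ i) r ≠ a := fun e => D.not_ra (e ▸ hr i)
    rw [pow_succ', mul_apply, ih (by omega), pow_succ' (σ * α), mul_apply (σ * α)]
    refine D.cut_face_apply ?_ ?_ ?_ ?_ ?_ ?_
    · rw [cutEdge_of_ne ?_ h1, mul_apply]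
      intro e
      have := pow_apply_inj (by omega) hp (e.trans D.left.symm)
      omega
    · rw [← mul_apply (σ * α), ← pow_succ']
      intro e
      have := pow_apply_inj (by omega) hp (e.trans D.left.symm)
      omega
    · rw [← D.vertex_a]
      exact fun e => h1 ((σ * α).injective e)
    · rw [← mul_apply (σ * α), ← pow_succ']
      intro e
      have := pow_apply_inj (x := r) (j := 0) (by omega) (by omega) e
      omega
    · rw [← mul_apply (σ * α), ← pow_succ']
      exact fun e => D.not_rl (e ▸ hr (i + 1))
    · rw [← mul_apply (σ * α), ← pow_succ']
      exact fun e => D.not_ra (e ▸ hr (i + 1))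

/-- The number `p` is an admissible label: it is at most the degree of the root face that remains.
-/
lemma p_le : p ≤ (cutVertex σ r l n a * (α * swap n a)).period r := by
  by_contra! hlt
  have h1 := pow_period (cutVertex σ r l n a * (α * swap n a)) r
  have h2 := period_pos (cutVertex σ r l n a * (α * swap n a)) r
  rw [D.cut_face_pow hlt] at h1
  have := pow_apply_inj (x := r) (j := 0) (hlt.trans D.p_lt) (by have := D.p_lt; omega) h1
  omega

/-- The face of `a` after the cut consists of `a` and of the old root face after `n`. -/
lemma cut_face_a_step {j : ℕ} (hj : p + j < (σ * α).period r) {x : H}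
    (hx : x = if j = 0 then a else ((σ * α) ^ (p + j)) r) :
    (cutVertex σ r l n a * (α * swap n a)) x =
      if p + j + 1 < (σ * α).period r then ((σ * α) ^ (p + j + 1)) r else a := by
  have hp := D.p_lt
  have hr : ∀ i, (σ * α).SameCycle r (((σ * α) ^ i) r) := sameCycle_pow_self _ _
  have h0 : σ ((α * swap n a) x) = ((σ * α) ^ (p + j + 1)) r := by
    rw [pow_succ', mul_apply (σ * α)]
    by_cases hj0 : j = 0
    · rw [hx, if_pos hj0, D.cutEdge_a, hj0, add_zero, D.left, mul_apply, D.right]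
    · rw [hx, if_neg hj0, cutEdge_of_ne ?_ ?_, mul_apply]
      · intro e
        have := pow_apply_inj hj hp (e.trans D.left.symm)
        omega
      · exact fun e => D.not_ra (e ▸ hr _)
  have h2 : ((σ * α) ^ (p + j + 1)) r ≠ σ n := by
    rw [← h0]
    intro e
    have e1 := σ.injective e
    have e2 : x = n := (α * swap n a).injective (e1.trans D.cutEdge_n.symm)
    rw [hx] at e2
    split_ifs at e2 with hj0
    · exact D.ne_na e2.symm
    · have := pow_apply_inj hj hp (e2.trans D.left.symm)
      omega
  split_ifs with h
  · refine D.cut_face_apply h0 ?_ h2 ?_ ?_ ?_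
    · intro e
      have := pow_apply_inj h hp (e.trans D.left.symm)
      omega
    · intro e
      have := pow_apply_inj (x := r) (j := 0) h (by omega) e
      omega
    · exact fun e => D.not_rl (e ▸ hr _)
    · exact fun e => D.not_ra (e ▸ hr _)
  · have e : p + j + 1 = (σ * α).period r := by omega
    have hrr : ((σ * α) ^ (p + j + 1)) r = r := by rw [e, pow_period]
    rw [hrr] at h0 h2
    rw [mul_apply, cutVertex, mul_apply, mul_apply, mul_apply, h0,
      swap_apply_of_ne_of_ne D.ne_rn h2, swap_apply_right, swap_apply_left]

lemma cut_face_a_pow (j : ℕ) (hj : p + j < (σ * α).period r) :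
    ((cutVertex σ r l n a * (α * swap n a)) ^ j) a =
      if j = 0 then a else ((σ * α) ^ (p + j)) r := by
  induction j with
  | zero => rfl
  | succ j ih =>
    rw [pow_succ', mul_apply, D.cut_face_a_step (by omega) (ih (by omega)),
      if_pos (by omega), if_neg (by omega), add_assoc]

/-- The label and the degree of the new face of `a` add up to the degree of the old root face. -/
lemma period_cut_a :
    (σ * α).period r = (cutVertex σ r l n a * (α * swap n a)).period a + p := by
  have hp := D.p_lt
  have hr : ∀ i, (σ * α).SameCycle r (((σ * α) ^ i) r) := sameCycle_pow_self _ _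
  suffices h : (cutVertex σ r l n a * (α * swap n a)).period a = (σ * α).period r - p by omega
  refine period_eq (by omega) ?_ ?_
  · obtain ⟨k, hk⟩ : ∃ k, (σ * α).period r - p = k + 1 := ⟨(σ * α).period r - p - 1, by omega⟩
    rw [hk, pow_succ', mul_apply, D.cut_face_a_step (by omega) (D.cut_face_a_pow k (by omega)),
      if_neg (by omega)]
  · intro j h1 h2 e
    rw [D.cut_face_a_pow j (by omega), if_neg (by omega)] at e
    exact D.not_ra (e ▸ hr _)

/-- The transpositions by which the cut changes the face permutation only involve half-edges on the
root face and on the face of `l`. -/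
lemma mergeClasses_of_cut_face {x y : H}
    (h : (cutVertex σ r l n a * (α * swap n a)).SameCycle x y) :
    (σ * α).cycles.mergeClasses r l x y := by
  have big : ∀ u v, ((σ * α).SameCycle u r ∨ (σ * α).SameCycle u l) →
      ((σ * α).SameCycle v r ∨ (σ * α).SameCycle v l) →
      (σ * α).cycles.mergeClasses r l u v := fun u v hu hv => Or.inr ⟨hu, hv⟩
  have hn : (σ * α).SameCycle n r ∨ (σ * α).SameCycle n l := Or.inl D.face_rn.symm
  have ha : (σ * α).SameCycle a r ∨ (σ * α).SameCycle a l := Or.inr D.face.symm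
  have hr : (σ * α).SameCycle r r ∨ (σ * α).SameCycle r l := Or.inl (SameCycle.refl _ _)
  have hl : (σ * α).SameCycle l r ∨ (σ * α).SameCycle l l := Or.inr (SameCycle.refl _ _)
  have hσ : (σ * α).SameCycle (σ n) r ∨ (σ * α).SameCycle (σ n) l := by
    refine Or.inr ?_
    rw [← D.vertex_a]
    exact (sameCycle_apply_self _ _).symm.trans D.face.symm
  refine sameCycle_of_rel (s := (σ * α).cycles.mergeClasses r l) (fun x => ?_) h
  have e : (cutVertex σ r l n a * (α * swap n a)) x =
      swap l a (swap l r (swap n (σ n) ((σ * α) (swap n a x)))) := rfl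
  rw [e]
  refine Setoid.trans' _ (Setoid.rel_swap (big _ _ hn ha) x) ?_
  refine Setoid.trans' _ (Or.inl (sameCycle_apply_self (σ * α) _)) ?_
  refine Setoid.trans' _ (Setoid.rel_swap (big _ _ hn hσ) _) ?_
  refine Setoid.trans' _ (Setoid.rel_swap (big _ _ hl hr) _) ?_
  exact Setoid.rel_swap (big _ _ hl ha) _

/-- A half-edge on the root face whose opposite is on the face of `l` is not affected. -/
lemma not_sameFace_cut_aux {h : H} (hn : h ≠ n) (hr : (σ * α).SameCycle r h)
    (hl : (σ * α).SameCycle l (α h)) :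
    ¬ (cutVertex σ r l n a * (α * swap n a)).SameCycle h (α h) := by
  intro hs
  have hp := D.p_lt
  obtain ⟨i, hi, rfl⟩ := hr.exists_pow_lt_period
  rcases lt_trichotomy i p with hip | hip | hip
  -- Before `n`, such a half-edge would contradict the choice of `n`; after `n`, it is on the new
  -- face of `a`, which contains no half-edge of the old face of `l` except for `a`.
  · exact D.first i hip hl
  · exact hn (hip ▸ D.left)
  · obtain ⟨j, rfl⟩ : ∃ j, i = p + j := ⟨i - p, by omega⟩
    have h1 := D.cut_face_a_pow j hi
    rw [if_neg (by omega)] at h1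
    have h2 : (cutVertex σ r l n a * (α * swap n a)).SameCycle a (α (((σ * α) ^ (p + j)) r)) := by
      refine SameCycle.trans ?_ hs
      rw [← h1]
      exact sameCycle_pow_self _ _ _
    obtain ⟨k, hk, e⟩ := h2.exists_pow_lt_period
    rw [D.cut_face_a_pow k (by have := D.period_cut_a; omega)] at e
    split_ifs at e
    · apply hn
      rw [← D.good.invol (((σ * α) ^ (p + j)) r), ← e, D.alpha_a]
    · rw [← e] at hl
      exact D.not_rl ((sameCycle_pow_self _ _ _).trans hl.symm)

lemma planarBridgeless : PlanarBridgeless (cutVertex σ r l n a) (α * swap n a) where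
  invol h := by
    by_cases h1 : h = n
    · rw [h1, D.cutEdge_n, D.cutEdge_n]
    by_cases h2 : h = a
    · rw [h2, D.cutEdge_a, D.cutEdge_a]
    rw [cutEdge_of_ne h1 h2, cutEdge_of_ne, D.good.invol]
    · exact fun e => h2 (by rw [← D.good.invol h, e, D.right])
    · exact fun e => h1 (by rw [← D.good.invol h, e, D.alpha_a])
  genus_eq := D.genus_cut
  not_sameFace h hne hs := by
    have h1 : h ≠ n := fun e => hne (e ▸ D.cutEdge_n)
    have h2 : h ≠ a := fun e => hne (e ▸ D.cutEdge_a)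
    rw [cutEdge_of_ne h1 h2] at hne hs
    have h3 : α h ≠ n := fun e => h2 (by rw [← D.good.invol h, e, D.right])
    have key := D.good.not_sameFace h hne
    rcases D.mergeClasses_of_cut_face hs with k | ⟨k | k, k' | k'⟩
    · exact key k
    · exact key (k.trans k'.symm)
    -- The remaining cases: the edge of `h` separates the root face from the face of `l`.
    · exact D.not_sameFace_cut_aux h1 k.symm k'.symm hs
    · refine D.not_sameFace_cut_aux h3 k'.symm ?_ ?_
      · rw [D.good.invol]
        exact k.symm
      · rw [D.good.invol]
        exact hs.symm
    · exact key (k.trans k'.symm)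

lemma conn_rn : conn σ α r n := conn_of_sameCycle_mul D.face_rn

lemma conn_ra : conn σ α r a := Setoid.trans' _ D.conn_rl (conn_of_sameCycle_mul D.face)

lemma conn_of_conn_cut {x y : H} (h : conn (cutVertex σ r l n a) (α * swap n a) x y) :
    conn σ α x y := by
  have hna : conn σ α n a := Setoid.trans' _ (Setoid.symm' _ D.conn_rn) D.conn_ra
  refine rel_of_conn (fun x => ?_) (fun x => ?_) h
  · have e : cutVertex σ r l n a x = swap l a (swap l r (swap n (σ n) (σ x))) := rfl
    rw [e]
    refine Setoid.trans' _ (conn_apply_left σ α x) ?_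
    refine Setoid.trans' _ (Setoid.rel_swap (conn_apply_left σ α n) _) ?_
    refine Setoid.trans' _ (Setoid.rel_swap (Setoid.symm' _ D.conn_rl) _) ?_
    exact Setoid.rel_swap (conn_of_sameCycle_mul D.face) _
  · have e : (α * swap n a) x = α (swap n a x) := rfl
    rw [e]
    exact Setoid.trans' _ (Setoid.rel_swap hna x) (conn_apply_right σ α _)

omit D in
lemma mul_eq_cut : σ = swap n (σ n) * (swap l r * (swap l a * cutVertex σ r l n a)) := by
  unfold cutVertex
  simp only [mul_assoc, swap_mul_self_mul]

/-- The component of the root falls into the components of `r`, of `a` and of `n`. -/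
lemma conn_iff {x : H} : conn σ α r x ↔ conn (cutVertex σ r l n a) (α * swap n a) r x ∨
    conn (cutVertex σ r l n a) (α * swap n a) a x ∨ x = n := by
  constructor
  · intro h
    -- The set `T` is invariant under the permutations after the cut and under the transpositions
    -- that undo the cut.
    let T : H → Prop := fun x => conn (cutVertex σ r l n a) (α * swap n a) r x ∨
      conn (cutVertex σ r l n a) (α * swap n a) a x ∨ x = n
    have hTr : T r := Or.inl (Setoid.refl' _ r)
    have hTa : T a := Or.inr (Or.inl (Setoid.refl' _ a))
    have hTl : T l := Or.inr (Or.inl (Setoid.symm' _ D.conn_cut_la))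
    have hTn : T n := Or.inr (Or.inr rfl)
    have hp := D.p_lt
    have hr : ∀ i, (σ * α).SameCycle r (((σ * α) ^ i) r) := sameCycle_pow_self _ _
    have hTσ : T (σ n) := by
      by_cases h1 : σ n = l
      · rwa [h1]
      by_cases h2 : σ n = a
      · rwa [h2]
      refine Or.inl ?_
      -- Otherwise `σ n` follows the first `p - 1` steps along the new root face.
      obtain ⟨q, hq⟩ : ∃ q, p = q + 1 := ⟨p - 1, by have := D.p_pos; omega⟩
      have h3 : ((cutVertex σ r l n a * (α * swap n a)) ^ (q + 1)) r = σ n := by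
        rw [pow_succ', mul_apply, D.cut_face_pow (by omega), mul_apply, cutEdge_of_ne,
          cutVertex, mul_apply, mul_apply, mul_apply, ← mul_apply σ α, ← mul_apply (σ * α),
          ← pow_succ', ← hq, D.left, swap_apply_left, swap_apply_of_ne_of_ne h1 D.vertex_n_ne_r,
          swap_apply_of_ne_of_ne h1 h2]
        · intro e
          have := pow_apply_inj (by omega) hp (e.trans D.left.symm)
          omega
        · exact fun e => D.not_ra (e ▸ hr _)
      rw [← h3]
      exact conn_of_sameCycle_mul (sameCycle_pow_self _ _ _)
    have hswap : ∀ {u v}, T u → T v → ∀ y, T (swap u v y) = T y := by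
      intro u v hu hv y
      by_cases h1 : y = u
      · rw [h1, swap_apply_left]
        exact propext ⟨fun _ => hu, fun _ => hv⟩
      by_cases h2 : y = v
      · rw [h2, swap_apply_right]
        exact propext ⟨fun _ => hv, fun _ => hu⟩
      rw [swap_apply_of_ne_of_ne h1 h2]
    have hcut : ∀ y z, conn (cutVertex σ r l n a) (α * swap n a) y z → T y = T z := by
      intro y z hyz
      refine propext ⟨?_, ?_⟩
      · rintro (k | k | rfl)
        · exact Or.inl (Setoid.trans' _ k hyz)
        · exact Or.inr (Or.inl (Setoid.trans' _ k hyz))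
        · exact Or.inr (Or.inr (D.eq_of_conn_n hyz))
      · rintro (k | k | rfl)
        · exact Or.inl (Setoid.trans' _ k (Setoid.symm' _ hyz))
        · exact Or.inr (Or.inl (Setoid.trans' _ k (Setoid.symm' _ hyz)))
        · exact Or.inr (Or.inr (D.eq_of_conn_n (Setoid.symm' _ hyz)))
    have key : T r = T x := by
      refine rel_of_conn (s := Setoid.ker T) (fun y => ?_) (fun y => ?_) h
      · change T y = T (σ y)
        have e : σ y = swap n (σ n) (swap l r (swap l a (cutVertex σ r l n a y))) :=
          congrArg (fun τ : Perm H => τ y) mul_eq_cut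
        rw [e, hswap hTn hTσ, hswap hTl hTr, hswap hTl hTa]
        exact hcut _ _ (conn_apply_left _ _ y)
      · change T y = T (α y)
        have e : α y = (α * swap n a) (swap n a y) := by simp
        rw [e, ← hcut _ _ (conn_apply_right _ _ (swap n a y)), hswap hTn hTa]
    exact (show T r = T x from key).mp hTr
  · rintro (h | h | rfl)
    · exact D.conn_of_conn_cut h
    · exact Setoid.trans' _ D.conn_ra (D.conn_of_conn_cut h)
    · exact D.conn_rn

lemma rootAt_r : RootAt (cutVertex σ r l n a) (α * swap n a) r where
  fixed := by rw [cutEdge_of_ne D.ne_rn D.ne_ra, D.root.fixed]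
  unique h hc hf := by
    have h1 : h ≠ n := by
      rintro rfl
      exact D.ne_rn (D.eq_of_conn_n (Setoid.symm' _ hc))
    have h2 : h ≠ a := by
      rintro rfl
      exact D.not_conn_ra hc
    rw [cutEdge_of_ne h1 h2] at hf
    exact D.root.unique h (D.conn_of_conn_cut hc) hf

lemma rootAt_a : RootAt (cutVertex σ r l n a) (α * swap n a) a where
  fixed := D.cutEdge_a
  unique h hc hf := by
    have h1 : h ≠ n := by
      rintro rfl
      exact D.ne_na (D.eq_of_conn_n (Setoid.symm' _ hc)).symm
    by_contra h2
    rw [cutEdge_of_ne h1 h2] at hf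
    have h3 := D.root.unique h (Setoid.trans' _ D.conn_ra (D.conn_of_conn_cut hc)) hf
    rw [h3] at hc
    exact D.not_conn_ra (Setoid.symm' _ hc)

/-- Apart from `n` and `l`, the root vertex keeps its half-edges. -/
lemma cut_vertex_iff {x : H} (hn : x ≠ n) (hl : x ≠ l) :
    (cutVertex σ r l n a).SameCycle r x ↔ σ.SameCycle r x := by
  have h1 : (swap l r * swap n (σ n) * σ).SameCycle r x ↔ σ.SameCycle r x := by
    have e : r = (swap n (σ n) * σ) l := D.remove_n_l.symm
    have h2 : (swap l r * (swap n (σ n) * σ)).SameCycle r x ↔ (swap n (σ n) * σ).SameCycle r x := by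
      have := sameCycle_swap_apply_mul_iff (π := swap n (σ n) * σ) (Ne.symm D.ne_lr) hl
      rwa [D.remove_n_l] at this
    rw [mul_assoc, h2, sameCycle_swap_apply_mul_iff D.ne_rn hn]
  rw [← h1]
  by_cases h : l = a
  · rw [cutVertex, ← h, swap_self]
    rfl
  · have h3 : ¬ (swap l r * swap n (σ n) * σ).SameCycle l a :=
      fun k => h (k.eq_of_left D.remove_l_l)
    have h4 := cycles_swap_mul h3
    rw [show swap l a * (swap l r * swap n (σ n) * σ) = cutVertex σ r l n a by
      simp only [cutVertex, mul_assoc]] at h4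
    change (cutVertex σ r l n a).cycles r x ↔ _
    rw [h4]
    constructor
    · rintro (k | ⟨k | k, -⟩)
      · exact k
      · exact absurd (k.eq_of_right D.remove_l_l).symm D.ne_lr
      · refine absurd (conn_of_sameCycle (α := α * swap n a) k) fun k => D.not_conn_remove_l ?_
        exact Setoid.trans' _ (conn_of_sameCycle_mul D.remove_l_la) (Setoid.symm' _ k)
    · exact Or.inl

/-- The root vertex loses exactly one incident face in the cut. -/
lemma vertexFaces_eq :
    vertexFaces σ α r = vertexFaces (cutVertex σ r l n a) (α * swap n a) r + 1 := by
  unfold vertexFaces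
  have hV : {x | (cutVertex σ r l n a).SameCycle r x} ⊆ {x | σ.SameCycle r x} := by
    intro x hx
    refine (D.cut_vertex_iff ?_ ?_).1 hx
    · rintro rfl
      exact D.ne_rn (hx.eq_of_right D.cut_n)
    · rintro rfl
      exact D.not_conn_ra (Setoid.trans' _ (conn_of_sameCycle hx) D.conn_cut_la)
  -- The root face and the face of `l` are both incident to the root vertex, and cutting the edge
  -- `{n, a}` merges them.
  have h1 : (σ * (α * swap n a)).cycles = (σ * α).cycles.mergeClasses r l := by
    rw [D.cycles_cutEdge]
    ext x y
    have e1 : ∀ z, (σ * α).SameCycle z n ↔ (σ * α).SameCycle z r := fun z =>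
      ⟨fun h => h.trans D.face_rn.symm, fun h => h.trans D.face_rn⟩
    have e2 : ∀ z, (σ * α).SameCycle z a ↔ (σ * α).SameCycle z l := fun z =>
      ⟨fun h => h.trans D.face.symm, fun h => h.trans D.face⟩
    change (_ ∨ ((σ * α).SameCycle x n ∨ (σ * α).SameCycle x a) ∧
      ((σ * α).SameCycle y n ∨ (σ * α).SameCycle y a)) ↔ _
    rw [e1, e1, e2, e2]
    rfl
  have h2 := Setoid.classesMeeting_mergeClasses (s := (σ * α).cycles) D.not_rl
    (V := {x | σ.SameCycle r x}) (SameCycle.refl _ _)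
    (by
      have := sameCycle_apply_self σ l
      rw [D.last] at this
      exact this.symm)
  rw [← h2, ← h1]
  congr 1
  have hrr : r ∈ {x | (cutVertex σ r l n a).SameCycle r x} := SameCycle.refl _ _
  rw [Setoid.classesMeeting_eq_of_subset hV]
  · refine Setoid.classesMeeting_congr fun x hx y hy => ?_
    have hcx : conn (cutVertex σ r l n a) (α * swap n a) r x := conn_of_sameCycle hx
    have hcy : conn (cutVertex σ r l n a) (α * swap n a) r y := conn_of_sameCycle hy
    have hne : ∀ z, conn (cutVertex σ r l n a) (α * swap n a) r z → z ≠ n := by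
      rintro z hz rfl
      exact D.ne_rn (D.eq_of_conn_n (Setoid.symm' _ hz))
    have hnl : ∀ z, conn (cutVertex σ r l n a) (α * swap n a) r z →
        ¬ (swap l r * (swap n (σ n) * σ * (α * swap n a))).SameCycle z l := by
      intro z hz hk
      rw [← mul_assoc, ← mul_assoc] at hk
      refine D.not_conn_remove_l
        (Setoid.symm' _ (Setoid.trans' _ (D.conn_remove_l_of_conn_cut hz) ?_))
      exact conn_of_sameCycle_mul hk
    -- In the component of `r`, the faces after the edge has been cut are not changed by the removal
    -- of `n` and of `l` from their vertices, nor by the insertion of `l` elsewhere.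
    have e1 : (σ * (α * swap n a)).SameCycle x y ↔
        (swap n (σ n) * σ * (α * swap n a)).SameCycle x y :=
      (D.remove_n_iff (hne x hcx) (hne y hcy)).symm
    have e2 : (swap n (σ n) * σ * (α * swap n a)).SameCycle x y ↔
        (swap l r * (swap n (σ n) * σ * (α * swap n a))).SameCycle x y := by
      change (swap n (σ n) * σ * (α * swap n a)).cycles x y ↔ _
      rw [cycles_eq_of_sameCycle D.ne_lr D.remove_n_rl]
      constructor
      · rintro (k | ⟨k, k'⟩)
        · exact k
        · exact (k.resolve_left (hnl x hcx)).trans (k'.resolve_left (hnl y hcy)).symm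
      · exact Or.inl
    have e3 : (swap l r * (swap n (σ n) * σ * (α * swap n a))).SameCycle x y ↔
        (cutVertex σ r l n a * (α * swap n a)).SameCycle x y := by
      have e : cutVertex σ r l n a * (α * swap n a) =
        swap l a * (swap l r * (swap n (σ n) * σ * (α * swap n a))) := by
        simp only [cutVertex, mul_assoc]
      rw [e]
      by_cases h : l = a
      · rw [← h, swap_self]
        rfl
      · have hs : (swap l r * (swap n (σ n) * σ * (α * swap n a))).SameCycle l a := by
          have := D.remove_l_la
          simp only [mul_assoc] at this ⊢
          exact this
        change (swap l r * (swap n (σ n) * σ * (α * swap n a))).cycles x y ↔ _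
        rw [cycles_eq_of_sameCycle h hs, ← e]
        constructor
        · rintro (k | ⟨k, -⟩)
          · exact k
          · exfalso
            apply D.not_conn_ra
            rcases k with k | k
            · exact Setoid.trans' _ hcx (Setoid.trans' _ (conn_of_sameCycle_mul k) D.conn_cut_la)
            · exact Setoid.trans' _ hcx (conn_of_sameCycle_mul k)
        · exact Or.inl
    exact e1.trans (e2.trans e3)
  · intro v hv
    have hl : (σ * (α * swap n a)).cycles l r := D.cutEdge_rl
    have hn : (σ * (α * swap n a)).cycles n r := by
      rw [h1]
      exact Or.inr ⟨Or.inl D.face_rn.symm, Or.inl (SameCycle.refl _ _)⟩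
    by_cases k1 : v = n
    · exact ⟨r, hrr, k1 ▸ hn⟩
    by_cases k2 : v = l
    · exact ⟨r, hrr, k2 ▸ hl⟩
    exact ⟨v, (D.cut_vertex_iff k1 k2).2 hv, Setoid.refl' _ v⟩

/-- The half-edge `σ n` in terms of the map after the cut. Together with `mul_eq_cut`, this recovers
`σ` from the map after the cut and the label `p`. -/
lemma apply_n : (swap l r * (swap l a * cutVertex σ r l n a))
    ((α * swap n a) (((cutVertex σ r l n a * (α * swap n a)) ^ (p - 1)) r)) = σ n := by
  have hp := D.p_lt
  have hp' := D.p_pos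
  rw [D.cut_face_pow (by omega), cutEdge_of_ne]
  · have e : swap l r * (swap l a * cutVertex σ r l n a) = swap n (σ n) * σ := by
      unfold cutVertex
      simp only [mul_assoc, swap_mul_self_mul]
    rw [e, mul_apply, ← mul_apply σ α, ← mul_apply (σ * α), ← pow_succ', Nat.sub_add_cancel hp',
      D.left, swap_apply_left]
  · intro e
    have := pow_apply_inj (by omega) hp (e.trans D.left.symm)
    omega
  · exact fun e => D.not_ra (e ▸ sameCycle_pow_self _ _ _)

end CutData

end PermPair

/-! ### Gluing two planar bridgeless maps -/

namespace Equiv.Perm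

variable {H : Type*} [Finite H]

/-- If `ρ` follows a cycle of `π` except where that cycle closes up, then it stays in one cycle. -/
lemma SameCycle.of_step {π ρ : Perm H} {x : H}
    (h : ∀ y, π.SameCycle x y → π y ≠ x → ρ y = π y) {y : H} (hy : π.SameCycle x y) :
    ρ.SameCycle x y := by
  obtain ⟨k, -, rfl⟩ := hy.exists_pow_eq'
  induction k with
  | zero => exact SameCycle.refl _ _
  | succ k ih =>
    rw [pow_succ', mul_apply]
    by_cases e : π ((π ^ k) x) = x
    · rw [e]
    · rw [← h _ (sameCycle_pow_self _ _ _) e]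
      exact (ih (sameCycle_pow_self _ _ _)).trans (sameCycle_apply_self _ _)

lemma SameCycle.of_step_of_ne {π ρ : Perm H} {x : H}
    (h : ∀ y, π.SameCycle x y → y ≠ x → π y ≠ x → ρ y = π y) {y : H} (hy : π.SameCycle x y)
    (hne : y ≠ x) : ρ.SameCycle (π x) y := by
  obtain ⟨k, -, rfl⟩ := hy.exists_pow_eq'
  induction k with
  | zero => exact (hne (by simp)).elim
  | succ k ih =>
    rw [pow_succ', mul_apply] at hne ⊢
    by_cases e : (π ^ k) x = x
    · rw [e]
    · rw [← h _ (sameCycle_pow_self _ _ _) e hne]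
      exact (ih (sameCycle_pow_self _ _ _) e).trans (sameCycle_apply_self _ _)

end Equiv.Perm

namespace PermPair

open Equiv Equiv.Perm

variable {H : Type*} [DecidableEq H] [Finite H]

/-- Every planar bridgeless map with more than its dangling root can be cut. -/
lemma exists_cutData {σ α : Perm H} {r : H} (h : PlanarBridgeless σ α) (hr : RootAt σ α r)
    (hne : σ r ≠ r) : ∃ l n a p, CutData σ α r l n a p := by
  classical
  have hl : σ (σ⁻¹ r) = r := by simp
  have hface : (σ * α).SameCycle r (α (σ⁻¹ r)) := by
    have h1 := sameCycle_apply_self (σ * α) (α (σ⁻¹ r))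
    rw [mul_apply, h.invol, hl] at h1
    exact h1.symm
  have hex : ∃ p : ℕ, (σ * α).SameCycle (σ⁻¹ r) (α (((σ * α) ^ p) r)) := by
    obtain ⟨p, -, hp⟩ := hface.exists_pow_eq'
    refine ⟨p, ?_⟩
    rw [hp, h.invol]
  exact ⟨_, _, _, Nat.find hex, h, hr, hne, hl, rfl, rfl, Nat.find_spec hex,
    fun i hi => Nat.find_min hex hi⟩

/-- Joins the vertices of `r` and of `a`: the half-edge before `a` is moved before `r`. -/
def joinVertex (σ : Perm H) (r a : H) : Perm H := swap (σ⁻¹ a) r * (swap (σ⁻¹ a) a * σ)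

/-- Inverse of `cutVertex`: after the vertices of `r` and of `a` have been joined, the half-edge `n`
is inserted at the `p`-th corner of the face of `r`. -/
def glueVertex (σ α : Perm H) (r n a : H) (p : ℕ) : Perm H :=
  swap n (joinVertex σ r a (α (((σ * α) ^ (p - 1)) r))) * joinVertex σ r a

/-- The situation in which two planar maps, with roots `r` and `a`, are glued by a new edge `{n, a}`
that starts at the `p`-th corner of the face of `r`. -/
structure GlueData (σ α : Perm H) (r n a : H) (p : ℕ) : Prop where
  good : PlanarBridgeless σ α
  root_r : RootAt σ α r
  root_a : RootAt σ α a
  sep : ¬ conn σ α r a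
  vertex_n : σ n = n
  edge_n : α n = n
  ne_nr : n ≠ r
  ne_na : n ≠ a
  pos : 0 < p
  le : p ≤ (σ * α).period r

namespace GlueData

variable {σ α : Perm H} {r n a : H} {p : ℕ} (D : GlueData σ α r n a p)

omit [DecidableEq H] [Finite H] in
lemma vertex_last : σ (σ⁻¹ a) = a := by simp

include D

lemma conn_la : conn σ α (σ⁻¹ a) a := by
  have := conn_apply_left σ α (σ⁻¹ a)
  rwa [vertex_last] at this

lemma not_conn_rl : ¬ conn σ α r (σ⁻¹ a) := fun h => D.sep (Setoid.trans' _ h D.conn_la)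

lemma eq_of_conn_n {x : H} (h : conn σ α n x) : x = n :=
  eq_of_conn_of_fixed D.vertex_n D.edge_n h

lemma ne_ln : σ⁻¹ a ≠ n := by
  intro h
  apply D.ne_na
  rw [← vertex_last (σ := σ) (a := a), h, D.vertex_n]

lemma ne_lr : σ⁻¹ a ≠ r := fun h => D.not_conn_rl (h ▸ Setoid.refl' _ _)

lemma ne_ra : r ≠ a := fun h => D.sep (h ▸ Setoid.refl' _ _)

lemma join_l : joinVertex σ r a (σ⁻¹ a) = r := by
  rw [joinVertex, mul_apply, mul_apply, vertex_last, swap_apply_right, swap_apply_left]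

lemma join_before_r {x : H} (h : σ x = r) : joinVertex σ r a x = σ⁻¹ a := by
  rw [joinVertex, mul_apply, mul_apply, h, swap_apply_of_ne_of_ne (Ne.symm D.ne_lr) D.ne_ra,
    swap_apply_right]

lemma join_before_l {x : H} (h : σ x = σ⁻¹ a) (hla : σ⁻¹ a ≠ a) : joinVertex σ r a x = a := by
  rw [joinVertex, mul_apply, mul_apply, h, swap_apply_left,
    swap_apply_of_ne_of_ne (Ne.symm hla) (Ne.symm D.ne_ra)]

omit D in
lemma join_of_ne {x : H} (h1 : σ x ≠ σ⁻¹ a) (h2 : σ x ≠ a) (h3 : σ x ≠ r) :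
    joinVertex σ r a x = σ x := by
  rw [joinVertex, mul_apply, mul_apply, swap_apply_of_ne_of_ne h1 h2,
    swap_apply_of_ne_of_ne h1 h3]

lemma join_n : joinVertex σ r a n = n := by
  rw [join_of_ne, D.vertex_n]
  · rw [D.vertex_n]; exact Ne.symm D.ne_ln
  · rw [D.vertex_n]; exact D.ne_na
  · rw [D.vertex_n]; exact D.ne_nr

lemma conn_corner (i : ℕ) : conn σ α r (α (((σ * α) ^ i) r)) :=
  Setoid.trans' _ (conn_of_sameCycle_mul (sameCycle_pow_self _ _ i)) (conn_apply_right _ _ _)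

lemma corner_ne_l (i : ℕ) : α (((σ * α) ^ i) r) ≠ σ⁻¹ a :=
  fun h => D.not_conn_rl (h ▸ D.conn_corner i)

lemma ne_n_of_conn {x : H} (h : conn σ α r x) : x ≠ n := by
  rintro rfl
  exact D.ne_nr (D.eq_of_conn_n (Setoid.symm' _ h)).symm

lemma ne_n_of_conn_a {x : H} (h : conn σ α a x) : x ≠ n := by
  rintro rfl
  exact D.ne_na (D.eq_of_conn_n (Setoid.symm' _ h)).symm

lemma join_corner_ne_n : joinVertex σ r a (α (((σ * α) ^ (p - 1)) r)) ≠ n := fun h =>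
  D.ne_n_of_conn (D.conn_corner _) ((joinVertex σ r a).injective (h.trans D.join_n.symm))

lemma glue_n : glueVertex σ α r n a p n = joinVertex σ r a (α (((σ * α) ^ (p - 1)) r)) := by
  rw [glueVertex, mul_apply, D.join_n, swap_apply_left]

omit D in
lemma glue_corner : glueVertex σ α r n a p (α (((σ * α) ^ (p - 1)) r)) = n := by
  rw [glueVertex, mul_apply, swap_apply_right]

lemma glue_of_ne {x : H} (h1 : x ≠ n) (h2 : x ≠ α (((σ * α) ^ (p - 1)) r)) :
    glueVertex σ α r n a p x = joinVertex σ r a x := by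
  rw [glueVertex, mul_apply, swap_apply_of_ne_of_ne]
  · exact fun h => h1 ((joinVertex σ r a).injective (h.trans D.join_n.symm))
  · exact fun h => h2 ((joinVertex σ r a).injective h)

lemma glue_l : glueVertex σ α r n a p (σ⁻¹ a) = r := by
  rw [D.glue_of_ne D.ne_ln (Ne.symm (D.corner_ne_l _)), D.join_l]

lemma edge_n' : (α * swap n a) n = a := by
  rw [mul_apply, swap_apply_left, D.root_a.fixed]

lemma edge_a' : (α * swap n a) a = n := by
  rw [mul_apply, swap_apply_right, D.edge_n]

omit D in
lemma edge_of_ne {h : H} (h1 : h ≠ n) (h2 : h ≠ a) : (α * swap n a) h = α h := by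
  rw [mul_apply, swap_apply_of_ne_of_ne h1 h2]

lemma edge_ne_n {x : H} (h : x ≠ n) : α x ≠ n := fun e => h (α.injective (e.trans D.edge_n.symm))

/-- One step of the new face permutation. -/
lemma face_apply {x : H} (h1 : x ≠ n) (h2 : x ≠ a) (h3 : x ≠ ((σ * α) ^ (p - 1)) r) :
    (glueVertex σ α r n a p * (α * swap n a)) x = joinVertex σ r a (α x) := by
  rw [mul_apply, edge_of_ne h1 h2, D.glue_of_ne (D.edge_ne_n h1)]
  exact fun e => h3 (α.injective e)

lemma face_apply_of_ne {x : H} (h1 : x ≠ n) (h2 : x ≠ a) (h3 : x ≠ ((σ * α) ^ (p - 1)) r)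
    (h4 : (σ * α) x ≠ σ⁻¹ a) (h5 : (σ * α) x ≠ a) (h6 : (σ * α) x ≠ r) :
    (glueVertex σ α r n a p * (α * swap n a)) x = (σ * α) x := by
  rw [D.face_apply h1 h2 h3, join_of_ne (σ := σ) h4 h5 h6, mul_apply]

/-- The new root face starts like the old one. -/
lemma face_pow {i : ℕ} (hi : i < p) :
    ((glueVertex σ α r n a p * (α * swap n a)) ^ i) r = ((σ * α) ^ i) r := by
  have hp := D.le
  have hr : ∀ i, conn σ α r (((σ * α) ^ i) r) :=
    fun i => conn_of_sameCycle_mul (sameCycle_pow_self _ _ i)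
  induction i with
  | zero => rfl
  | succ i ih =>
    rw [pow_succ', mul_apply, ih (by omega), pow_succ' (σ * α), mul_apply (σ * α)]
    refine D.face_apply_of_ne (D.ne_n_of_conn (hr i)) ?_ ?_ ?_ ?_ ?_
    · exact fun e => D.sep (e ▸ hr i)
    · intro e
      have := pow_apply_inj (by omega) (by omega) e
      omega
    · rw [← mul_apply (σ * α), ← pow_succ']
      exact fun e => D.not_conn_rl (e ▸ hr (i + 1))
    · rw [← mul_apply (σ * α), ← pow_succ']
      exact fun e => D.sep (e ▸ hr (i + 1))
    · rw [← mul_apply (σ * α), ← pow_succ']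
      intro e
      have := pow_apply_inj (x := r) (j := 0) (by omega) (by omega) e
      omega

lemma face_pow_p : ((glueVertex σ α r n a p * (α * swap n a)) ^ p) r = n := by
  have hp := D.pos
  have hr : conn σ α r (((σ * α) ^ (p - 1)) r) := conn_of_sameCycle_mul (sameCycle_pow_self _ _ _)
  rw [← Nat.sub_add_cancel hp, pow_succ', mul_apply, Nat.sub_add_cancel hp, D.face_pow (by omega),
    mul_apply, edge_of_ne (D.ne_n_of_conn hr), glue_corner]
  exact fun e => D.sep (e ▸ hr)

/-- If the face of `σ⁻¹ a` is not that of `a`, it stays a part of a face. -/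
lemma face_l {y : H} (h : (σ * α).SameCycle (σ⁻¹ a) y) (ha : ¬ (σ * α).SameCycle (σ⁻¹ a) a) :
    (glueVertex σ α r n a p * (α * swap n a)).SameCycle (σ⁻¹ a) y := by
  refine SameCycle.of_step (fun y hy hne => ?_) h
  have hc : conn σ α a y := Setoid.trans' _ (Setoid.symm' _ D.conn_la) (conn_of_sameCycle_mul hy)
  refine D.face_apply_of_ne (D.ne_n_of_conn_a hc) ?_ ?_ hne ?_ ?_
  · exact fun e => ha (e ▸ hy)
  · exact fun e => D.sep (Setoid.trans' _ (conn_of_sameCycle_mul (sameCycle_pow_self _ _ (p - 1)))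
      (Setoid.symm' _ (e ▸ hc)))
  · exact fun e => ha (e ▸ hy.trans (sameCycle_apply_self _ _))
  · exact fun e => D.sep (Setoid.symm' _ (e ▸ Setoid.trans' _ hc
      (conn_of_sameCycle_mul (sameCycle_apply_self (σ * α) y))))

/-- In the map of root `a`, the edge before `a` has different faces on its sides. -/
lemma not_face_la (h : σ⁻¹ a ≠ a) : ¬ (σ * α).SameCycle (σ⁻¹ a) a := by
  intro hs
  refine D.good.not_sameFace (σ⁻¹ a) (fun e => h ?_) (hs.trans ?_)
  · exact D.root_a.unique _ (Setoid.symm' _ D.conn_la) e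
  · have := sameCycle_apply_self (σ * α) (α (σ⁻¹ a))
    rw [mul_apply, D.good.invol, vertex_last] at this
    exact this.symm

/-- The new edge has the face of `σ⁻¹ a`, the last half-edge of the glued root vertex, on the side
of `a`. -/
lemma face_la : (glueVertex σ α r n a p * (α * swap n a)).SameCycle (σ⁻¹ a) a := by
  by_cases hla : σ⁻¹ a = a
  · rw [hla]
  have hna := D.not_face_la hla
  have hz : (σ * α) ((σ * α)⁻¹ (σ⁻¹ a)) = σ⁻¹ a := by simp
  have hs : (σ * α).SameCycle (σ⁻¹ a) ((σ * α)⁻¹ (σ⁻¹ a)) := ⟨-1, by simp⟩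
  have hc : conn σ α a ((σ * α)⁻¹ (σ⁻¹ a)) :=
    Setoid.trans' _ (Setoid.symm' _ D.conn_la) (conn_of_sameCycle_mul hs)
  have h1 := D.face_l hs hna
  refine h1.trans ?_
  have h2 := sameCycle_apply_self (glueVertex σ α r n a p * (α * swap n a))
    ((σ * α)⁻¹ (σ⁻¹ a))
  rw [D.face_apply (D.ne_n_of_conn_a hc) ?_ ?_, D.join_before_l hz hla] at h2
  · exact h2
  · intro e
    rw [e] at hs
    exact hna hs
  · exact fun e => D.sep (Setoid.trans' _ (conn_of_sameCycle_mul (sameCycle_pow_self _ _ (p - 1)))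
      (Setoid.symm' _ (e ▸ hc)))

/-- On the side of `n`, the new edge has the old face of `a`, apart from `a` itself. -/
lemma face_n {y : H} (h : (σ * α).SameCycle a y) (hne : y ≠ a) :
    (glueVertex σ α r n a p * (α * swap n a)).SameCycle n y := by
  have hla : σ⁻¹ a ≠ a := by
    intro e
    apply hne
    refine (h.eq_of_left ?_).symm
    change σ (α a) = a
    rw [D.root_a.fixed]
    conv_lhs => rw [← e, vertex_last]
  have hstep : (glueVertex σ α r n a p * (α * swap n a)) n = (σ * α) a := by
    have hr : conn σ α a r → False := fun k => D.sep (Setoid.symm' _ k)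
    rw [mul_apply, D.edge_n', D.glue_of_ne (Ne.symm D.ne_na), join_of_ne, mul_apply,
      D.root_a.fixed]
    · intro e
      apply D.not_face_la hla
      rw [← e]
      have := sameCycle_apply_self (σ * α) a
      rw [mul_apply, D.root_a.fixed] at this
      exact this.symm
    · intro e
      exact hla (σ.injective (by rw [e, vertex_last]))
    · exact fun e => hr (e ▸ conn_apply_left σ α a)
    · exact fun e => D.sep (e ▸ D.conn_corner (p - 1))
  have h1 := sameCycle_apply_self (glueVertex σ α r n a p * (α * swap n a)) n
  rw [hstep] at h1
  refine h1.trans (SameCycle.of_step_of_ne (fun y hy h2 h3 => ?_) h hne)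
  have hc : conn σ α a y := conn_of_sameCycle_mul hy
  refine D.face_apply_of_ne (D.ne_n_of_conn_a hc) h2 ?_ ?_ h3 ?_
  · exact fun e => D.sep (Setoid.trans' _ (conn_of_sameCycle_mul (sameCycle_pow_self _ _ (p - 1)))
      (Setoid.symm' _ (e ▸ hc)))
  · exact fun e => D.not_face_la hla (e ▸ hy.trans (sameCycle_apply_self _ _)).symm
  · exact fun e => D.sep (Setoid.symm' _ (e ▸ Setoid.trans' _ hc
      (conn_of_sameCycle_mul (sameCycle_apply_self (σ * α) y))))

/-- The set of half-edges on those faces that take part in the gluing. -/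
def touched (_D : GlueData σ α r n a p) : Set H :=
  {x | x = n ∨ (σ * α).SameCycle r x ∨ (σ * α).SameCycle (σ⁻¹ a) x ∨ (σ * α).SameCycle a x}

lemma mem_touched_iff {x y : H} (h : (σ * α).SameCycle x y) : x ∈ D.touched ↔ y ∈ D.touched := by
  have key : ∀ {x y}, (σ * α).SameCycle x y → x ∈ D.touched → y ∈ D.touched := by
    rintro x y h (rfl | k | k | k)
    · exact Or.inl (D.eq_of_conn_n (conn_of_sameCycle_mul h))
    · exact Or.inr (Or.inl (k.trans h))
    · exact Or.inr (Or.inr (Or.inl (k.trans h)))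
    · exact Or.inr (Or.inr (Or.inr (k.trans h)))
  exact ⟨key h, key h.symm⟩

lemma join_corner_mem : joinVertex σ r a (α (((σ * α) ^ (p - 1)) r)) ∈ D.touched := by
  set c := α (((σ * α) ^ (p - 1)) r) with hc
  have hσ : (σ * α).SameCycle r (σ c) := by
    have := sameCycle_pow_self (σ * α) r (p - 1 + 1)
    rwa [pow_succ', mul_apply, mul_apply, ← hc] at this
  have hcc : conn σ α r (σ c) := conn_of_sameCycle_mul hσ
  by_cases h : σ c = r
  · rw [D.join_before_r h]
    exact Or.inr (Or.inr (Or.inl (SameCycle.refl _ _)))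
  · rw [join_of_ne (fun e => D.not_conn_rl (e ▸ hcc)) (fun e => D.sep (e ▸ hcc)) h]
    exact Or.inr (Or.inl hσ)

/-- New faces are unions of parts of touched faces, or old faces. -/
lemma sameCycle_or_touched {x y : H}
    (h : (glueVertex σ α r n a p * (α * swap n a)).SameCycle x y) :
    (σ * α).SameCycle x y ∨ (x ∈ D.touched ∧ y ∈ D.touched) := by
  let s : Setoid H :=
    { r := fun x y => (σ * α).SameCycle x y ∨ (x ∈ D.touched ∧ y ∈ D.touched)
      iseqv :=
        { refl := fun x => Or.inl (SameCycle.refl _ x)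
          symm := fun h => h.imp (fun k => k.symm) And.symm
          trans := by
            rintro x y z (h | h) (k | k)
            · exact Or.inl (h.trans k)
            · exact Or.inr ⟨(D.mem_touched_iff h).2 k.1, k.2⟩
            · exact Or.inr ⟨h.1, (D.mem_touched_iff k).1 h.2⟩
            · exact Or.inr ⟨h.1, k.2⟩ } }
  have hn : n ∈ D.touched := Or.inl rfl
  have hr : r ∈ D.touched := Or.inr (Or.inl (SameCycle.refl _ _))
  have hl : σ⁻¹ a ∈ D.touched := Or.inr (Or.inr (Or.inl (SameCycle.refl _ _)))
  have ha : a ∈ D.touched := Or.inr (Or.inr (Or.inr (SameCycle.refl _ _)))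
  have big : ∀ {u v}, u ∈ D.touched → v ∈ D.touched → s u v := fun hu hv => Or.inr ⟨hu, hv⟩
  refine sameCycle_of_rel (s := s) (fun x => ?_) h
  have e : (glueVertex σ α r n a p * (α * swap n a)) x =
      swap n (joinVertex σ r a (α (((σ * α) ^ (p - 1)) r)))
        (swap (σ⁻¹ a) r (swap (σ⁻¹ a) a ((σ * α) (swap n a x)))) := rfl
  rw [e]
  refine Setoid.trans' _ (Setoid.rel_swap (big hn ha) x) ?_
  refine Setoid.trans' _ (Or.inl (sameCycle_apply_self (σ * α) _)) ?_
  refine Setoid.trans' _ (Setoid.rel_swap (big hl ha) _) ?_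
  refine Setoid.trans' _ (Setoid.rel_swap (big hl hr) _) ?_
  exact Setoid.rel_swap (big hn D.join_corner_mem) _

/-- The gluing up to the last step, in which the half-edges `n` and `a` are joined to an edge. At
this stage both have corners at the same face. -/
lemma genus_glue_swap : genus (glueVertex σ α r n a p) α = 0 ∧
    (glueVertex σ α r n a p * α).SameCycle n a := by
  -- Joining the vertices: first remove `σ⁻¹ a` from its vertex, then insert it before `r`.
  have g2 : genus (swap (σ⁻¹ a) a * σ) α = 0 := by
    by_cases hla : σ⁻¹ a = a
    · rw [hla, swap_self]
      exact D.good.genus_eq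
    · refine genus_swap_mul_eq_zero hla ?_ D.good.genus_eq
      have := sameCycle_apply_self σ (σ⁻¹ a)
      rwa [vertex_last] at this
  have c2 : ∀ {x y}, conn (swap (σ⁻¹ a) a * σ) α x y → conn σ α x y := by
    intro x y h
    have := conn_swap_mul_le h
    rwa [Setoid.mergeClasses_of_rel D.conn_la] at this
  have f2 : (swap (σ⁻¹ a) a * σ * α).SameCycle (σ⁻¹ a) a := by
    by_cases hla : σ⁻¹ a = a
    · rw [hla]
    · rw [mul_assoc]
      exact sameCycle_swap_mul_self (D.not_face_la hla)
  have s2 : ∀ {x y}, (σ * α).SameCycle x y → (swap (σ⁻¹ a) a * σ * α).SameCycle x y := by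
    intro x y h
    by_cases hla : σ⁻¹ a = a
    · rw [hla, swap_self]
      exact h
    · rw [mul_assoc]
      exact SameCycle.swap_mul_of_not (D.not_face_la hla) h
  have n1 : ¬ conn (swap (σ⁻¹ a) a * σ) α (σ⁻¹ a) r :=
    fun h => D.not_conn_rl (Setoid.symm' _ (c2 h))
  have g1 : genus (joinVertex σ r a) α = 0 := by
    rw [joinVertex, genus_swap_mul_of_not_conn n1, g2]
  have n1' : ¬ (swap (σ⁻¹ a) a * σ * α).SameCycle (σ⁻¹ a) r :=
    fun h => n1 (conn_of_sameCycle_mul h)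
  have s1 : ∀ {x y}, (swap (σ⁻¹ a) a * σ * α).SameCycle x y →
      (joinVertex σ r a * α).SameCycle x y := by
    intro x y h
    rw [joinVertex, mul_assoc]
    exact SameCycle.swap_mul_of_not n1' h
  have f1 : (joinVertex σ r a * α).SameCycle (σ⁻¹ a) r := by
    rw [joinVertex, mul_assoc]
    exact sameCycle_swap_mul_self n1'
  -- The half-edge `n` forms a component of its own until it is inserted.
  have nn : ¬ conn (joinVertex σ r a) α n
      (joinVertex σ r a (α (((σ * α) ^ (p - 1)) r))) :=
    fun h => D.join_corner_ne_n (eq_of_conn_of_fixed D.join_n D.edge_n h)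
  have nn' : ¬ (joinVertex σ r a * α).SameCycle n
      (joinVertex σ r a (α (((σ * α) ^ (p - 1)) r))) := fun h => nn (conn_of_sameCycle_mul h)
  refine ⟨by rw [glueVertex, genus_swap_mul_of_not_conn nn, g1], ?_⟩
  have s0 : ∀ {x y}, (joinVertex σ r a * α).SameCycle x y →
      (glueVertex σ α r n a p * α).SameCycle x y := by
    intro x y h
    rw [glueVertex, mul_assoc]
    exact SameCycle.swap_mul_of_not nn' h
  have f0 : (glueVertex σ α r n a p * α).SameCycle n
      (joinVertex σ r a (α (((σ * α) ^ (p - 1)) r))) := by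
    rw [glueVertex, mul_assoc]
    exact sameCycle_swap_mul_self nn'
  -- The faces of `n`, of `r`, of `σ⁻¹ a` and of `a` have become one.
  refine f0.trans ((s0 ?_).trans (s0 (s1 f2)))
  have h1 := sameCycle_apply_self (joinVertex σ r a * α) (((σ * α) ^ (p - 1)) r)
  rw [mul_apply] at h1
  exact h1.symm.trans ((s1 (s2 (sameCycle_pow_self _ _ _))).symm.trans f1.symm)

lemma not_edge_na : ¬ α.SameCycle n a := fun h => D.ne_na (h.eq_of_left D.edge_n)

lemma genus_glue : genus (glueVertex σ α r n a p) (α * swap n a) = 0 := by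
  rw [genus_mul_swap_of_sameCycle D.not_edge_na D.genus_glue_swap.2, D.genus_glue_swap.1]

lemma not_face_na :
    ¬ (glueVertex σ α r n a p * (α * swap n a)).SameCycle n a := by
  rw [← mul_assoc, ← sameCycle_inv, mul_inv_rev, swap_inv]
  exact not_sameCycle_swap_mul D.ne_na (sameCycle_inv.2 D.genus_glue_swap.2)

/-- An edge between the two faces at the vertex of `a` stays between different faces, namely those
on the two sides of the new edge. -/
lemma not_sameFace_aux {h : H} (hn : α h ≠ a) (hl : (σ * α).SameCycle (σ⁻¹ a) h)
    (ha : (σ * α).SameCycle a (α h)) :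
    ¬ (glueVertex σ α r n a p * (α * swap n a)).SameCycle h (α h) := by
  intro hs
  apply D.not_face_na
  have hla : ¬ (σ * α).SameCycle (σ⁻¹ a) a := by
    refine D.not_face_la fun e => ?_
    have h1 : (σ * α) a = a := by
      rw [mul_apply, D.root_a.fixed]
      conv_lhs => rw [← e]
      simp
    exact hn (ha.eq_of_left h1).symm
  exact (D.face_n ha hn).trans (hs.symm.trans ((D.face_l hl hla).symm.trans D.face_la))

lemma planarBridgeless : PlanarBridgeless (glueVertex σ α r n a p) (α * swap n a) where
  invol h := by
    by_cases h1 : h = n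
    · rw [h1, D.edge_n', D.edge_a']
    by_cases h2 : h = a
    · rw [h2, D.edge_a', D.edge_n']
    rw [edge_of_ne h1 h2, edge_of_ne, D.good.invol]
    · exact D.edge_ne_n h1
    · exact fun e => h2 (α.injective (e.trans D.root_a.fixed.symm))
  genus_eq := D.genus_glue
  not_sameFace h hne hs := by
    by_cases h1 : h = n
    · rw [h1, D.edge_n'] at hs
      exact D.not_face_na hs
    by_cases h2 : h = a
    · rw [h2, D.edge_a'] at hs
      exact D.not_face_na hs.symm
    rw [edge_of_ne h1 h2] at hne hs
    -- The half-edges `h` and `α h` belong to the same map and differ from `n`, so that only edges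
    -- between the faces of `σ⁻¹ a` and of `a` need an argument.
    have key := D.good.not_sameFace h hne
    have hα := conn_apply_right σ α h
    have h3 : α h ≠ a := fun e => h2 (α.injective (e.trans D.root_a.fixed.symm))
    have h4 : conn σ α a (σ⁻¹ a) := Setoid.symm' _ D.conn_la
    have sepl : ∀ {x}, conn σ α r x → conn σ α a x → False :=
      fun h h' => D.sep (Setoid.trans' _ h (Setoid.symm' _ h'))
    rcases D.sameCycle_or_touched hs with k | ⟨k | k | k | k, k' | k' | k' | k'⟩
    · exact key k
    · exact h1 k
    · exact h1 k
    · exact h1 k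
    · exact h1 k
    · exact D.edge_ne_n h1 k'
    · exact key (k.symm.trans k')
    · exact sepl (Setoid.trans' _ (conn_of_sameCycle_mul k) hα)
        (Setoid.trans' _ h4 (conn_of_sameCycle_mul k'))
    · exact sepl (Setoid.trans' _ (conn_of_sameCycle_mul k) hα) (conn_of_sameCycle_mul k')
    · exact D.edge_ne_n h1 k'
    · exact sepl (conn_of_sameCycle_mul k') (Setoid.trans' _ h4
        (Setoid.trans' _ (conn_of_sameCycle_mul k) hα))
    · exact key (k.symm.trans k')
    · exact D.not_sameFace_aux h3 k k' hs
    · exact D.edge_ne_n h1 k'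
    · exact sepl (conn_of_sameCycle_mul k') (Setoid.trans' _ (conn_of_sameCycle_mul k) hα)
    · refine D.not_sameFace_aux (h := α h) ?_ k' ?_ ?_
      · rwa [D.good.invol]
      · rwa [D.good.invol]
      · rw [D.good.invol]
        exact hs.symm
    · exact key (k.symm.trans k')

/-- Gluing joins no more than the components of `r`, of `a` and of `n`. -/
lemma conn_sub {x : H} (h : conn (glueVertex σ α r n a p) (α * swap n a) r x) :
    conn σ α r x ∨ conn σ α a x ∨ x = n := by
  let T : H → Prop := fun x => conn σ α r x ∨ conn σ α a x ∨ x = n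
  have hTr : T r := Or.inl (Setoid.refl' _ r)
  have hTa : T a := Or.inr (Or.inl (Setoid.refl' _ a))
  have hTl : T (σ⁻¹ a) := Or.inr (Or.inl (Setoid.symm' _ D.conn_la))
  have hTn : T n := Or.inr (Or.inr rfl)
  have hswap : ∀ {u v}, T u → T v → ∀ y, T (swap u v y) = T y := by
    intro u v hu hv y
    by_cases h1 : y = u
    · rw [h1, swap_apply_left]
      exact propext ⟨fun _ => hu, fun _ => hv⟩
    by_cases h2 : y = v
    · rw [h2, swap_apply_right]
      exact propext ⟨fun _ => hv, fun _ => hu⟩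
    rw [swap_apply_of_ne_of_ne h1 h2]
  have hconn : ∀ y z, conn σ α y z → T y = T z := by
    intro y z hyz
    refine propext ⟨?_, ?_⟩
    · rintro (k | k | rfl)
      · exact Or.inl (Setoid.trans' _ k hyz)
      · exact Or.inr (Or.inl (Setoid.trans' _ k hyz))
      · exact Or.inr (Or.inr (D.eq_of_conn_n hyz))
    · rintro (k | k | rfl)
      · exact Or.inl (Setoid.trans' _ k (Setoid.symm' _ hyz))
      · exact Or.inr (Or.inl (Setoid.trans' _ k (Setoid.symm' _ hyz)))
      · exact Or.inr (Or.inr (D.eq_of_conn_n (Setoid.symm' _ hyz)))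
  have hjoin : ∀ y, T (joinVertex σ r a y) = T y := by
    intro y
    rw [joinVertex, mul_apply, mul_apply, hswap hTl hTr, hswap hTl hTa]
    exact (hconn _ _ (conn_apply_left σ α y)).symm
  have key : T r = T x := by
    refine rel_of_conn (s := Setoid.ker T) (fun y => ?_) (fun y => ?_) h
    · change T y = T (glueVertex σ α r n a p y)
      rw [glueVertex, mul_apply, hswap hTn, hjoin]
      rw [hjoin]
      exact Or.inl (D.conn_corner _)
    · change T y = T (α (swap n a y))
      rw [← hconn _ _ (conn_apply_right σ α _), hswap hTn hTa]
  exact (show T r = T x from key).mp hTr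

lemma rootAt : RootAt (glueVertex σ α r n a p) (α * swap n a) r where
  fixed := by rw [edge_of_ne (Ne.symm D.ne_nr) D.ne_ra, D.root_r.fixed]
  unique h hc hf := by
    have h1 : h ≠ n := by
      rintro rfl
      rw [D.edge_n'] at hf
      exact D.ne_na hf.symm
    have h2 : h ≠ a := by
      rintro rfl
      rw [D.edge_a'] at hf
      exact D.ne_na hf
    rw [edge_of_ne h1 h2] at hf
    rcases D.conn_sub hc with k | k | k
    · exact D.root_r.unique h k hf
    · exact absurd (D.root_a.unique h k hf) h2
    · exact absurd k h1

/-- Gluing produces a map that is cut into the given pieces. -/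
lemma cutData :
    CutData (glueVertex σ α r n a p) (α * swap n a) r (σ⁻¹ a) n a p where
  good := D.planarBridgeless
  root := D.rootAt
  ne_self h := D.ne_lr ((glueVertex σ α r n a p).injective (D.glue_l.trans h.symm))
  last := D.glue_l
  left := D.face_pow_p
  right := D.edge_n'
  face := D.face_la
  first i hi hs := by
    have hp := D.le
    have hri : (σ * α).SameCycle r (((σ * α) ^ i) r) := sameCycle_pow_self _ _ i
    have hc := D.conn_corner i
    have hn := D.ne_n_of_conn (conn_of_sameCycle_mul hri)
    have ha : ((σ * α) ^ i) r ≠ a := fun e => D.sep (e ▸ conn_of_sameCycle_mul hri)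
    have hrn : (glueVertex σ α r n a p * (α * swap n a)).SameCycle r n := by
      have := sameCycle_pow_self (glueVertex σ α r n a p * (α * swap n a)) r p
      rwa [D.face_pow_p] at this
    rw [D.face_pow hi, edge_of_ne hn ha] at hs
    have hal := Setoid.trans' _ D.conn_la (Setoid.refl' _ a)
    have hface : (σ * α).SameCycle r (α (((σ * α) ^ i) r)) := by
      rcases D.sameCycle_or_touched hs with k | ⟨-, k | k | k | k⟩
      · exact absurd (Setoid.trans' _ hc (Setoid.symm' _ (conn_of_sameCycle_mul k)))
          D.not_conn_rl
      · exact absurd k (D.ne_n_of_conn hc)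
      · exact k
      · exact absurd (Setoid.trans' _ hc (Setoid.symm' _ (conn_of_sameCycle_mul k)))
          D.not_conn_rl
      · exact absurd (Setoid.trans' _ hc (Setoid.symm' _ (conn_of_sameCycle_mul k))) D.sep
    by_cases hfix : α (((σ * α) ^ i) r) = ((σ * α) ^ i) r
    · have h1 := D.root_r.unique _ (conn_of_sameCycle_mul hri) hfix
      rw [hfix, h1] at hs
      exact D.not_face_na (hrn.symm.trans (hs.symm.trans D.face_la))
    · exact D.good.not_sameFace _ hfix (hri.symm.trans hface)

lemma cutVertex_glue : cutVertex (glueVertex σ α r n a p) r (σ⁻¹ a) n a = σ := by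
  rw [cutVertex, D.glue_n, glueVertex]
  simp only [mul_assoc, swap_mul_self_mul, joinVertex]

omit D in
lemma cutEdge_glue : α * swap n a * swap n a = α := by
  rw [mul_assoc, swap_mul_self, mul_one]

end GlueData

end PermPair

/-! ### Codes of maps -/

/-- The disjoint union of two equivalence relations and a one-point class. -/
def Setoid.optionSum {X Y : Type*} (t : Setoid X) (u : Setoid Y) : Setoid (Option (X ⊕ Y)) where
  r
    | some (Sum.inl a), some (Sum.inl b) => t a b
    | some (Sum.inr a), some (Sum.inr b) => u a b
    | none, none => True
    | _, _ => False
  iseqv :=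
    { refl := by
        rintro (_ | a | a)
        · trivial
        · exact t.refl a
        · exact u.refl a
      symm := by
        rintro (_ | a | a) (_ | b | b) h
        all_goals first | trivial | exact h.elim | exact t.symm h | exact u.symm h
      trans := by
        rintro (_ | a | a) (_ | b | b) (_ | c | c) h k
        all_goals first | trivial | exact h.elim | exact k.elim | exact t.trans h k |
          exact u.trans h k }

namespace PermPair

open Equiv Equiv.Perm

lemma cycles_eq_conn {H : Type*} (π : Perm H) : π.cycles = conn π 1 := by
  ext x y
  refine ⟨fun h => conn_of_sameCycle h, fun h => ?_⟩
  exact rel_of_conn (s := π.cycles) (fun x => ⟨1, by simp⟩) (fun x => SameCycle.refl _ _) h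

section OptionSum

variable {X Y : Type*}

/-- Two permutations acting side by side, with a further fixed point. -/
def optionSum (π : Perm X) (ρ : Perm Y) : Perm (Option (X ⊕ Y)) := optionCongr (Equiv.sumCongr π ρ)

lemma optionSum_inl (π : Perm X) (ρ : Perm Y) (x : X) :
    optionSum π ρ (some (Sum.inl x)) = some (Sum.inl (π x)) := rfl

lemma optionSum_inr (π : Perm X) (ρ : Perm Y) (y : Y) :
    optionSum π ρ (some (Sum.inr y)) = some (Sum.inr (ρ y)) := rfl

lemma optionSum_mul (π π' : Perm X) (ρ ρ' : Perm Y) :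
    optionSum π ρ * optionSum π' ρ' = optionSum (π * π') (ρ * ρ') := by
  ext1 (_ | x | y) <;> rfl

lemma optionSum_one : optionSum (1 : Perm X) (1 : Perm Y) = 1 := by
  ext1 (_ | x | y) <;> rfl

lemma conn_optionSum (σ α : Perm X) (τ β : Perm Y) :
    conn (optionSum σ τ) (optionSum α β) = (conn σ α).optionSum (conn τ β) := by
  ext x y
  constructor
  · refine fun h => rel_of_conn ?_ ?_ h
    · rintro (_ | a | a)
      · trivial
      · exact conn_apply_left σ α a
      · exact conn_apply_left τ β a
    · rintro (_ | a | a)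
      · trivial
      · exact conn_apply_right σ α a
      · exact conn_apply_right τ β a
  · have hX : ∀ a b, conn σ α a b → conn (optionSum σ τ) (optionSum α β)
        (some (Sum.inl a)) (some (Sum.inl b)) := by
      intro a b h
      exact rel_of_conn (s := Setoid.comap (fun a => some (Sum.inl a))
        (conn (optionSum σ τ) (optionSum α β))) (fun a => conn_apply_left _ _ _)
        (fun a => conn_apply_right _ _ _) h
    have hY : ∀ a b, conn τ β a b → conn (optionSum σ τ) (optionSum α β)
        (some (Sum.inr a)) (some (Sum.inr b)) := by
      intro a b h
      exact rel_of_conn (s := Setoid.comap (fun a => some (Sum.inr a))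
        (conn (optionSum σ τ) (optionSum α β))) (fun a => conn_apply_left _ _ _)
        (fun a => conn_apply_right _ _ _) h
    rcases x with _ | a | a <;> rcases y with _ | b | b <;> intro h
    · exact Setoid.refl' _ _
    · exact h.elim
    · exact h.elim
    · exact h.elim
    · exact hX a b h
    · exact h.elim
    · exact h.elim
    · exact h.elim
    · exact hY a b h

lemma cycles_optionSum (π : Perm X) (ρ : Perm Y) :
    (optionSum π ρ).cycles = π.cycles.optionSum ρ.cycles := by
  rw [cycles_eq_conn, cycles_eq_conn, cycles_eq_conn, ← conn_optionSum, optionSum_one]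

lemma numClasses_optionSum [Finite X] [Finite Y] (t : Setoid X) (u : Setoid Y) :
    (t.optionSum u).numClasses = t.numClasses + u.numClasses + 1 :=
  Setoid.numClasses_option_sum (fun _ _ => Iff.rfl) (fun _ _ => Iff.rfl) (fun _ _ h => h)
    (by rintro (a | a) h <;> exact h)

lemma genus_optionSum [Finite X] [Finite Y] (σ α : Perm X) (τ β : Perm Y) :
    genus (optionSum σ τ) (optionSum α β) = genus σ α + genus τ β := by
  unfold genus
  rw [optionSum_mul, conn_optionSum, cycles_optionSum, cycles_optionSum, cycles_optionSum]
  simp only [numClasses_optionSum]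
  have : Nat.card (Option (X ⊕ Y)) = Nat.card X + Nat.card Y + 1 := by
    rw [Finite.card_option, Nat.card_sum]
  rw [this]
  push_cast
  ring

lemma PlanarBridgeless.optionSum [Finite X] [Finite Y] {σ α : Perm X} {τ β : Perm Y}
    (h : PlanarBridgeless σ α) (k : PlanarBridgeless τ β) :
    PlanarBridgeless (optionSum σ τ) (optionSum α β) where
  invol := by
    rintro (_ | a | a)
    · rfl
    · rw [optionSum_inl, optionSum_inl, h.invol]
    · rw [optionSum_inr, optionSum_inr, k.invol]
  genus_eq := by rw [genus_optionSum, h.genus_eq, k.genus_eq, add_zero]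
  not_sameFace := by
    have key : ∀ x y, (PermPair.optionSum σ τ * PermPair.optionSum α β).SameCycle x y →
        ((σ * α).cycles.optionSum (τ * β).cycles) x y := by
      intro x y hxy
      rw [← cycles_optionSum, ← optionSum_mul]
      exact hxy
    rintro (_ | a | a) hne hs
    · exact hne rfl
    · exact h.not_sameFace a (fun e => hne (by rw [optionSum_inl, e])) (key _ _ hs)
    · exact k.not_sameFace a (fun e => hne (by rw [optionSum_inr, e])) (key _ _ hs)

lemma RootAt.optionSum_inl {σ α : Perm X} (τ β : Perm Y) {r : X} (h : RootAt σ α r) :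
    RootAt (optionSum σ τ) (optionSum α β) (some (Sum.inl r)) where
  fixed := by rw [PermPair.optionSum_inl, h.fixed]
  unique := by
    rw [conn_optionSum]
    rintro (_ | a | a) hc hf
    · exact hc.elim
    · rw [PermPair.optionSum_inl] at hf
      rw [h.unique a hc (by simpa using hf)]
    · exact hc.elim

lemma RootAt.optionSum_inr (σ α : Perm X) {τ β : Perm Y} {r : Y} (h : RootAt τ β r) :
    RootAt (optionSum σ τ) (optionSum α β) (some (Sum.inr r)) where
  fixed := by rw [PermPair.optionSum_inr, h.fixed]
  unique := by
    rw [conn_optionSum]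
    rintro (_ | a | a) hc hf
    · exact hc.elim
    · exact hc.elim
    · rw [PermPair.optionSum_inr] at hf
      rw [h.unique a hc (by simpa using hf)]

end OptionSum

section HasCode

variable {H : Type*} [DecidableEq H] [Finite H]

/-- The map with root `r` is described by the code: it is cut recursively until only dangling
half-edges are left. -/
inductive HasCode : Perm H → Perm H → H → Code → Prop
  | leaf {σ α : Perm H} {r : H} (h : σ r = r) : HasCode σ α r Code.leaf
  | node {σ α : Perm H} {r l n a : H} {p : ℕ} {B A : Code} (D : CutData σ α r l n a p)
      (hB : HasCode (cutVertex σ r l n a) (α * swap n a) r B)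
      (hA : HasCode (cutVertex σ r l n a) (α * swap n a) a A) : HasCode σ α r (Code.node B A p)

lemma exists_hasCode {σ α : Perm H} {r : H} (h : PlanarBridgeless σ α) (hr : RootAt σ α r) :
    ∃ c, HasCode σ α r c := by
  obtain ⟨k, hk⟩ : ∃ k, {x | conn σ α r x}.ncard = k := ⟨_, rfl⟩
  induction k using Nat.strong_induction_on generalizing σ α r with
  | _ k ih =>
  by_cases hne : σ r = r
  · exact ⟨_, HasCode.leaf hne⟩
  obtain ⟨l, n, a, p, D⟩ := exists_cutData h hr hne
  have hlt : ∀ x, conn σ α r x → ¬ conn (cutVertex σ r l n a) (α * swap n a) x n →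
      {y | conn (cutVertex σ r l n a) (α * swap n a) x y}.ncard < k := by
    intro x hx hn
    rw [← hk]
    refine Set.ncard_lt_ncard ⟨fun y hy => Setoid.trans' _ hx (D.conn_of_conn_cut hy), ?_⟩
    exact fun hs => hn (hs D.conn_rn)
  obtain ⟨B, hB⟩ := ih _ (hlt r (Setoid.refl' _ r)
    (fun e => D.ne_rn (D.eq_of_conn_n (Setoid.symm' _ e)))) D.planarBridgeless D.rootAt_r rfl
  obtain ⟨A, hA⟩ := ih _ (hlt a D.conn_ra
    (fun e => D.ne_na (D.eq_of_conn_n (Setoid.symm' _ e)).symm)) D.planarBridgeless D.rootAt_a rfl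
  exact ⟨_, HasCode.node D hB hA⟩

lemma CutData.unique {σ α : Perm H} {r l n a l' n' a' : H} {p p' : ℕ}
    (D : CutData σ α r l n a p) (D' : CutData σ α r l' n' a' p') :
    l' = l ∧ n' = n ∧ a' = a ∧ p' = p := by
  have hl : l' = l := σ.injective (D'.last.trans D.last.symm)
  subst hl
  have hp : p' = p := by
    rcases lt_trichotomy p' p with h | h | h
    · exact absurd (by rw [D'.left, D'.right]; exact D'.face) (D.first p' h)
    · exact h
    · exact absurd (by rw [D.left, D.right]; exact D.face) (D'.first p h)
  subst hp
  have hn : n' = n := D'.left.symm.trans D.left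
  subst hn
  exact ⟨rfl, rfl, D'.right.symm.trans D.right, rfl⟩

lemma HasCode.unique {σ α : Perm H} {r : H} {c c' : Code} (h : HasCode σ α r c)
    (h' : HasCode σ α r c') : c = c' := by
  induction h generalizing c' with
  | leaf h =>
    cases h' with
    | leaf => rfl
    | node D => exact absurd h D.ne_self
  | node D _ _ ihB ihA =>
    cases h' with
    | leaf h => exact absurd h D.ne_self
    | node D' hB' hA' =>
      obtain ⟨rfl, rfl, rfl, rfl⟩ := D.unique D'
      rw [ihB hB', ihA hA']

/-- The parameters of a code in terms of the map. -/
lemma HasCode.spec {σ α : Perm H} {r : H} {c : Code} (h : HasCode σ α r c)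
    (hr : RootAt σ α r) :
    c.Valid ∧ c.width = (σ * α).period r ∧ c.spine = vertexFaces σ α r ∧
      {x | conn σ α r x}.ncard + 1 = 2 * c.size := by
  induction h with
  | @leaf σ α r h =>
    have hf : (σ * α) r = r := by rw [mul_apply, hr.fixed, h]
    refine ⟨trivial, ?_, ?_, ?_⟩
    · exact (period_eq one_pos (by rw [pow_one, hf]) (by omega)).symm
    · have : {x | σ.SameCycle r x} = {r} := by
        ext x
        exact ⟨fun k => (SameCycle.eq_of_left k h).symm, fun k => k ▸ SameCycle.refl _ _⟩
      rw [vertexFaces, this, Setoid.classesMeeting, Set.image_singleton, Set.ncard_singleton]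
      rfl
    · have : {x | conn σ α r x} = {r} := by
        ext x
        exact ⟨eq_of_conn_of_fixed h hr.fixed, fun k => k ▸ (Setoid.refl' _ _ : conn σ α r r)⟩
      rw [this, Set.ncard_singleton]
      rfl
  | @node σ α r l n a p B A D _ _ ihB ihA =>
    obtain ⟨vB, wB, sB, nB⟩ := ihB D.rootAt_r
    obtain ⟨vA, wA, sA, nA⟩ := ihA D.rootAt_a
    refine ⟨⟨vB, vA, D.p_pos, wB ▸ D.p_le⟩, ?_, ?_, ?_⟩
    · rw [D.period_cut_a, ← wA]
      rfl
    · rw [D.vertexFaces_eq, ← sB]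
      rfl
    · have hU : {x | conn σ α r x} = {x | conn (cutVertex σ r l n a) (α * swap n a) r x} ∪
          {x | conn (cutVertex σ r l n a) (α * swap n a) a x} ∪ {n} := by
        ext x
        rw [Set.union_assoc]
        exact D.conn_iff
      have d1 : Disjoint {x | conn (cutVertex σ r l n a) (α * swap n a) r x}
          {x | conn (cutVertex σ r l n a) (α * swap n a) a x} := by
        rw [Set.disjoint_left]
        exact fun x h k => D.not_conn_ra (Setoid.trans' _ h (Setoid.symm' _ k))
      have d2 : Disjoint ({x | conn (cutVertex σ r l n a) (α * swap n a) r x} ∪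
          {x | conn (cutVertex σ r l n a) (α * swap n a) a x}) {n} := by
        rw [Set.disjoint_singleton_right]
        rintro (k | k)
        · exact D.ne_rn (D.eq_of_conn_n (Setoid.symm' _ k))
        · exact D.ne_na (D.eq_of_conn_n (Setoid.symm' _ k)).symm
      rw [hU, Set.ncard_union_eq d2, Set.ncard_union_eq d1, Set.ncard_singleton, Code.size]
      omega

variable {H' : Type*} [DecidableEq H'] [Finite H']

lemma sameCycle_map_iff {X Y : Type*} [Finite X] [Finite Y] {e : X → Y}
    (he : Function.Injective e) {π : Perm X} {π' : Perm Y} (h : ∀ x, e (π x) = π' (e x))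
    {x y : X} : π'.SameCycle (e x) (e y) ↔ π.SameCycle x y := by
  have hpow : ∀ (k : ℕ) x, (π' ^ k) (e x) = e ((π ^ k) x) := by
    intro k
    induction k with
    | zero => exact fun _ => rfl
    | succ k ih => exact fun x => by rw [pow_succ', mul_apply, ih, ← h, pow_succ', mul_apply]
  constructor
  · intro hs
    obtain ⟨k, -, hk⟩ := hs.exists_pow_eq'
    rw [hpow] at hk
    rw [← he hk]
    exact sameCycle_pow_self _ _ _
  · intro hs
    obtain ⟨k, -, hk⟩ := hs.exists_pow_eq'
    rw [← hk, ← hpow]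
    exact sameCycle_pow_self _ _ _

lemma CutData.map {σ α : Perm H} {r l n a : H} {p : ℕ} (D : CutData σ α r l n a p)
    {σ' α' : Perm H'} {e : H → H'} (he : Function.Injective e) (h1 : ∀ x, e (σ x) = σ' (e x))
    (h2 : ∀ x, e (α x) = α' (e x)) (h : PlanarBridgeless σ' α') (hr : RootAt σ' α' (e r)) :
    CutData σ' α' (e r) (e l) (e n) (e a) p := by
  have h3 : ∀ x, e ((σ * α) x) = (σ' * α') (e x) := fun x => by
    rw [mul_apply, mul_apply, h1, h2]
  have hpow : ∀ (k : ℕ) x, ((σ' * α') ^ k) (e x) = e (((σ * α) ^ k) x) := by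
    intro k
    induction k with
    | zero => exact fun _ => rfl
    | succ k ih =>
      intro x
      rw [pow_succ', mul_apply (σ' * α'), ih, ← h3, pow_succ' (σ * α), mul_apply (σ * α)]
  refine ⟨h, hr, fun k => D.ne_self (he ((h1 r).trans k)), ?_, ?_, ?_, ?_, ?_⟩
  · rw [← h1, D.last]
  · rw [hpow, D.left]
  · rw [← h2, D.right]
  · exact (sameCycle_map_iff he h3).2 D.face
  · intro i hi
    rw [hpow, ← h2, sameCycle_map_iff he h3]
    exact D.first i hi

/-- Codes are preserved by embeddings of maps as components of larger maps. -/
lemma HasCode.map {σ α : Perm H} {r : H} {c : Code} (hc : HasCode σ α r c)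
    {σ' α' : Perm H'} {e : H → H'} (he : Function.Injective e) (h1 : ∀ x, e (σ x) = σ' (e x))
    (h2 : ∀ x, e (α x) = α' (e x)) (h : PlanarBridgeless σ' α') (hr : RootAt σ' α' (e r)) :
    HasCode σ' α' (e r) c := by
  induction hc generalizing σ' α' with
  | leaf k => exact HasCode.leaf (by rw [← h1, k])
  | @node σ α r l n a p B A D _ _ ihB ihA =>
    have D' := D.map he h1 h2 h hr
    have c1 : ∀ x, e (cutVertex σ r l n a x) = cutVertex σ' (e r) (e l) (e n) (e a) (e x) := by
      intro x
      simp only [cutVertex, mul_apply, ← h1, he.swap_apply]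
    have c2 : ∀ x, e ((α * swap n a) x) = (α' * swap (e n) (e a)) (e x) := by
      intro x
      simp only [mul_apply, h2, he.swap_apply]
    exact HasCode.node D' (ihB c1 c2 D'.planarBridgeless D'.rootAt_r)
      (ihA c1 c2 D'.planarBridgeless D'.rootAt_a)

/-- Two maps with the same code are isomorphic. -/
lemma HasCode.exists_iso {σ α : Perm H} {r : H} {c : Code} (hc : HasCode σ α r c)
    (hr : RootAt σ α r) {σ' α' : Perm H'} {r' : H'} (hc' : HasCode σ' α' r' c)
    (hr' : RootAt σ' α' r') :
    ∃ e : H → H', e r = r' ∧ Set.InjOn e {x | conn σ α r x} ∧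
      (∀ x, conn σ α r x → conn σ' α' r' (e x)) ∧
      (∀ x, conn σ α r x → e (σ x) = σ' (e x)) ∧ ∀ x, conn σ α r x → e (α x) = α' (e x) := by
  induction hc generalizing σ' α' r' with
  | @leaf σ α r h =>
    cases hc' with
    | leaf h' =>
      have key : ∀ x, conn σ α r x → x = r := fun _ => eq_of_conn_of_fixed h hr.fixed
      exact ⟨fun _ => r', rfl, fun x hx y hy _ => (key x hx).trans (key y hy).symm,
        fun _ _ => Setoid.refl' _ _, fun _ _ => h'.symm, fun _ _ => hr'.fixed.symm⟩
  | @node σ α r l n a p B A D hB hA ihB ihA =>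
    cases hc' with
    | @node _ _ _ l' n' a' _ _ _ D' hB' hA' =>
    obtain ⟨f, f1, f2, f3, f4, f5⟩ := ihB D.rootAt_r hB' D'.rootAt_r
    obtain ⟨g, g1, g2, g3, g4, g5⟩ := ihA D.rootAt_a hA' D'.rootAt_a
    classical
    set σ₀ := cutVertex σ r l n a with hσ₀
    set α₀ := α * swap n a with hα₀
    set τ₀ := cutVertex σ' r' l' n' a' with hτ₀
    set β₀ := α' * swap n' a' with hβ₀
    -- The isomorphism is `f` on the component of `r` and `g` on that of `a`, and maps `n` to `n'`.
    -- Since it intertwines the maps after the cuts, it intertwines the transpositions that undo the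
    -- cuts.
    let e : H → H' := fun x => if x = n then n' else if conn σ₀ α₀ a x then g x else f x
    have en : e n = n' := if_pos rfl
    have eA : ∀ x, conn σ₀ α₀ a x → e x = g x := by
      intro x hx
      have : x ≠ n := by
        rintro rfl
        exact D.ne_na (D.eq_of_conn_n (Setoid.symm' _ hx)).symm
      change (if x = n then n' else _) = _
      rw [if_neg this, if_pos hx]
    have eB : ∀ x, conn σ₀ α₀ r x → e x = f x := by
      intro x hx
      have : x ≠ n := by
        rintro rfl
        exact D.ne_rn (D.eq_of_conn_n (Setoid.symm' _ hx))
      change (if x = n then n' else _) = _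
      rw [if_neg this, if_neg]
      exact fun k => D.not_conn_ra (Setoid.trans' _ hx (Setoid.symm' _ k))
    have er : e r = r' := (eB r (Setoid.refl' _ r)).trans f1
    have ea : e a = a' := (eA a (Setoid.refl' _ a)).trans g1
    have hinj : Set.InjOn e {x | conn σ α r x} := by
      intro x hx y hy hxy
      have neB : ∀ z, conn τ₀ β₀ r' z → z ≠ n' := by
        rintro z hz rfl
        exact D'.ne_rn (D'.eq_of_conn_n (Setoid.symm' _ hz))
      have neA : ∀ z, conn τ₀ β₀ a' z → z ≠ n' := by
        rintro z hz rfl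
        exact D'.ne_na (D'.eq_of_conn_n (Setoid.symm' _ hz)).symm
      have neAB : ∀ z w, conn τ₀ β₀ r' z → conn τ₀ β₀ a' w → z ≠ w := by
        rintro z w hz hw rfl
        exact D'.not_conn_ra (Setoid.trans' _ hz (Setoid.symm' _ hw))
      rcases D.conn_iff.1 hx with hx | hx | rfl <;> rcases D.conn_iff.1 hy with hy | hy | rfl
      · exact f2 hx hy (by rw [← eB x hx, hxy, eB y hy])
      · rw [eB x hx, eA y hy] at hxy
        exact absurd hxy (neAB _ _ (f3 x hx) (g3 y hy))
      · rw [eB x hx, en] at hxy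
        exact absurd hxy (neB _ (f3 x hx))
      · rw [eA x hx, eB y hy] at hxy
        exact absurd hxy.symm (neAB _ _ (f3 y hy) (g3 x hx))
      · exact g2 hx hy (by rw [← eA x hx, hxy, eA y hy])
      · rw [eA x hx, en] at hxy
        exact absurd hxy (neA _ (g3 x hx))
      · rw [eB y hy, en] at hxy
        exact absurd hxy.symm (neB _ (f3 y hy))
      · rw [eA y hy, en] at hxy
        exact absurd hxy.symm (neA _ (g3 y hy))
      · rfl
    have c1 : ∀ x, conn σ α r x → e (σ₀ x) = τ₀ (e x) := by
      intro x hx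
      rcases D.conn_iff.1 hx with hx | hx | rfl
      · rw [eB x hx, ← f4 x hx, eB _ (Setoid.trans' _ hx (conn_apply_left _ _ x))]
      · rw [eA x hx, ← g4 x hx, eA _ (Setoid.trans' _ hx (conn_apply_left _ _ x))]
      · rw [hσ₀, D.cut_n, en, hτ₀, D'.cut_n]
    have c2 : ∀ x, conn σ α r x → e (α₀ x) = β₀ (e x) := by
      intro x hx
      rcases D.conn_iff.1 hx with hx | hx | rfl
      · rw [eB x hx, ← f5 x hx, eB _ (Setoid.trans' _ hx (conn_apply_right _ _ x))]
      · rw [eA x hx, ← g5 x hx, eA _ (Setoid.trans' _ hx (conn_apply_right _ _ x))]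
      · rw [hα₀, D.cutEdge_n, en, hβ₀, D'.cutEdge_n]
    have m1 : ∀ x, conn σ α r x → conn σ α r (σ₀ x) := fun x hx =>
      Setoid.trans' _ hx (D.conn_of_conn_cut (conn_apply_left _ _ x))
    have m2 : ∀ x, conn σ α r x → conn σ α r (α₀ x) := fun x hx =>
      Setoid.trans' _ hx (D.conn_of_conn_cut (conn_apply_right _ _ x))
    have hl := D.conn_rl
    have hn := D.conn_rn
    have ha := D.conn_ra
    have hrr : conn σ α r r := Setoid.refl' _ r
    have el : e l = l' := by
      apply τ₀.injective
      rw [← c1 l hl, hσ₀, D.cut_l, ea, hτ₀, D'.cut_l]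
    have sw : ∀ {u v x}, conn σ α r u → conn σ α r v → conn σ α r x →
        e (swap u v x) = swap (e u) (e v) (e x) := by
      intro u v x hu hv hx
      by_cases h1 : x = u
      · rw [h1, swap_apply_left, swap_apply_left]
      by_cases h2 : x = v
      · rw [h2, swap_apply_right, swap_apply_right]
      rw [swap_apply_of_ne_of_ne h1 h2, swap_apply_of_ne_of_ne]
      · exact fun k => h1 (hinj hx hu k)
      · exact fun k => h2 (hinj hx hv k)
    have ms : ∀ {u v x}, conn σ α r u → conn σ α r v → conn σ α r x →
        conn σ α r (swap u v x) := by
      intro u v x hu hv hx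
      exact Setoid.trans' _ hx (Setoid.rel_swap (Setoid.trans' _ (Setoid.symm' _ hu) hv) x)
    have hpow : ∀ k : ℕ, conn σ α r (((σ₀ * α₀) ^ k) r) ∧
        e (((σ₀ * α₀) ^ k) r) = ((τ₀ * β₀) ^ k) r' := by
      intro k
      induction k with
      | zero => exact ⟨hrr, er⟩
      | succ k ih =>
        rw [pow_succ', mul_apply (σ₀ * α₀), mul_apply σ₀ α₀, pow_succ', mul_apply (τ₀ * β₀),
          mul_apply τ₀ β₀, ← ih.2, ← c2 _ ih.1, ← c1 _ (m2 _ ih.1)]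
        exact ⟨m1 _ (m2 _ ih.1), rfl⟩
    -- The place where `n` is inserted is determined by the label `p`.
    have eσn : e (σ n) = σ' n' := by
      have e1 : swap l r (swap l a (σ₀ (α₀ (((σ₀ * α₀) ^ (p - 1)) r)))) = σ n := D.apply_n
      have e2 : swap l' r' (swap l' a' (τ₀ (β₀ (((τ₀ * β₀) ^ (p - 1)) r')))) = σ' n' := D'.apply_n
      rw [← e1, ← e2, sw hl hrr (ms hl ha (m1 _ (m2 _ (hpow _).1))),
        sw hl ha (m1 _ (m2 _ (hpow _).1)),
        c1 _ (m2 _ (hpow _).1), c2 _ (hpow _).1, (hpow _).2, el, er, ea]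
    have hσn : conn σ α r (σ n) := Setoid.trans' _ hn (conn_apply_left _ _ n)
    have d1 : ∀ x, conn σ α r x → e (σ x) = σ' (e x) := by
      intro x hx
      have e1 : σ x = swap n (σ n) (swap l r (swap l a (σ₀ x))) :=
        congrArg (fun τ : Perm H => τ x) CutData.mul_eq_cut
      have e2 : σ' (e x) = swap n' (σ' n') (swap l' r' (swap l' a' (τ₀ (e x)))) :=
        congrArg (fun τ : Perm H' => τ (e x)) CutData.mul_eq_cut
      rw [e1, e2, sw hn hσn (ms hl hrr (ms hl ha (m1 _ hx))), sw hl hrr (ms hl ha (m1 _ hx)),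
        sw hl ha (m1 _ hx), c1 _ hx, en, eσn, el, er, ea]
    have d2 : ∀ x, conn σ α r x → e (α x) = α' (e x) := by
      intro x hx
      have e1 : α x = α₀ (swap n a x) := by simp [hα₀]
      have e2 : α' (e x) = β₀ (swap n' a' (e x)) := by simp [hβ₀]
      rw [e1, e2, c2 _ (ms hn ha hx), sw hn ha hx, en, ea]
    refine ⟨e, er, hinj, fun x hx => ?_, d1, d2⟩
    refine D'.conn_iff.2 ?_
    rcases D.conn_iff.1 hx with hx | hx | rfl
    · rw [eB x hx]
      exact Or.inl (f3 x hx)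
    · rw [eA x hx]
      exact Or.inr (Or.inl (g3 x hx))
    · exact Or.inr (Or.inr en)

end HasCode

/-- Every valid code describes a map: the maps of the two subtrees are put side by side, together
with a new half-edge `none`, and are glued. -/
lemma exists_map_of_valid {c : Code} (hc : c.Valid) :
    ∃ (H : Type) (_ : Finite H) (_ : DecidableEq H) (σ α : Perm H) (r : H),
      PlanarBridgeless σ α ∧ RootAt σ α r ∧ (∀ x, conn σ α r x) ∧ HasCode σ α r c := by
  induction c with
  | leaf =>
    refine ⟨Unit, inferInstance, inferInstance, 1, 1, (), ⟨fun _ => rfl, genus_one_left _, ?_⟩,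
      ⟨rfl, fun _ _ _ => rfl⟩, fun _ => Setoid.refl' _ _, HasCode.leaf rfl⟩
    exact fun h hne => absurd rfl hne
  | node B A p ihB ihA =>
    obtain ⟨vB, vA, hp, hpB⟩ := hc
    obtain ⟨X, _, _, σ, α, r, h1, h2, h3, h4⟩ := ihB vB
    obtain ⟨Y, _, _, τ, β, a, k1, k2, k3, k4⟩ := ihA vA
    have good := h1.optionSum k1
    have rr := h2.optionSum_inl τ β
    have ra := k2.optionSum_inr σ α
    have hB : HasCode (optionSum σ τ) (optionSum α β) (some (Sum.inl r)) B :=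
      h4.map (e := fun x => some (Sum.inl x)) (fun x y h => by simpa using h) (fun _ => rfl)
        (fun _ => rfl) good rr
    have hA : HasCode (optionSum σ τ) (optionSum α β) (some (Sum.inr a)) A :=
      k4.map (e := fun x => some (Sum.inr x)) (fun x y h => by simpa using h) (fun _ => rfl)
        (fun _ => rfl) good ra
    have D : GlueData (optionSum σ τ) (optionSum α β) (some (Sum.inl r)) none
        (some (Sum.inr a)) p :=
      { good := good
        root_r := rr
        root_a := ra
        sep := by
          rw [conn_optionSum]
          exact fun h => h
        vertex_n := rfl
        edge_n := rfl
        ne_nr := by simp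
        ne_na := by simp
        pos := hp
        le := by rwa [← (hB.spec rr).2.1] }
    refine ⟨Option (X ⊕ Y), inferInstance, inferInstance, _, _, some (Sum.inl r),
      D.planarBridgeless, D.rootAt, fun x => ?_, HasCode.node D.cutData ?_ ?_⟩
    · refine D.cutData.conn_iff.2 ?_
      rw [D.cutVertex_glue, GlueData.cutEdge_glue, conn_optionSum]
      rcases x with _ | x | x
      · exact Or.inr (Or.inr rfl)
      · exact Or.inl (h3 x)
      · exact Or.inr (Or.inl (k3 x))
    · rwa [D.cutVertex_glue, GlueData.cutEdge_glue]
    · rwa [D.cutVertex_glue, GlueData.cutEdge_glue]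

end PermPair

/-! ### The root vertex in the depth-first search -/

namespace PermPair

open Equiv Equiv.Perm

variable {H : Type*}

/-- The components that are left when the vertex of `r` is split into single half-edges. -/
def splitRoot (σ α : Perm H) (r : H) : Setoid H :=
  Relation.EqvGen.setoid fun a b => b = α a ∨ (¬ σ.SameCycle r a ∧ b = σ a)

lemma splitRoot_edge (σ α : Perm H) (r a : H) : splitRoot σ α r a (α a) :=
  Relation.EqvGen.rel _ _ (Or.inl rfl)

lemma splitRoot_vertex {σ : Perm H} (α : Perm H) {r a : H} (h : ¬ σ.SameCycle r a) :
    splitRoot σ α r a (σ a) :=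
  Relation.EqvGen.rel _ _ (Or.inr ⟨h, rfl⟩)

lemma rel_of_splitRoot {s : Setoid H} {σ α : Perm H} {r : H} (h1 : ∀ a, s a (α a))
    (h2 : ∀ a, ¬ σ.SameCycle r a → s a (σ a)) {a b : H} (h : splitRoot σ α r a b) : s a b := by
  induction h with
  | rel a b h =>
    rcases h with rfl | ⟨h, rfl⟩
    · exact h1 a
    · exact h2 a h
  | refl a => exact Setoid.refl' _ a
  | symm a b _ ih => exact Setoid.symm' _ ih
  | trans a b c _ _ ih1 ih2 => exact Setoid.trans' _ ih1 ih2

variable [Finite H]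

lemma splitRoot_of_sameCycle {σ : Perm H} (α : Perm H) {r a b : H} (h : ¬ σ.SameCycle r a)
    (hab : σ.SameCycle a b) : splitRoot σ α r a b := by
  obtain ⟨k, -, rfl⟩ := hab.exists_pow_eq'
  induction k with
  | zero => exact Setoid.refl' _ _
  | succ k ih =>
    rw [pow_succ', mul_apply]
    refine Setoid.trans' _ (ih (sameCycle_pow_self _ _ _)) (splitRoot_vertex α fun k => h ?_)
    exact k.trans (sameCycle_pow_self _ _ _).symm

variable [DecidableEq H]

/-- The half-edge `σ r` may be taken out of the root vertex before this vertex is split. -/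
lemma splitRoot_remove {σ : Perm H} (α : Perm H) {r : H} (h : σ r ≠ r) :
    splitRoot (swap (σ r) (σ (σ r)) * σ) α r = splitRoot σ α r := by
  have hr : r ≠ σ r := Ne.symm h
  have hfix : (swap (σ r) (σ (σ r)) * σ) (σ r) = σ r := by simp
  have hout : ∀ x, ¬ σ.SameCycle r x → (swap (σ r) (σ (σ r)) * σ) x = σ x := by
    intro x hx
    rw [mul_apply, swap_apply_of_ne_of_ne]
    · exact fun e => hx (σ.injective e ▸ SameCycle.refl _ _)
    · exact fun e => hx (σ.injective e ▸ sameCycle_apply_self σ r)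
  ext x y
  constructor
  · refine fun k => rel_of_splitRoot (fun a => splitRoot_edge σ α r a) (fun a ha => ?_) k
    by_cases h1 : a = σ r
    · rw [h1, hfix]
    · have ha' : ¬ σ.SameCycle r a := fun k => ha ((sameCycle_swap_apply_mul_iff hr h1).2 k)
      rw [hout a ha']
      exact splitRoot_vertex α ha'
  · refine fun k => rel_of_splitRoot (fun a => splitRoot_edge _ α r a) (fun a ha => ?_) k
    have h1 : a ≠ σ r := fun e => ha (e ▸ sameCycle_apply_self σ r)
    rw [← hout a ha]
    exact splitRoot_vertex α fun k => ha ((sameCycle_swap_apply_mul_iff hr h1).1 k)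

/-- In a planar map, splitting the root vertex increases the number of components as much as the
vertex has more half-edges than incident faces. By induction, the half-edge `σ r` is taken out of
the root vertex. Either its two corners belong to the same face, and a component splits off, or two
faces merge. -/
lemma numClasses_splitRoot {σ α : Perm H} {r : H} (h0 : genus σ α = 0) :
    (splitRoot σ α r).numClasses + vertexFaces σ α r =
      (conn σ α).numClasses + {x | σ.SameCycle r x}.ncard := by
  obtain ⟨d, hd⟩ : ∃ d, {x | σ.SameCycle r x}.ncard = d := ⟨_, rfl⟩
  induction d generalizing σ with
  | zero =>
    rw [Set.ncard_eq_zero] at hd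
    exact absurd (show r ∈ {x | σ.SameCycle r x} from SameCycle.refl _ _) (hd ▸ Set.notMem_empty r)
  | succ d ih =>
    by_cases hr : σ r = r
    · have hV : {x | σ.SameCycle r x} = {r} := by
        ext x
        exact ⟨fun k => (SameCycle.eq_of_left k hr).symm, fun k => k ▸ SameCycle.refl _ _⟩
      have hs : splitRoot σ α r = conn σ α := by
        ext x y
        constructor
        · exact fun k => rel_of_splitRoot (conn_apply_right σ α)
            (fun a _ => conn_apply_left σ α a) k
        · refine fun k => rel_of_conn (fun a => ?_) (splitRoot_edge σ α r) k
          by_cases ha : σ.SameCycle r a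
          · rw [← ha.eq_of_left hr, hr]
          · exact splitRoot_vertex α ha
      rw [hs, vertexFaces, hV, Setoid.classesMeeting, Set.image_singleton, Set.ncard_singleton,
        Set.ncard_singleton]
    set y := σ r with hy
    set σ' := swap y (σ y) * σ with hσ'
    have hry : r ≠ y := Ne.symm hr
    have hyy : y ≠ σ y := fun e => hr (σ.injective (hy ▸ e)).symm
    have hys : σ.SameCycle y (σ y) := sameCycle_apply_self σ y
    have hV : ∀ x, x ≠ y → (σ'.SameCycle r x ↔ σ.SameCycle r x) := fun x hx =>
      sameCycle_swap_apply_mul_iff hry hx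
    have hfix : σ' y = y := by simp [hσ']
    have hVset : {x | σ.SameCycle r x} = insert y {x | σ'.SameCycle r x} := by
      ext x
      by_cases hx : x = y
      · simp only [hx, Set.mem_insert_iff, true_or, iff_true]
        exact sameCycle_apply_self σ r
      · simp only [Set.mem_insert_iff, hx, false_or]
        exact (hV x hx).symm
    have hynot : y ∉ {x | σ'.SameCycle r x} := fun k => hry (SameCycle.eq_of_right k hfix)
    have hcard : {x | σ'.SameCycle r x}.ncard = d := by
      rw [hVset, Set.ncard_insert_of_notMem hynot] at hd
      omega
    have h0' : genus σ' α = 0 := genus_swap_mul_eq_zero hyy hys h0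
    have key := ih h0' hcard
    have hsplit : splitRoot σ' α r = splitRoot σ α r := splitRoot_remove α hr
    rw [hsplit, hcard] at key
    rw [hd]
    have hcyc : σ'.cycles.numClasses = σ.cycles.numClasses + 1 :=
      numClasses_swap_mul_of_sameCycle hyy hys
    have hg := h0
    have hg' := h0'
    unfold genus at hg hg'
    have hmul : σ' * α = swap y (σ y) * (σ * α) := mul_assoc _ _ _
    have hσyV : σ y ∈ {x | σ'.SameCycle r x} := by
      refine (hV _ (Ne.symm hyy)).2 ?_
      exact (sameCycle_apply_self σ r).trans hys
    -- If `y` and `σ y` share a face, that face splits, and its new part is in the component that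
    -- the root vertex loses; otherwise the two faces merge.
    by_cases hf : (σ * α).SameCycle y (σ y)
    · have hfc := numClasses_swap_mul_of_sameCycle hyy hf
      rw [← hmul] at hfc
      have hn : ¬ conn σ' α y (σ y) := not_conn_swap_mul hyy hys hf h0
      have hnf : ∀ x ∈ {x | σ'.SameCycle r x}, ¬ (σ' * α).SameCycle x y := by
        intro x hx k
        apply hn
        exact Setoid.trans' _ (Setoid.symm' _ (conn_of_sameCycle_mul k))
          (conn_of_sameCycle (SameCycle.trans (SameCycle.symm hx) hσyV))
      have e1 : vertexFaces σ α r = vertexFaces σ' α r := by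
        unfold vertexFaces
        rw [Setoid.classesMeeting_eq_of_subset (W := {x | σ'.SameCycle r x})
          (hVset ▸ Set.subset_insert _ _)]
        · refine Setoid.classesMeeting_congr fun a ha b hb => ?_
          rw [cycles_eq_of_sameCycle hyy hf, ← hmul]
          constructor
          · rintro (k | ⟨k, k'⟩)
            · exact k
            · exact SameCycle.trans (k.resolve_left (hnf a ha)) (k'.resolve_left (hnf b hb)).symm
          · exact Or.inl
        · intro v hv
          rw [hVset] at hv
          rcases hv with rfl | hv
          · exact ⟨_, hσyV, hf⟩
          · exact ⟨v, hv, Setoid.refl' _ v⟩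
      omega
    · have hfc := numClasses_swap_mul_of_not hf
      rw [← hmul] at hfc
      have e1 : vertexFaces σ' α r + 1 = vertexFaces σ α r := by
        unfold vertexFaces
        rw [← Setoid.classesMeeting_mergeClasses (s := (σ * α).cycles) hf
          (V := {x | σ.SameCycle r x}) (sameCycle_apply_self σ r)
          ((sameCycle_apply_self σ r).trans hys), ← cycles_swap_mul hf, ← hmul]
        congr 1
        refine (Setoid.classesMeeting_eq_of_subset (hVset ▸ Set.subset_insert _ _) ?_).symm
        intro v hv
        rw [hVset] at hv
        rcases hv with rfl | hv
        · refine ⟨_, hσyV, ?_⟩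
          rw [hmul]
          exact sameCycle_swap_mul_self hf
        · exact ⟨v, hv, Setoid.refl' _ v⟩
      omega

end PermPair

namespace RootedMap

open Equiv Equiv.Perm PermPair

variable (M : RootedMap)

instance : Finite M.HalfEdge := M.finite_halfEdge

lemma α_root : M.α M.root = M.root := (M.α_eq_self_iff _).2 rfl

lemma conn_total (x y : M.HalfEdge) : conn M.σ M.α x y := by
  obtain ⟨⟨g, hg⟩, rfl⟩ := M.transitive.exists_smul_eq x y
  change conn M.σ M.α x (g x)
  induction hg using Subgroup.closure_induction generalizing x with
  | mem g hg =>
    rcases hg with rfl | rfl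
    · exact conn_apply_left _ _ x
    · exact conn_apply_right _ _ x
  | one => exact Setoid.refl' _ x
  | mul g h _ _ ihg ihh => exact Setoid.trans' _ (ihh x) (ihg (h x))
  | inv g _ ih =>
    have := ih (g⁻¹ x)
    rw [← mul_apply, mul_inv_cancel, one_apply] at this
    exact Setoid.symm' _ this

lemma numClasses_conn : (conn M.σ M.α).numClasses = 1 := by
  rw [Setoid.numClasses, Nat.card_eq_one_iff_unique]
  refine ⟨⟨fun a b => ?_⟩, ⟨Quotient.mk _ M.root⟩⟩
  induction a using Quotient.ind
  induction b using Quotient.ind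
  exact Quotient.sound (M.conn_total _ _)

lemma edge_sameCycle_iff {x y : M.HalfEdge} : M.α.SameCycle x y ↔ y = x ∨ y = M.α x := by
  constructor
  · intro h
    obtain ⟨k, -, rfl⟩ := h.exists_pow_eq'
    induction k with
    | zero => exact Or.inl rfl
    | succ k ih =>
      rw [pow_succ', mul_apply]
      rcases ih (sameCycle_pow_self _ _ _) with e | e
      · exact Or.inr (by rw [e])
      · exact Or.inl (by rw [e, M.α_α])
  · rintro (rfl | rfl)
    · exact SameCycle.refl _ _
    · exact sameCycle_apply_self _ _

/-- All edges but the root have two half-edges. -/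
lemma card_halfEdge : Nat.card M.HalfEdge + 1 = 2 * M.numEdges := by
  classical
  have := Fintype.ofFinite M.HalfEdge
  have := Fintype.ofFinite (Quotient M.α.cycles)
  have h : Nat.card M.HalfEdge = ∑ q : Quotient M.α.cycles,
      (Finset.univ.filter fun x => Quotient.mk M.α.cycles x = q).card := by
    rw [Nat.card_eq_fintype_card, ← Finset.card_univ]
    exact Finset.card_eq_sum_card_fiberwise fun x _ => Finset.mem_univ _
  have hf : ∀ q : Quotient M.α.cycles,
      (Finset.univ.filter fun x => Quotient.mk M.α.cycles x = q).card +
        (if q = Quotient.mk M.α.cycles M.root then 1 else 0) = 2 := by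
    intro q
    induction q using Quotient.ind with
    | _ x =>
    have hset : (Finset.univ.filter fun y => Quotient.mk M.α.cycles y =
        Quotient.mk M.α.cycles x) = {x, M.α x} := by
      ext y
      simp only [Finset.mem_filter, Finset.mem_univ, true_and, Finset.mem_insert,
        Finset.mem_singleton]
      rw [Quotient.eq (r := M.α.cycles)]
      exact (sameCycle_comm.trans M.edge_sameCycle_iff)
    rw [hset]
    by_cases hx : x = M.root
    · rw [hx, M.α_root, if_pos rfl, Finset.pair_eq_singleton, Finset.card_singleton]
    · rw [Finset.card_pair fun e => hx ((M.α_eq_self_iff x).1 e.symm), if_neg]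
      rw [Quotient.eq (r := M.α.cycles)]
      intro k
      rcases M.edge_sameCycle_iff.1 (SameCycle.symm k) with e | e
      · exact hx e
      · exact hx (e.trans M.α_root)
  have h2 : ∑ q : Quotient M.α.cycles,
      ((Finset.univ.filter fun x => Quotient.mk M.α.cycles x = q).card +
        (if q = Quotient.mk M.α.cycles M.root then 1 else 0)) = M.numEdges * 2 := by
    rw [Finset.sum_congr rfl fun q _ => hf q, Finset.sum_const, Finset.card_univ,
      ← Nat.card_eq_fintype_card, smul_eq_mul]
    rfl
  rw [Finset.sum_add_distrib, ← h, Finset.sum_ite_eq' Finset.univ, if_pos (Finset.mem_univ _)] at h2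
  omega

lemma planar_iff : M.Planar ↔ genus M.σ M.α = 0 := by
  have h := M.card_halfEdge
  have hc := M.numClasses_conn
  unfold Planar eulerChar genus
  rw [hc]
  change ((Setoid.numClasses M.σ.cycles : ℤ) - ((Setoid.numClasses M.α.cycles : ℤ) - 1) +
    (Setoid.numClasses (M.σ * M.α).cycles : ℤ) = 2) ↔ _
  change _ + 1 = 2 * Setoid.numClasses M.α.cycles at h
  omega

lemma rootAt : RootAt M.σ M.α M.root where
  fixed := M.α_root
  unique h _ hf := (M.α_eq_self_iff h).1 hf

open Classical in
lemma bridgeless_iff_conn : M.Bridgeless ↔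
    ∀ h x y, conn M.σ (M.α * swap h (M.α h)) x y := by
  have hval : ∀ h a, (M.α * swap h (M.α h)) a = if a = h ∨ a = M.α h then a else M.α a := by
    intro h a
    rw [mul_apply]
    by_cases h1 : a = h
    · rw [h1, swap_apply_left, M.α_α, if_pos (Or.inl rfl)]
    by_cases h2 : a = M.α h
    · rw [h2, swap_apply_right, if_pos (Or.inr rfl)]
    rw [swap_apply_of_ne_of_ne h1 h2, if_neg (not_or.2 ⟨h1, h2⟩)]
  refine forall_congr' fun h => forall_congr' fun x => forall_congr' fun y =>
    ⟨fun k => ?_, fun k => ?_⟩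
  · induction k with
    | rel a b hab =>
      rcases hab with rfl | ⟨rfl, h1, h2⟩
      · exact conn_apply_left _ _ a
      · have := conn_apply_right M.σ (M.α * swap h (M.α h)) a
        rwa [hval, if_neg (not_or.2 ⟨h1, h2⟩)] at this
    | refl a => exact Setoid.refl' _ a
    | symm a b _ ih => exact Setoid.symm' _ ih
    | trans a b c _ _ ih1 ih2 => exact Setoid.trans' _ ih1 ih2
  · refine rel_of_conn (s := Relation.EqvGen.setoid _) (fun a => ?_) (fun a => ?_) k
    · exact Relation.EqvGen.rel _ _ (Or.inl rfl)
    · rw [hval]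
      split_ifs with h1
      · exact Relation.EqvGen.refl _
      · exact Relation.EqvGen.rel _ _ (Or.inr ⟨rfl, not_or.1 h1⟩)

lemma planarBridgeless_iff : M.Planar ∧ M.Bridgeless ↔ PlanarBridgeless M.σ M.α := by
  classical
  rw [planar_iff, bridgeless_iff_conn]
  constructor
  · rintro ⟨h0, hb⟩
    refine ⟨M.α_α, h0, fun h hne hs => ?_⟩
    exact not_conn_mul_swap (Ne.symm hne) (sameCycle_apply_self M.α h) hs h0 (hb h _ _)
  · intro P
    refine ⟨P.genus_eq, fun h x y => ?_⟩
    by_cases hne : M.α h = h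
    · rw [hne, swap_self]
      exact M.conn_total x y
    · have hs : (M.σ * (M.α * swap h (M.α h))).SameCycle h (M.α h) := by
        change (M.σ * (M.α * swap h (M.α h))).cycles h (M.α h)
        rw [← mul_assoc, cycles_mul_swap (P.not_sameFace h hne)]
        exact Or.inr ⟨Or.inl (SameCycle.refl _ _), Or.inr (SameCycle.refl _ _)⟩
      refine rel_of_conn (conn_apply_left _ _) (fun a => ?_) (M.conn_total x y)
      have e : M.α a = (M.α * swap h (M.α h)) (swap h (M.α h) a) := by simp
      rw [e]
      exact Setoid.trans' _ (Setoid.rel_swap (conn_of_sameCycle_mul hs) a) (conn_apply_right _ _ _)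

lemma mem_around {h x : M.HalfEdge} : x ∈ M.around h ↔ M.SameVertex h x ∧ x ≠ h := by
  have hpos := period_pos M.σ h
  rw [around, List.mem_iterate]
  change (∃ m < M.σ.period h - 1, _) ↔ _
  constructor
  · rintro ⟨m, hm, rfl⟩
    have e : (M.σ^[m]) (M.σ h) = (M.σ ^ (m + 1)) h := by
      rw [iterate_eq_pow, ← mul_apply, ← pow_succ]
    rw [e]
    refine ⟨sameCycle_pow_self _ _ _, fun k => ?_⟩
    have := pow_apply_inj (π := M.σ) (x := h) (i := m + 1) (j := 0) (by omega) hpos k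
    omega
  · rintro ⟨hs, hne⟩
    obtain ⟨i, hi, rfl⟩ := SameCycle.exists_pow_lt_period hs
    obtain ⟨j, rfl⟩ : ∃ j, i = j + 1 := by
      refine ⟨i - 1, ?_⟩
      rcases Nat.eq_zero_or_pos i with rfl | k
      · exact absurd rfl hne
      · omega
    refine ⟨j, by omega, ?_⟩
    rw [iterate_eq_pow, ← mul_apply, ← pow_succ]

lemma length_around (h : M.HalfEdge) : (M.around h).length + 1 = M.σ.period h := by
  have hpos := period_pos M.σ h
  rw [around, List.length_iterate]
  change M.σ.period h - 1 + 1 = M.σ.period h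
  omega

lemma ncard_vertex (h : M.HalfEdge) : {x | M.SameVertex h x}.ncard = M.σ.period h := by
  classical
  have e : {x | M.SameVertex h x} =
      ((Finset.range (M.σ.period h)).image fun i => (M.σ ^ i) h : Finset M.HalfEdge) := by
    ext x
    simp only [Set.mem_ofPred_eq, Finset.coe_image, Finset.coe_range, Set.mem_image, Set.mem_Iio]
    constructor
    · exact fun k => SameCycle.exists_pow_lt_period k
    · rintro ⟨i, -, rfl⟩
      exact sameCycle_pow_self _ _ _
  rw [e, Set.ncard_coe_finset, Finset.card_image_of_injOn, Finset.card_range]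
  intro i hi j hj hij
  exact pow_apply_inj (by simpa using hi) (by simpa using hj) hij

/-- A half-edge at a vertex that the search has reached. -/
def Visited (S : Set M.HalfEdge) (h : M.HalfEdge) : Prop := ∃ k ∈ S, M.SameVertex (M.α k) h

/-- The invariants of the depth-first search. The half-edges of the stack that belong to the root
vertex are at its bottom; each component that is left when the root vertex is split is entered
through at most one half-edge of the root vertex, and is searched completely before the next
half-edge of the root vertex is examined. -/
structure SearchState (stack : List M.HalfEdge) (S : Set M.HalfEdge) : Prop where
  root_mem : M.root ∈ S
  visited_mem : ∀ h, M.Visited S h → h ∈ S ∨ M.α h ∈ S ∨ h ∈ stack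
  visited_stack : ∀ h ∈ stack, M.Visited S h
  visited_tail : ∀ h ∈ S, M.Visited S h
  eq_root : ∀ h ∈ S, M.α h ∈ S → h = M.root
  eq_of_rel : ∀ x ∈ S, ∀ y ∈ S, M.SameVertex M.root x → M.SameVertex M.root y →
    splitRoot M.σ M.α M.root x y → x = y
  exists_rel : ∀ h ∈ S, ∃ x ∈ S, M.SameVertex M.root x ∧ splitRoot M.σ M.α M.root h x
  split : ∃ T R : List M.HalfEdge, stack = T ++ R ∧ (∀ h ∈ R, M.SameVertex M.root h) ∧
    ∀ h ∈ T, ¬ M.SameVertex M.root h ∧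
      ∃ x ∈ S, M.SameVertex M.root x ∧ splitRoot M.σ M.α M.root h x

variable {M}

lemma Visited.mono {S S' : Set M.HalfEdge} (hS : S ⊆ S') {h : M.HalfEdge} (hv : M.Visited S h) :
    M.Visited S' h := by
  obtain ⟨k, hk, hs⟩ := hv
  exact ⟨k, hS hk, hs⟩

lemma Visited.of_sameVertex {S : Set M.HalfEdge} {h k : M.HalfEdge} (hv : M.Visited S h)
    (hs : M.SameVertex h k) : M.Visited S k := by
  obtain ⟨x, hx, hxs⟩ := hv
  exact ⟨x, hx, SameCycle.trans hxs hs⟩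

namespace SearchState

variable {stack : List M.HalfEdge} {S : Set M.HalfEdge}

lemma visited_root (D : M.SearchState stack S) {h : M.HalfEdge} (hs : M.SameVertex M.root h) :
    M.Visited S h := ⟨M.root, D.root_mem, by rwa [M.α_root]⟩

lemma init : M.SearchState (M.around M.root) {M.root} where
  root_mem := rfl
  visited_mem h hv := by
    obtain ⟨k, rfl, hs⟩ := hv
    rw [M.α_root] at hs
    by_cases e : h = M.root
    · exact Or.inl e
    · exact Or.inr (Or.inr (M.mem_around.2 ⟨hs, e⟩))
  visited_stack h hh := ⟨M.root, rfl, by rw [M.α_root]; exact (M.mem_around.1 hh).1⟩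
  visited_tail h hh := ⟨M.root, rfl, by rw [M.α_root, hh]; exact SameCycle.refl _ _⟩
  eq_root h hh _ := hh
  eq_of_rel x hx y hy _ _ _ := Eq.trans hx (Eq.symm hy)
  exists_rel h hh := ⟨M.root, rfl, SameCycle.refl _ _, hh ▸ Setoid.refl' _ _⟩
  split := ⟨[], _, rfl, fun h hh => (M.mem_around.1 hh).1, fun h hh => by cases hh⟩

lemma pop {h : M.HalfEdge} (D : M.SearchState (h :: stack) S) (hh : h ∈ S ∨ M.α h ∈ S) :
    M.SearchState stack S where
  root_mem := D.root_mem
  visited_mem x hx := by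
    rcases D.visited_mem x hx with k | k | k
    · exact Or.inl k
    · exact Or.inr (Or.inl k)
    · rcases List.mem_cons.1 k with rfl | k
      · exact hh.imp_right Or.inl
      · exact Or.inr (Or.inr k)
  visited_stack x hx := D.visited_stack x (List.mem_cons_of_mem _ hx)
  visited_tail := D.visited_tail
  eq_root := D.eq_root
  eq_of_rel := D.eq_of_rel
  exists_rel := D.exists_rel
  split := by
    obtain ⟨T, R, e, hR, hT⟩ := D.split
    rcases T with _ | ⟨t, T⟩
    · rw [List.nil_append] at e
      exact ⟨[], stack, rfl, fun x hx => hR x (e ▸ List.mem_cons_of_mem _ hx),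
        fun x hx => by cases hx⟩
    · rw [List.cons_append, List.cons.injEq] at e
      exact ⟨T, R, e.2, hR, fun x hx => hT x (List.mem_cons_of_mem _ hx)⟩

/-- When the search is back at the root vertex, the components entered so far have been searched
completely. -/
lemma mem_of_splitRoot (D : M.SearchState stack S)
    (hst : ∀ h ∈ stack, M.SameVertex M.root h) {x y : M.HalfEdge} (hx : x ∈ S ∨ M.α x ∈ S)
    (hxy : splitRoot M.σ M.α M.root x y) : y ∈ S ∨ M.α y ∈ S := by
  have key : (x ∈ S ∨ M.α x ∈ S) = (y ∈ S ∨ M.α y ∈ S) := by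
    refine rel_of_splitRoot (s := Setoid.ker fun x => x ∈ S ∨ M.α x ∈ S) (fun a => ?_)
      (fun a ha => ?_) hxy
    · change (a ∈ S ∨ M.α a ∈ S) = (M.α a ∈ S ∨ M.α (M.α a) ∈ S)
      rw [M.α_α, or_comm]
    · have hvis : ∀ z, z ∈ S ∨ M.α z ∈ S → M.Visited S z := by
        rintro z (hz | hz)
        · exact D.visited_tail z hz
        · exact ⟨_, hz, by rw [M.α_α]; exact SameCycle.refl _ _⟩
      have hs : M.SameVertex a (M.σ a) := sameCycle_apply_self _ _
      have step : ∀ z w, ¬ M.SameVertex M.root w → M.SameVertex z w → z ∈ S ∨ M.α z ∈ S →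
          w ∈ S ∨ M.α w ∈ S := by
        intro z w hw hzw hz
        rcases D.visited_mem w ((hvis z hz).of_sameVertex hzw) with k | k | k
        · exact Or.inl k
        · exact Or.inr k
        · exact absurd (hst w k) hw
      refine propext ⟨step a (M.σ a) (fun k => ha (SameCycle.trans k (SameCycle.symm hs))) hs,
        step (M.σ a) a ha (SameCycle.symm hs)⟩
  exact key.mp hx

/-- Traversing a new edge. -/
lemma traverse {h : M.HalfEdge} (D : M.SearchState (h :: stack) S) (h1 : h ∉ S)
    (h2 : M.α h ∉ S) {new : List M.HalfEdge}
    (hnew : (M.Visited S (M.α h) ∧ new = []) ∨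
      (¬ M.Visited S (M.α h) ∧ new = M.around (M.α h))) :
    M.SearchState (new ++ stack) (insert h S) := by
  have hsub : S ⊆ insert h S := Set.subset_insert _ _
  have hvh : M.Visited S h := D.visited_stack h List.mem_cons_self
  have hvα : M.Visited (insert h S) (M.α h) := ⟨h, Set.mem_insert _ _, SameCycle.refl _ _⟩
  have hmemnew : ∀ x ∈ new, M.SameVertex (M.α h) x ∧ ¬ M.SameVertex M.root x := by
    intro x hx
    rcases hnew with ⟨-, rfl⟩ | ⟨hn, rfl⟩
    · cases hx
    · have hs := (M.mem_around.1 hx).1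
      exact ⟨hs, fun k => hn (D.visited_root (SameCycle.trans k (SameCycle.symm hs)))⟩
  have hrel : ∀ x ∈ new, splitRoot M.σ M.α M.root x h := by
    intro x hx
    obtain ⟨hs, hr⟩ := hmemnew x hx
    exact Setoid.trans' _ (splitRoot_of_sameCycle M.α hr (SameCycle.symm hs))
      (Setoid.symm' _ (splitRoot_edge _ _ _ h))
  obtain ⟨T, R, e, hR, hT⟩ := D.split
  -- Either the search is back at the root vertex, or `h` belongs to a component already entered.
  have hcase : (M.SameVertex M.root h ∧ ∀ x ∈ stack, M.SameVertex M.root x) ∨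
      (¬ M.SameVertex M.root h ∧
        (∃ x ∈ S, M.SameVertex M.root x ∧ splitRoot M.σ M.α M.root h x) ∧
        ∃ T R : List M.HalfEdge, stack = T ++ R ∧ (∀ h ∈ R, M.SameVertex M.root h) ∧
          ∀ h ∈ T, ¬ M.SameVertex M.root h ∧
            ∃ x ∈ S, M.SameVertex M.root x ∧ splitRoot M.σ M.α M.root h x) := by
    rcases T with _ | ⟨t, T⟩
    · rw [List.nil_append] at e
      exact Or.inl ⟨hR h (e ▸ List.mem_cons_self),
        fun x hx => hR x (e ▸ List.mem_cons_of_mem _ hx)⟩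
    · rw [List.cons_append, List.cons.injEq] at e
      obtain ⟨rfl, e⟩ := e
      obtain ⟨k1, k2⟩ := hT h List.mem_cons_self
      exact Or.inr ⟨k1, k2, T, R, e, hR, fun x hx => hT x (List.mem_cons_of_mem _ hx)⟩
  -- An edge that leaves the root vertex enters a new component.
  have hfresh : M.SameVertex M.root h → ∀ x ∈ S, ¬ splitRoot M.σ M.α M.root x h := by
    intro hr x hx k
    rcases hcase with ⟨-, hst⟩ | ⟨hn, -⟩
    · have := D.mem_of_splitRoot (fun y hy => ?_) (Or.inl hx) k
      · exact this.elim h1 h2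
      · rcases List.mem_cons.1 hy with rfl | hy
        · exact hr
        · exact hst y hy
    · exact hn hr
  have hex : ∃ x ∈ insert h S, M.SameVertex M.root x ∧ splitRoot M.σ M.α M.root h x := by
    rcases hcase with ⟨hr, -⟩ | ⟨-, ⟨x, hx, k⟩, -⟩
    · exact ⟨h, Set.mem_insert _ _, hr, Setoid.refl' _ h⟩
    · exact ⟨x, hsub hx, k⟩
  exact
    { root_mem := hsub D.root_mem
      visited_mem := by
        rintro x ⟨k, hk, hs⟩
        by_cases hx : M.Visited S x
        · rcases D.visited_mem x hx with k | k | k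
          · exact Or.inl (hsub k)
          · exact Or.inr (Or.inl (hsub k))
          · rcases List.mem_cons.1 k with rfl | k
            · exact Or.inl (Set.mem_insert _ _)
            · exact Or.inr (Or.inr (List.mem_append_right _ k))
        · rcases hk with rfl | hk
          · rcases hnew with ⟨hv, -⟩ | ⟨hn, rfl⟩
            · exact absurd (hv.of_sameVertex hs) hx
            · by_cases ex : x = M.α k
              · refine Or.inr (Or.inl ?_)
                rw [ex, M.α_α]
                exact Set.mem_insert _ _
              · exact Or.inr (Or.inr (List.mem_append_left _ (M.mem_around.2 ⟨hs, ex⟩)))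
          · exact absurd ⟨k, hk, hs⟩ hx
      visited_stack := by
        intro x hx
        rcases List.mem_append.1 hx with hx | hx
        · exact hvα.of_sameVertex (hmemnew x hx).1
        · exact (D.visited_stack x (List.mem_cons_of_mem _ hx)).mono hsub
      visited_tail := by
        rintro x (rfl | hx)
        · exact hvh.mono hsub
        · exact (D.visited_tail x hx).mono hsub
      eq_root := by
        rintro x (rfl | hx) (hαx | hαx)
        · exact (M.α_eq_self_iff x).1 hαx
        · exact absurd hαx h2
        · rw [← hαx, M.α_α] at h2
          exact absurd hx h2
        · exact D.eq_root x hx hαx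
      eq_of_rel := by
        rintro x (rfl | hx) y (rfl | hy) hrx hry k
        · rfl
        · exact absurd (Setoid.symm' _ k) (hfresh hrx y hy)
        · exact absurd k (hfresh hry x hx)
        · exact D.eq_of_rel x hx y hy hrx hry k
      exists_rel := by
        rintro x (rfl | hx)
        · exact hex
        · obtain ⟨y, hy, k⟩ := D.exists_rel x hx
          exact ⟨y, hsub hy, k⟩
      split := by
        have hnew' : ∀ x ∈ new, ¬ M.SameVertex M.root x ∧
            ∃ y ∈ insert h S, M.SameVertex M.root y ∧ splitRoot M.σ M.α M.root x y := by
          intro x hx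
          obtain ⟨y, hy, k1, k2⟩ := hex
          exact ⟨(hmemnew x hx).2, y, hy, k1, Setoid.trans' _ (hrel x hx) k2⟩
        rcases hcase with ⟨-, hst⟩ | ⟨-, -, T, R, e, hR, hT⟩
        · exact ⟨new, stack, rfl, hst, hnew'⟩
        · refine ⟨new ++ T, R, by rw [e, List.append_assoc], hR, fun x hx => ?_⟩
          rcases List.mem_append.1 hx with hx | hx
          · exact hnew' x hx
          · obtain ⟨k, y, hy, k'⟩ := hT x hx
            exact ⟨k, y, hsub hy, k'⟩ }

lemma ncard_unvisited {h : M.HalfEdge} (hn : ¬ M.Visited S (M.α h)) :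
    {x | ¬ M.Visited (insert h S) x}.ncard + M.σ.period (M.α h) ≤
      {x | ¬ M.Visited S x}.ncard := by
  rw [← M.ncard_vertex, ← Set.ncard_union_eq]
  · refine Set.ncard_le_ncard ?_
    rintro x (hx | hx)
    · exact fun k => hx (k.mono (Set.subset_insert _ _))
    · exact fun k => hn (k.of_sameVertex (SameCycle.symm hx))
  · rw [Set.disjoint_left]
    exact fun x hx hx' => hx ⟨h, Set.mem_insert _ _, hx'⟩

/-- Every step of the search preserves the invariants, and makes progress, measured by the length of
the stack plus the number of half-edges at vertices not yet visited. The subtraction is truncated: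
once the measure is zero, the search has ended. -/
lemma step (D : M.SearchState stack S) :
    M.SearchState (M.dfsStep (stack, S)).1 (M.dfsStep (stack, S)).2 ∧
      (M.dfsStep (stack, S)).1.length + {x | ¬ M.Visited (M.dfsStep (stack, S)).2 x}.ncard ≤
        stack.length + {x | ¬ M.Visited S x}.ncard - 1 := by
  classical
  rcases stack with _ | ⟨h, stack⟩
  · refine ⟨D, ?_⟩
    -- The map is connected, so that all vertices are visited when the stack is empty.
    have hz : {x | ¬ M.Visited S x} = ∅ := by
      ext x
      simp only [Set.mem_ofPred_eq, Set.mem_empty_iff_false, iff_false, not_not]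
      have key : M.Visited S M.root = M.Visited S x := by
        have hα : ∀ a, M.Visited S a → M.Visited S (M.α a) := by
          intro a ha
          rcases D.visited_mem a ha with k | k | k
          · exact ⟨a, k, SameCycle.refl _ _⟩
          · exact D.visited_tail _ k
          · cases k
        refine rel_of_conn (s := Setoid.ker (M.Visited S)) (fun a => ?_) (fun a => ?_)
          (M.conn_total M.root x)
        · have hs : M.SameVertex a (M.σ a) := sameCycle_apply_self _ _
          exact propext ⟨fun k => k.of_sameVertex hs, fun k => k.of_sameVertex (SameCycle.symm hs)⟩
        · refine propext ⟨hα a, fun k => ?_⟩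
          have := hα _ k
          rwa [M.α_α] at this
      exact key.mp (D.visited_root (SameCycle.refl _ _))
    change 0 + {x | ¬ M.Visited S x}.ncard ≤ _
    rw [hz, Set.ncard_empty]
    omega
  · by_cases h1 : h ∈ S ∨ M.α h ∈ S
    · have e : M.dfsStep (h :: stack, S) = (stack, S) := by rw [dfsStep, if_pos h1]
      rw [e]
      refine ⟨D.pop h1, ?_⟩
      rw [List.length_cons]
      change stack.length + {x | ¬ M.Visited S x}.ncard ≤ _
      omega
    · obtain ⟨h2, h3⟩ := not_or.1 h1
      by_cases h4 : M.Visited S (M.α h)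
      · have e : M.dfsStep (h :: stack, S) = (stack, insert h S) := by
          rw [dfsStep, if_neg h1]
          exact if_pos h4
        rw [e]
        refine ⟨D.traverse h2 h3 (Or.inl ⟨h4, rfl⟩), ?_⟩
        have : {x | ¬ M.Visited (insert h S) x}.ncard ≤ {x | ¬ M.Visited S x}.ncard :=
          Set.ncard_le_ncard fun x hx k => hx (k.mono (Set.subset_insert _ _))
        rw [List.length_cons]
        change stack.length + {x | ¬ M.Visited (insert h S) x}.ncard ≤ _
        omega
      · have e : M.dfsStep (h :: stack, S) = (M.around (M.α h) ++ stack, insert h S) := by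
          rw [dfsStep, if_neg h1]
          exact if_neg h4
        rw [e]
        refine ⟨D.traverse h2 h3 (Or.inr ⟨h4, rfl⟩), ?_⟩
        have k1 := ncard_unvisited h4
        have k2 := M.length_around (M.α h)
        rw [List.length_cons, List.length_append]
        change _ + _ + {x | ¬ M.Visited (insert h S) x}.ncard ≤ _
        omega

end SearchState

variable (M)

/-- The search ends with every edge oriented. -/
lemma searchState_dfsOrientation : M.SearchState [] M.dfsOrientation := by
  have key : ∀ k : ℕ, M.SearchState (M.dfsStep^[k] (M.around M.root, {M.root})).1
      (M.dfsStep^[k] (M.around M.root, {M.root})).2 ∧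
      (M.dfsStep^[k] (M.around M.root, {M.root})).1.length +
        {x | ¬ M.Visited (M.dfsStep^[k] (M.around M.root, {M.root})).2 x}.ncard ≤
          (M.around M.root).length + {x | ¬ M.Visited {M.root} x}.ncard - k := by
    intro k
    induction k with
    | zero => exact ⟨SearchState.init, le_rfl⟩
    | succ k ih =>
      rw [Function.iterate_succ_apply']
      have := ih.1.step
      refine ⟨this.1, this.2.trans ?_⟩
      omega
  obtain ⟨h1, h2⟩ := key (Nat.card M.HalfEdge)
  have h3 : (M.around M.root).length + {x | ¬ M.Visited {M.root} x}.ncard ≤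
      Nat.card M.HalfEdge := by
    have k1 := M.length_around M.root
    have k2 : {x | ¬ M.Visited {M.root} x}.ncard + {x | M.SameVertex M.root x}.ncard ≤
        Nat.card M.HalfEdge := by
      rw [← Set.ncard_union_eq]
      · exact Set.ncard_le_card _
      · rw [Set.disjoint_left]
        exact fun x hx hx' => hx ⟨M.root, rfl, by rwa [M.α_root]⟩
    rw [M.ncard_vertex] at k2
    omega
  have h4 : (M.dfsStep^[Nat.card M.HalfEdge] (M.around M.root, {M.root})).1 = [] :=
    List.eq_nil_of_length_eq_zero (by omega)
  rwa [h4] at h1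

/-- The indegree of the root vertex in terms of the components that are left when this vertex is
split. -/
lemma rootIndegree_add : M.rootIndegree + (splitRoot M.σ M.α M.root).numClasses =
    {x | M.SameVertex M.root x}.ncard + 1 := by
  have D := M.searchState_dfsOrientation
  set S := M.dfsOrientation with hS
  have hvis : ∀ x, x ∈ S ∨ M.α x ∈ S := by
    -- If a vertex were not visited, a further step would make progress, although the stack is
    -- empty.
    have hz : ∀ x, M.Visited S x := by
      by_contra! hex
      have h := D.step.2
      rw [show M.dfsStep ([], S) = ([], S) from rfl] at h
      obtain ⟨x, hx⟩ := hex
      have : 0 < {x | ¬ M.Visited S x}.ncard := (Set.ncard_pos).2 ⟨x, hx⟩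
      simp only [List.length_nil] at h
      omega
    intro x
    rcases D.visited_mem x (hz x) with k | k | k
    · exact Or.inl k
    · exact Or.inr k
    · cases k
  -- The incoming half-edges at the root vertex.
  have e1 : M.rootIndegree = {x | M.SameVertex M.root x ∧ M.α x ∈ S}.ncard := by
    rw [rootIndegree, ← hS, ← Set.ncard_image_of_injective _ M.α.injective]
    congr 1
    ext x
    constructor
    · rintro ⟨y, ⟨hy, hs⟩, rfl⟩
      exact ⟨hs, by rwa [M.α_α]⟩
    · rintro ⟨hs, hx⟩
      exact ⟨M.α x, ⟨hx, by rwa [M.α_α]⟩, M.α_α x⟩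
  -- The outgoing half-edges, and the root, correspond to the components, since each component is
  -- entered exactly once.
  have e2 : (splitRoot M.σ M.α M.root).numClasses =
      {x | M.SameVertex M.root x ∧ x ∈ S}.ncard := by
    rw [← Setoid.classesMeeting_univ,
      Setoid.classesMeeting_eq_of_subset (W := {x | M.SameVertex M.root x ∧ x ∈ S})
        (Set.subset_univ _)]
    · refine Set.InjOn.ncard_image fun x hx y hy hxy => ?_
      exact D.eq_of_rel x hx.2 y hy.2 hx.1 hy.1 (Quotient.exact hxy)
    · intro v _
      rcases hvis v with hv | hv
      · obtain ⟨x, hx, h1, h2⟩ := D.exists_rel v hv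
        exact ⟨x, ⟨h1, hx⟩, h2⟩
      · obtain ⟨x, hx, h1, h2⟩ := D.exists_rel _ hv
        exact ⟨x, ⟨h1, hx⟩, Setoid.trans' _ (splitRoot_edge _ _ _ v) h2⟩
  -- Every half-edge at the root vertex is incoming or outgoing, and only the root counts as both.
  rw [e1, e2, ← Set.ncard_union_add_ncard_inter]
  have u : {x | M.SameVertex M.root x ∧ M.α x ∈ S} ∪ {x | M.SameVertex M.root x ∧ x ∈ S} =
      {x | M.SameVertex M.root x} := by
    ext x
    simp only [Set.mem_union, Set.mem_ofPred_eq, ← and_or_left]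
    exact and_iff_left (hvis x).symm
  have i : {x | M.SameVertex M.root x ∧ M.α x ∈ S} ∩ {x | M.SameVertex M.root x ∧ x ∈ S} =
      {M.root} := by
    ext x
    constructor
    · rintro ⟨⟨-, h1⟩, -, h2⟩
      exact D.eq_root x h2 h1
    · rintro rfl
      exact ⟨⟨SameCycle.refl _ _, by rw [M.α_root]; exact D.root_mem⟩, SameCycle.refl _ _,
        D.root_mem⟩
  rw [u, i, Set.ncard_singleton]

/-- In a planar map, the indegree of the root vertex is the number of faces incident to it. -/
lemma rootIndegree_eq (h : genus M.σ M.α = 0) :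
    M.rootIndegree = vertexFaces M.σ M.α M.root := by
  classical
  have h1 := M.rootIndegree_add
  have h2 := numClasses_splitRoot (r := M.root) h
  rw [M.numClasses_conn] at h2
  change _ = _ + {x | M.SameVertex M.root x}.ncard at h2
  omega

end RootedMap

/-! ### Counting planar bridgeless maps -/

namespace RootedMap

open Equiv Equiv.Perm PermPair

variable (M : RootedMap)

open Classical in
lemma exists_code (h : PlanarBridgeless M.σ M.α) : ∃ c, HasCode M.σ M.α M.root c :=
  exists_hasCode h M.rootAt

/-- The code of a planar bridgeless map. -/
noncomputable def code (h : PlanarBridgeless M.σ M.α) : Code := (M.exists_code h).choose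

open Classical in
lemma hasCode_code (h : PlanarBridgeless M.σ M.α) : HasCode M.σ M.α M.root (M.code h) :=
  (M.exists_code h).choose_spec

lemma conn_eq_univ : {x | conn M.σ M.α M.root x} = Set.univ := by
  ext x
  exact ⟨fun _ => trivial, fun _ => M.conn_total _ _⟩

lemma code_spec (h : PlanarBridgeless M.σ M.α) :
    (M.code h).Valid ∧ (M.code h).size = M.numEdges ∧ (M.code h).spine = M.rootIndegree := by
  classical
  obtain ⟨h1, -, h2, h3⟩ := (M.hasCode_code h).spec M.rootAt
  refine ⟨h1, ?_, h2.trans (M.rootIndegree_eq h.genus_eq).symm⟩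
  rw [conn_eq_univ, Set.ncard_univ, M.card_halfEdge] at h3
  omega

variable {M}

lemma Iso.code_eq {N : RootedMap} (e : Iso M N) (h : PlanarBridgeless M.σ M.α)
    (k : PlanarBridgeless N.σ N.α) : M.code h = N.code k := by
  classical
  obtain ⟨e, e1, e2, e3⟩ := e
  have := (M.hasCode_code h).map e.injective e2 e3 k (by rw [e1]; exact N.rootAt)
  rw [e1] at this
  exact this.unique (N.hasCode_code k)

lemma iso_of_code_eq {N : RootedMap} (h : PlanarBridgeless M.σ M.α)
    (k : PlanarBridgeless N.σ N.α) (hc : M.code h = N.code k) : Iso M N := by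
  classical
  have hM := M.hasCode_code h
  rw [hc] at hM
  have hN := N.hasCode_code k
  obtain ⟨e, e1, e2, -, e3, e4⟩ := hM.exists_iso M.rootAt hN N.rootAt
  have h1 := (hM.spec M.rootAt).2.2.2
  have h2 := (hN.spec N.rootAt).2.2.2
  rw [conn_eq_univ, Set.ncard_univ] at h1 h2
  rw [conn_eq_univ, Set.injOn_univ] at e2
  have hb : Function.Bijective e :=
    (Nat.bijective_iff_injective_and_card e).2 ⟨e2, by omega⟩
  exact ⟨Equiv.ofBijective e hb, e1, fun x => e3 x (M.conn_total _ _),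
    fun x => e4 x (M.conn_total _ _)⟩

lemma exists_code_eq {c : Code} (hc : c.Valid) :
    ∃ (M : RootedMap) (h : PlanarBridgeless M.σ M.α), M.code h = c := by
  obtain ⟨H, _, _, σ, α, r, h1, h2, h3, h4⟩ := exists_map_of_valid hc
  let M : RootedMap :=
    { HalfEdge := H
      finite_halfEdge := inferInstance
      σ := σ
      α := α
      root := r
      α_α := h1.invol
      α_eq_self_iff := fun h => ⟨h2.unique h (h3 h), fun e => e ▸ h2.fixed⟩
      transitive := by
        refine ⟨fun x y => ?_⟩
        have key : ∀ z, conn σ α r z → ∃ g : Subgroup.closure {σ, α}, g • r = z := by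
          intro z hz
          have := rel_of_conn (s := MulAction.orbitRel (Subgroup.closure {σ, α}) H)
            (fun a => Setoid.symm' _ (show MulAction.orbitRel _ _ (σ a) a from
              ⟨⟨σ, Subgroup.subset_closure (by simp)⟩, rfl⟩))
            (fun a => Setoid.symm' _ (show MulAction.orbitRel _ _ (α a) a from
              ⟨⟨α, Subgroup.subset_closure (by simp)⟩, rfl⟩)) hz
          exact Setoid.symm' _ this
        obtain ⟨g, rfl⟩ := key x (h3 x)
        obtain ⟨g', rfl⟩ := key y (h3 y)
        exact ⟨g' * g⁻¹, by rw [mul_smul, inv_smul_smul]⟩ }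
  refine ⟨M, h1, ?_⟩
  have := M.hasCode_code h1
  refine HasCode.unique (σ := σ) (α := α) (r := r) ?_ h4
  convert this

/-- Planar bridgeless maps are in bijection with valid codes. -/
lemma exists_bijective_code (n i : ℕ) :
    ∃ f : PlanarBridgelessMaps n i → {c : Code // c.Valid ∧ c.size = n ∧ c.spine = i},
      Function.Bijective f := by
  have hpb : ∀ M : {M : RootedMap // M.Planar ∧ M.Bridgeless ∧ M.numEdges = n ∧
      M.rootIndegree = i}, PlanarBridgeless M.1.σ M.1.α := fun M =>
    M.1.planarBridgeless_iff.1 ⟨M.2.1, M.2.2.1⟩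
  refine ⟨Quotient.lift (fun M => ⟨M.1.code (hpb M), (M.1.code_spec (hpb M)).1,
    (M.1.code_spec (hpb M)).2.1.trans M.2.2.2.1, (M.1.code_spec (hpb M)).2.2.trans M.2.2.2.2⟩)
    (fun M N e => Subtype.ext (Iso.code_eq e (hpb M) (hpb N))), ?_, ?_⟩
  · intro a b
    induction a using Quotient.ind with
    | _ M =>
    induction b using Quotient.ind with
    | _ N =>
    intro hab
    exact Quotient.sound (iso_of_code_eq (hpb M) (hpb N) (congrArg Subtype.val hab))
  · rintro ⟨c, hc, hn, hi⟩
    obtain ⟨M, h, rfl⟩ := exists_code_eq hc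
    obtain ⟨h1, h2, h3⟩ := M.code_spec h
    have hp := M.planarBridgeless_iff.2 h
    exact ⟨Quotient.mk _ ⟨M, hp.1, hp.2, h2.symm.trans hn, h3.symm.trans hi⟩, rfl⟩

end RootedMap

namespace Code

instance finite_valid (n i : ℕ) : Finite {c : Code // c.Valid ∧ c.size = n ∧ c.spine = i} :=
  Finite.of_injective (β := {c // c ∈ ofSize n})
    (fun c => ⟨c.1, mem_ofSize.2 ⟨c.2.1, c.2.2.1⟩⟩)
    fun _ _ h => Subtype.ext (congrArg (fun x => x.1) h)

lemma card_valid (n i : ℕ) :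
    Nat.card {c : Code // c.Valid ∧ c.size = n ∧ c.spine = i} = count n i := by
  classical
  rw [count]
  refine Nat.subtype_card _ fun c => ?_
  rw [Finset.mem_filter, mem_ofSize, and_assoc]

end Code

namespace RootedMap

lemma finite_planarBridgelessMaps (n i : ℕ) : Finite (PlanarBridgelessMaps n i) := by
  obtain ⟨f, hf⟩ := exists_bijective_code n i
  exact Finite.of_injective f hf.1

lemma card_planarBridgelessMaps (n i : ℕ) :
    Nat.card (PlanarBridgelessMaps n i) = Code.count n i := by
  obtain ⟨f, hf⟩ := exists_bijective_code n i
  rw [Nat.card_eq_of_bijective f hf, Code.card_valid]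

end RootedMap

/-! ### Top cycles in systems of chords -/

namespace ChordDiagram

/-- The set of end points of a set of chords. -/
def endpoints (C : Finset (ℕ × ℕ)) : Set ℕ := {q | ∃ c ∈ C, q = c.1 ∨ q = c.2}

/-- A chord diagram before its end points are relabelled by `1, …, 2n`. -/
structure IsSystem (C : Finset (ℕ × ℕ)) : Prop where
  lt : ∀ c ∈ C, c.1 < c.2
  source_inj : ∀ c ∈ C, ∀ d ∈ C, c.1 = d.1 → c = d
  sink_inj : ∀ c ∈ C, ∀ d ∈ C, c.2 = d.2 → c = d
  source_ne_sink : ∀ c ∈ C, ∀ d ∈ C, c.1 ≠ d.2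

/-- The chords `c` and `d` cross. -/
def Cross (c d : ℕ × ℕ) : Prop := RightNbr c d ∨ RightNbr d c

/-- Connectedness, expressed without paths: no proper part of `C` is isolated. -/
structure Linked (C : Finset (ℕ × ℕ)) : Prop where
  nonempty : C.Nonempty
  eq_of_isolated : ∀ P ⊆ C, P.Nonempty → (∀ c ∈ P, ∀ d ∈ C, d ∉ P → ¬ Cross c d) → P = C

/-- The position immediately after `w` is not covered by a chord of `C` with source greater than
`s`. -/
def Uncovered (C : Finset (ℕ × ℕ)) (s w : ℕ) : Prop := ∀ d ∈ C, s < d.1 → d.1 ≤ w → d.2 ≤ w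

/-- The gap of `C` immediately after `q` is good: a new chord which enters from the left and ends in
this gap does not complete a top cycle. -/
def GoodGap (C : Finset (ℕ × ℕ)) (q : ℕ) : Prop :=
  ∀ e ∈ C, e.1 ≤ q → q < e.2 → ∃ w, q ≤ w ∧ w ≤ e.2 ∧ Uncovered C e.1 w

/-- The absence of top cycles, expressed without paths: if `e` is a right neighbor of `c`, then the
part of `e` to the right of `c` is not covered by chords with source greater than that of `e`. -/
def CycleFree (C : Finset (ℕ × ℕ)) : Prop :=
  ∀ c ∈ C, ∀ e ∈ C, RightNbr c e → ∃ w, c.2 ≤ w ∧ w ≤ e.2 ∧ Uncovered C e.1 w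

variable {C P Q : Finset (ℕ × ℕ)}

lemma Cross.symm {c d : ℕ × ℕ} (h : Cross c d) : Cross d c := Or.symm h

lemma source_mem {c : ℕ × ℕ} (h : c ∈ C) : c.1 ∈ endpoints C := ⟨c, h, Or.inl rfl⟩

lemma sink_mem {c : ℕ × ℕ} (h : c ∈ C) : c.2 ∈ endpoints C := ⟨c, h, Or.inr rfl⟩

lemma endpoints_mono (h : P ⊆ C) : endpoints P ⊆ endpoints C :=
  fun _ ⟨c, hc, k⟩ => ⟨c, h hc, k⟩

lemma endpoints_union : endpoints (P ∪ Q) = endpoints P ∪ endpoints Q := by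
  ext q
  simp only [endpoints, Finset.mem_union, Set.mem_union, Set.mem_ofPred_eq, or_and_right,
    exists_or]

lemma endpoints_eq_coe (C : Finset (ℕ × ℕ)) :
    endpoints C = ((C.image Prod.fst ∪ C.image Prod.snd : Finset ℕ) : Set ℕ) := by
  ext q
  simp only [endpoints, Set.mem_ofPred_eq, Finset.coe_union, Finset.coe_image, Set.mem_union,
    Set.mem_image, Finset.mem_coe]
  constructor
  · rintro ⟨c, hc, rfl | rfl⟩
    · exact Or.inl ⟨c, hc, rfl⟩
    · exact Or.inr ⟨c, hc, rfl⟩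
  · rintro (⟨c, hc, rfl⟩ | ⟨c, hc, rfl⟩)
    · exact ⟨c, hc, Or.inl rfl⟩
    · exact ⟨c, hc, Or.inr rfl⟩

lemma endpoints_finite (C : Finset (ℕ × ℕ)) : (endpoints C).Finite :=
  endpoints_eq_coe C ▸ Finset.finite_toSet _

lemma IsSystem.mono (hC : IsSystem C) (h : P ⊆ C) : IsSystem P where
  lt c hc := hC.lt c (h hc)
  source_inj c hc d hd := hC.source_inj c (h hc) d (h hd)
  sink_inj c hc d hd := hC.sink_inj c (h hc) d (h hd)
  source_ne_sink c hc d hd := hC.source_ne_sink c (h hc) d (h hd)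

lemma IsSystem.eq_of_endpoint (hC : IsSystem C) {c d : ℕ × ℕ} (hc : c ∈ C) (hd : d ∈ C) {q : ℕ}
    (h : q = c.1 ∨ q = c.2) (k : q = d.1 ∨ q = d.2) : c = d := by
  rcases h with rfl | rfl <;> rcases k with k | k
  · exact hC.source_inj c hc d hd k
  · exact absurd k (hC.source_ne_sink c hc d hd)
  · exact absurd k.symm (hC.source_ne_sink d hd c hc)
  · exact hC.sink_inj c hc d hd k

lemma Uncovered.mono {s w : ℕ} (h : Uncovered C s w) (hP : P ⊆ C) : Uncovered P s w :=
  fun d hd => h d (hP hd)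

lemma GoodGap.mono {q : ℕ} (h : GoodGap C q) (hP : P ⊆ C) : GoodGap P q := by
  intro e he h1 h2
  obtain ⟨w, k1, k2, k3⟩ := h e (hP he) h1 h2
  exact ⟨w, k1, k2, k3.mono hP⟩

lemma CycleFree.mono (h : CycleFree C) (hP : P ⊆ C) : CycleFree P := by
  intro c hc e he hce
  obtain ⟨w, k1, k2, k3⟩ := h c (hP hc) e (hP he) hce
  exact ⟨w, k1, k2, k3.mono hP⟩

/-- In a top cycle, the chords of the path would all have to end at or before the uncovered
position. -/
lemma topCycleFree_of_cycleFree (h : CycleFree C) : TopCycleFree C := by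
  rintro m hm ⟨f, hf, hT⟩
  have mono : ∀ {a b : ℕ}, 1 ≤ a → a < b → b ≤ 2 * m → f a < f b := fun h1 h2 h3 =>
    hf ⟨h1, by omega⟩ ⟨by omega, h3⟩ h2
  have hpath : ∀ k, k < m - 1 → (f (2 * k + 1), f (2 * k + 4)) ∈ C := fun k hk =>
    hT (2 * k + 1, 2 * k + 4)
      (Finset.mem_insert_of_mem (Finset.mem_image.2 ⟨k, Finset.mem_range.2 hk, rfl⟩))
  have he : (f 2, f (2 * m - 1)) ∈ C := hT (2, 2 * m - 1) (Finset.mem_insert_self _ _)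
  obtain ⟨w, h1, h2, h3⟩ := h _ (hpath 0 (by omega)) _ he
    ⟨mono (by omega) (by omega) (by omega), mono (by omega) (by omega) (by omega),
      mono (by omega) (by omega) (by omega)⟩
  -- One chord of the path after the other ends at or before `w`.
  have key : ∀ k, k < m - 1 → f (2 * k + 4) ≤ w := by
    intro k
    induction k with
    | zero => exact fun _ => h1
    | succ k ih =>
      intro hk
      refine h3 _ (hpath (k + 1) hk) (mono (by omega) (by omega) (by omega)) ?_
      exact (mono (a := 2 * (k + 1) + 1) (b := 2 * k + 4) (by omega) (by omega)
        (by omega)).le.trans (ih (by omega))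
  have h4 := key (m - 2) (by omega)
  have h5 := mono (a := 2 * m - 1) (b := 2 * (m - 2) + 4) (by omega) (by omega) (by omega)
  exact absurd (h4.trans h2) (not_le.2 h5)

lemma strictMonoOn_of_succ {f : ℕ → ℕ} {a b : ℕ} (h : ∀ k, a ≤ k → k < b → f k < f (k + 1)) :
    StrictMonoOn f (Set.Icc a b) := by
  intro x hx y hy hxy
  obtain ⟨d, rfl⟩ : ∃ d, y = x + d + 1 := ⟨y - x - 1, by omega⟩
  clear hxy
  obtain ⟨hx1, -⟩ := hx
  obtain ⟨-, hy2⟩ := hy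
  induction d with
  | zero => exact h x hx1 (by omega)
  | succ d ih => exact (ih (by omega)).trans (h _ (by omega) (by omega))

/-- If the part of `e` to the right of `c` is covered, then chords that reach as far to the right as
possible form a top cycle with `c` and `e`. -/
lemma cycleFree_of_topCycleFree (hC : IsSystem C) (h : TopCycleFree C) : CycleFree C := by
  classical
  intro c hc e he hce
  by_contra hcon
  have hcov : ∀ w, c.2 ≤ w → w ≤ e.2 → ∃ d ∈ C, e.1 < d.1 ∧ d.1 ≤ w ∧ w < d.2 := by
    intro w h1 h2
    by_contra hw
    refine hcon ⟨w, h1, h2, fun d hd k1 k2 => ?_⟩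
    by_contra hlt
    exact hw ⟨d, hd, k1, k2, by omega⟩
  have hnext : ∀ w, ∃ d : ℕ × ℕ, c.2 ≤ w → w ≤ e.2 →
      (d ∈ C ∧ e.1 < d.1 ∧ d.1 ≤ w ∧ w < d.2) ∧
        ∀ d' ∈ C, e.1 < d'.1 → d'.1 ≤ w → w < d'.2 → d'.2 ≤ d.2 := by
    intro w
    by_cases hw : c.2 ≤ w ∧ w ≤ e.2
    · obtain ⟨d, hd, k⟩ := hcov w hw.1 hw.2
      obtain ⟨d, hd, hmax⟩ := (C.filter fun d => e.1 < d.1 ∧ d.1 ≤ w ∧ w < d.2).exists_max_image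
        Prod.snd ⟨d, Finset.mem_filter.2 ⟨hd, k⟩⟩
      refine ⟨d, fun _ _ => ⟨Finset.mem_filter.1 hd, fun d' h1 h2 h3 h4 => ?_⟩⟩
      exact hmax d' (Finset.mem_filter.2 ⟨h1, h2, h3, h4⟩)
    · exact ⟨c, fun h1 h2 => absurd ⟨h1, h2⟩ hw⟩
  -- The chord `d (k + 1)` reaches furthest to the right among those that cover the end of `d k`.
  choose N hN using hnext
  let d : ℕ → ℕ × ℕ := fun k => Nat.rec c (fun _ x => N x.2) k
  have d0 : d 0 = c := rfl
  have ds : ∀ k, d (k + 1) = N (d k).2 := fun _ => rfl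
  have hex : ∃ k, e.2 < (d k).2 := by
    by_contra! hle
    have hgrow : ∀ k, c.2 + k ≤ (d k).2 := by
      intro k
      induction k with
      | zero => exact le_rfl
      | succ k ih =>
        have := (hN (d k).2 (by omega) (hle k)).1.2.2.2
        rw [ds]
        omega
    have := hgrow (e.2 + 1)
    have := hle (e.2 + 1)
    omega
  -- The chain stops when it passes the end of `e`.
  obtain ⟨K, hK, hmin⟩ : ∃ K, e.2 < (d K).2 ∧ ∀ k < K, (d k).2 ≤ e.2 :=
    ⟨Nat.find hex, Nat.find_spec hex, fun k hk => not_lt.1 (Nat.find_min hex hk)⟩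
  have hKpos : 1 ≤ K := by
    rcases Nat.eq_zero_or_pos K with rfl | k
    · have := hce.2.2
      rw [d0] at hK
      omega
    · exact k
  have hge : ∀ k ≤ K, c.2 ≤ (d k).2 := by
    intro k
    induction k with
    | zero => exact fun _ => le_rfl
    | succ k ih =>
      intro hk
      have := (hN (d k).2 (ih (by omega)) (hmin k (by omega))).1.2.2.2
      rw [ds]
      have := ih (by omega)
      omega
  have hstep : ∀ k < K, (d (k + 1) ∈ C ∧ e.1 < (d (k + 1)).1 ∧ (d (k + 1)).1 ≤ (d k).2 ∧
      (d k).2 < (d (k + 1)).2) ∧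
        ∀ d' ∈ C, e.1 < d'.1 → d'.1 ≤ (d k).2 → (d k).2 < d'.2 → d'.2 ≤ (d (k + 1)).2 :=
    fun k hk => hN (d k).2 (hge k (by omega)) (hmin k hk)
  have hmem : ∀ k ≤ K, d k ∈ C := by
    intro k hk
    rcases k with _ | k
    · exact hc
    · exact (hstep k (by omega)).1.1
  have hlt1 : ∀ k < K, (d (k + 1)).1 < (d k).2 := fun k hk =>
    lt_of_le_of_ne (hstep k hk).1.2.2.1
      (hC.source_ne_sink _ (hmem (k + 1) (by omega)) _ (hmem k (by omega)))
  -- By maximality, chords that are not consecutive in the chain do not cross.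
  have hlt2 : ∀ k, k + 1 < K → (d k).2 < (d (k + 2)).1 := by
    intro k hk
    by_contra! hle
    have h1 := (hstep k (by omega)).1
    have h2 := (hstep (k + 1) hk).1
    have := (hstep k (by omega)).2 _ h2.1 h2.2.1 hle (h1.2.2.2.trans h2.2.2.2)
    omega
  have hlast : (d (K - 1)).2 < e.2 := by
    refine lt_of_le_of_ne (hmin _ (by omega)) fun heq => ?_
    have heq := hC.sink_inj _ (hmem (K - 1) (by omega)) _ he heq
    rcases Nat.eq_zero_or_pos (K - 1) with k | k
    · rw [k, d0] at heq
      have := hce.1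
      rw [heq] at this
      omega
    · have := (hstep (K - 2) (by omega)).1.2.1
      rw [show K - 2 + 1 = K - 1 by omega, heq] at this
      omega
  -- The end points of the top cycle in their order.
  let f : ℕ → ℕ := fun i =>
    if i = 2 then e.1 else if i = 2 * K + 3 then e.2 else
      if i % 2 = 1 then (d (i / 2)).1 else (d (i / 2 - 2)).2
  have f2 : f 2 = e.1 := if_pos rfl
  have fe : f (2 * K + 3) = e.2 := by
    change (if 2 * K + 3 = 2 then _ else _) = _
    rw [if_neg (by omega), if_pos rfl]
  have fs : ∀ k ≤ K, f (2 * k + 1) = (d k).1 := by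
    intro k hk
    change (if 2 * k + 1 = 2 then _ else _) = _
    rw [if_neg (by omega), if_neg (by omega), if_pos (by omega),
      show (2 * k + 1) / 2 = k by omega]
  have ft : ∀ k ≤ K, f (2 * k + 4) = (d k).2 := by
    intro k hk
    change (if 2 * k + 4 = 2 then _ else _) = _
    rw [if_neg (by omega), if_neg (by omega), if_neg (by omega),
      show (2 * k + 4) / 2 - 2 = k by omega]
  refine h (K + 2) (by omega) ⟨f, strictMonoOn_of_succ fun i h1 h2 => ?_, fun x hx => ?_⟩
  · rcases Nat.even_or_odd' i with ⟨j, rfl | rfl⟩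
    · obtain rfl | ⟨k, rfl⟩ : j = 1 ∨ ∃ k, j = k + 2 := by
        rcases j with _ | _ | j
        · omega
        · exact Or.inl rfl
        · exact Or.inr ⟨j, rfl⟩
      · rw [mul_one, f2, show 2 + 1 = 2 * 1 + 1 from rfl, fs 1 hKpos]
        exact (hstep 0 (by omega)).1.2.1
      · rw [show 2 * (k + 2) = 2 * k + 4 by ring, ft k (by omega)]
        by_cases hk : k + 1 = K
        · rw [show 2 * k + 4 + 1 = 2 * K + 3 by omega, fe, show k = K - 1 by omega]
          exact hlast
        · rw [show 2 * k + 4 + 1 = 2 * (k + 2) + 1 by ring, fs _ (by omega)]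
          exact hlt2 k (by omega)
    · rcases j with _ | k
      · change f (2 * 0 + 1) < f 2
        rw [f2, fs 0 (by omega)]
        exact hce.1
      · rw [show 2 * (k + 1) + 1 + 1 = 2 * k + 4 by ring, ft k (by omega)]
        by_cases hk : k = K
        · rw [show 2 * (k + 1) + 1 = 2 * K + 3 by omega, fe, hk]
          exact hK
        · rw [fs (k + 1) (by omega)]
          exact hlt1 k (by omega)
  · rcases Finset.mem_insert.1 hx with rfl | hx
    · rw [show 2 * (K + 2) - 1 = 2 * K + 3 by omega, fe, f2]
      exact he
    · obtain ⟨k, hk, rfl⟩ := Finset.mem_image.1 hx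
      rw [Finset.mem_range] at hk
      rw [fs k (by omega), ft k (by omega)]
      exact hmem k (by omega)

lemma topCycleFree_iff (hC : IsSystem C) : TopCycleFree C ↔ CycleFree C :=
  ⟨cycleFree_of_topCycleFree hC, topCycleFree_of_cycleFree⟩

/-- Chords that do not cross `P` can be added without covering the part of `e` after `q`. -/
lemma exists_uncovered_union (hC : IsSystem (P ∪ Q)) (h : ∀ c ∈ P, ∀ d ∈ Q, ¬ Cross c d)
    {e : ℕ × ℕ} (he : e ∈ P) {q : ℕ} (hw : ∃ w, q ≤ w ∧ w ≤ e.2 ∧ Uncovered P e.1 w) :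
    ∃ w, q ≤ w ∧ w ≤ e.2 ∧ Uncovered (P ∪ Q) e.1 w := by
  classical
  -- The greatest uncovered position works: a chord of `Q` covering it would end at a greater one.
  obtain ⟨w, ⟨h1, h2, h3⟩, hmax⟩ : ∃ w, (q ≤ w ∧ w ≤ e.2 ∧ Uncovered P e.1 w) ∧
      ∀ w', (q ≤ w' ∧ w' ≤ e.2 ∧ Uncovered P e.1 w') → w' ≤ w := by
    obtain ⟨w, hw⟩ := hw
    have hle : w ≤ e.2 := hw.2.1
    exact ⟨Nat.findGreatest (fun w => q ≤ w ∧ w ≤ e.2 ∧ Uncovered P e.1 w) e.2,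
      Nat.findGreatest_spec (P := fun w => q ≤ w ∧ w ≤ e.2 ∧ Uncovered P e.1 w) hle hw,
      fun w' hw' => Nat.le_findGreatest (P := fun w => q ≤ w ∧ w ≤ e.2 ∧ Uncovered P e.1 w)
        hw'.2.1 hw'⟩
  refine ⟨w, h1, h2, fun d hd k1 k2 => ?_⟩
  rcases Finset.mem_union.1 hd with hdP | hdQ
  · exact h3 d hdP k1 k2
  by_contra hlt
  have e1 : d.1 < e.2 := lt_of_le_of_ne (k2.trans h2)
    (hC.source_ne_sink d hd e (Finset.mem_union_left _ he))
  have e2 : d.2 ≤ e.2 := by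
    by_contra k
    exact h e he d hdQ (Or.inl ⟨k1, e1, by omega⟩)
  have := hmax d.2 ⟨by omega, e2, fun d' hd' k3 k4 => ?_⟩
  · omega
  · by_contra k5
    have k6 : d'.1 < d.2 := lt_of_le_of_ne k4
      (hC.source_ne_sink d' (Finset.mem_union_left _ hd') d hd)
    have k7 : d'.1 ≤ d.1 := by
      by_contra k
      exact h d' hd' d hdQ (Or.inr ⟨by omega, k6, by omega⟩)
    have := h3 d' hd' k3 (by omega)
    omega

lemma GoodGap.union (hC : IsSystem (P ∪ Q)) (h : ∀ c ∈ P, ∀ d ∈ Q, ¬ Cross c d) {q : ℕ}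
    (hP : GoodGap P q) (hQ : GoodGap Q q) : GoodGap (P ∪ Q) q := by
  intro e he h1 h2
  rcases Finset.mem_union.1 he with k | k
  · exact exists_uncovered_union hC h k (hP e k h1 h2)
  · rw [Finset.union_comm] at hC ⊢
    exact exists_uncovered_union hC (fun c hc d hd k => h d hd c hc k.symm) k (hQ e k h1 h2)

lemma CycleFree.union (hC : IsSystem (P ∪ Q)) (h : ∀ c ∈ P, ∀ d ∈ Q, ¬ Cross c d)
    (hP : CycleFree P) (hQ : CycleFree Q) : CycleFree (P ∪ Q) := by
  intro c hc e he hce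
  rcases Finset.mem_union.1 hc with k | k <;> rcases Finset.mem_union.1 he with k' | k'
  · exact exists_uncovered_union hC h k' (hP c k e k' hce)
  · exact absurd (Or.inl hce) (h c k e k')
  · exact absurd (Or.inr hce) (h e k' c k)
  · rw [Finset.union_comm] at hC ⊢
    exact exists_uncovered_union hC (fun c hc d hd k => h d hd c hc k.symm) k' (hQ c k e k' hce)

/-- Adding a chord with smallest source. -/
lemma cycleFree_insert {ρ : ℕ × ℕ} (hC : IsSystem (insert ρ C)) (hρ : ∀ c ∈ C, ρ.1 < c.1) :
    CycleFree (insert ρ C) ↔ CycleFree C ∧ GoodGap C ρ.2 := by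
  have hlt := hC.lt ρ (Finset.mem_insert_self _ _)
  have hunc : ∀ e ∈ C, ∀ w, Uncovered C e.1 w → Uncovered (insert ρ C) e.1 w := by
    intro e he w hw d hd k1 k2
    rcases Finset.mem_insert.1 hd with rfl | hd
    · have := hρ e he
      omega
    · exact hw d hd k1 k2
  constructor
  · refine fun h => ⟨h.mono (Finset.subset_insert _ _), fun e he h1 h2 => ?_⟩
    have hne : e.1 ≠ ρ.2 := hC.source_ne_sink e (Finset.mem_insert_of_mem he) ρ
      (Finset.mem_insert_self _ _)
    obtain ⟨w, k1, k2, k3⟩ := h ρ (Finset.mem_insert_self _ _) e (Finset.mem_insert_of_mem he)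
      ⟨hρ e he, by omega, h2⟩
    exact ⟨w, k1, k2, k3.mono (Finset.subset_insert _ _)⟩
  · rintro ⟨h1, h2⟩ c hc e he hce
    rcases Finset.mem_insert.1 he with rfl | he'
    · rcases Finset.mem_insert.1 hc with rfl | hc'
      · have := hce.1
        omega
      · have := hρ c hc'
        have := hce.1
        omega
    · rcases Finset.mem_insert.1 hc with rfl | hc'
      · obtain ⟨w, k1, k2, k3⟩ := h2 e he' hce.2.1.le hce.2.2
        exact ⟨w, k1, k2, hunc e he' w k3⟩
      · obtain ⟨w, k1, k2, k3⟩ := h1 c hc' e he' hce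
        exact ⟨w, k1, k2, hunc e he' w k3⟩

/-- A connected set of chords covers all positions between its end points. -/
lemma Linked.exists_cover (hC : IsSystem C) (h : Linked C) {w : ℕ} {a b : ℕ × ℕ} (ha : a ∈ C)
    (ha' : a.1 ≤ w) (hb : b ∈ C) (hb' : w < b.2) : ∃ d ∈ C, d.1 ≤ w ∧ w < d.2 := by
  by_contra hcon
  have hP := h.eq_of_isolated (C.filter fun c => c.2 ≤ w) (Finset.filter_subset _ _)
    ⟨a, Finset.mem_filter.2 ⟨ha, by by_contra k; exact hcon ⟨a, ha, ha', by omega⟩⟩⟩ ?_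
  · have := (Finset.mem_filter.1 (hP ▸ hb)).2
    omega
  · intro c hc d hd hdP k
    rw [Finset.mem_filter] at hc hdP
    have h1 : w < d.2 := by
      by_contra k
      exact hdP ⟨hd, by omega⟩
    have h2 : w < d.1 := by
      by_contra k
      exact hcon ⟨d, hd, by omega, h1⟩
    have := hC.lt c hc.1
    rcases k with ⟨k1, k2, k3⟩ | ⟨k1, k2, k3⟩ <;> omega

/-! ### The decomposition of a connected system at its root -/

/-- The decomposition of a connected set of chords at its root `ρ`: the part `B` is the first
component that is left when `ρ` is removed, the part `A` contains everything else. -/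
structure Split (C : Finset (ℕ × ℕ)) (ρ : ℕ × ℕ) (B A : Finset (ℕ × ℕ)) : Prop where
  sys : IsSystem C
  linked : Linked C
  union : B ∪ A = C
  disj : Disjoint B A
  root_mem : ρ ∈ A
  root_lt : ∀ c ∈ C, c ≠ ρ → ρ.1 < c.1
  linked_left : Linked B
  first : ∃ b ∈ B, ∀ c ∈ C, c ≠ ρ → b.1 ≤ c.1
  not_cross : ∀ b ∈ B, ∀ a ∈ A, a ≠ ρ → ¬ Cross b a

namespace Split

variable {ρ : ℕ × ℕ} {B A : Finset (ℕ × ℕ)} (D : Split C ρ B A)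

include D

lemma mem_left {c : ℕ × ℕ} (h : c ∈ B) : c ∈ C := D.union ▸ Finset.mem_union_left _ h

lemma mem_right {c : ℕ × ℕ} (h : c ∈ A) : c ∈ C := D.union ▸ Finset.mem_union_right _ h

lemma subset_left : B ⊆ C := fun _ => D.mem_left

lemma subset_right : A ⊆ C := fun _ => D.mem_right

lemma mem_or {c : ℕ × ℕ} (h : c ∈ C) : c ∈ B ∨ c ∈ A := by
  rwa [← D.union, Finset.mem_union] at h

lemma not_mem_both {c : ℕ × ℕ} (h : c ∈ B) : c ∉ A := Finset.disjoint_left.1 D.disj h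

lemma ne_root {b : ℕ × ℕ} (h : b ∈ B) : b ≠ ρ := fun e => D.not_mem_both h (e ▸ D.root_mem)

lemma root_lt_left {b : ℕ × ℕ} (h : b ∈ B) : ρ.1 < b.1 :=
  D.root_lt b (D.mem_left h) (D.ne_root h)

/-- The root crosses a chord of `B`. -/
lemma exists_cross : ∃ b ∈ B, b.1 < ρ.2 ∧ ρ.2 < b.2 := by
  by_contra hcon
  have := D.linked.eq_of_isolated B D.subset_left D.linked_left.nonempty ?_
  · exact D.not_mem_both (this ▸ D.mem_right D.root_mem) D.root_mem
  · intro b hb c hc hcB k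
    have hcA := (D.mem_or hc).resolve_left hcB
    by_cases e : c = ρ
    · subst e
      have := D.root_lt_left hb
      rcases k with ⟨k1, k2, k3⟩ | ⟨k1, k2, k3⟩
      · omega
      · exact hcon ⟨b, hb, k2, k3⟩
    · exact D.not_cross b hb c hcA e k

lemma linked_right : Linked A where
  nonempty := ⟨ρ, D.root_mem⟩
  eq_of_isolated P hP hne hiso := by
    by_cases hρ : ρ ∈ P
    · have h := D.linked.eq_of_isolated (B ∪ P) (Finset.union_subset D.subset_left
        (hP.trans D.subset_right)) ⟨ρ, Finset.mem_union_right _ hρ⟩ ?_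
      · refine Finset.Subset.antisymm hP fun a ha => ?_
        have := h ▸ D.mem_right ha
        exact (Finset.mem_union.1 this).resolve_left fun k => D.not_mem_both k ha
      · intro c hc d hd hdP k
        rw [Finset.mem_union, not_or] at hdP
        have hdA := (D.mem_or hd).resolve_left hdP.1
        rcases Finset.mem_union.1 hc with hc | hc
        · exact D.not_cross c hc d hdA (fun e => hdP.2 (e ▸ hρ)) k
        · exact hiso c hc d hdA hdP.2 k
    · have h := D.linked.eq_of_isolated P (hP.trans D.subset_right) hne ?_
      · exact absurd (h ▸ D.mem_right D.root_mem) hρ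
      · intro c hc d hd hdP k
        rcases D.mem_or hd with hd | hd
        · exact D.not_cross d hd c (hP hc) (fun e => hρ (e ▸ hc)) k.symm
        · exact hiso c hc d hd hdP k

/-- A chord of `A` other than the root has no end point of `B` under it. -/
lemma not_between {a : ℕ × ℕ} (ha : a ∈ A) (hne : a ≠ ρ) {q : ℕ} (hq : q ∈ endpoints B) :
    ¬ (a.1 < q ∧ q < a.2) := by
  have haC := D.mem_right ha
  have hdist : ∀ b ∈ B, b.1 ≠ a.1 ∧ b.1 ≠ a.2 ∧ b.2 ≠ a.1 ∧ b.2 ≠ a.2 := by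
    intro b hb
    have hbC := D.mem_left hb
    have hba : b ≠ a := fun e => D.not_mem_both hb (e ▸ ha)
    exact ⟨fun e => hba (D.sys.source_inj b hbC a haC e), D.sys.source_ne_sink b hbC a haC,
      fun e => D.sys.source_ne_sink a haC b hbC e.symm,
      fun e => hba (D.sys.sink_inj b hbC a haC e)⟩
  have hcr : ∀ b ∈ B, (a.1 < b.1 ∧ b.1 < a.2) ↔ (a.1 < b.2 ∧ b.2 < a.2) := by
    intro b hb
    have h1 := D.not_cross b hb a ha hne
    have h2 := hdist b hb
    have h3 := D.sys.lt b (D.mem_left hb)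
    unfold Cross RightNbr at h1
    omega
  obtain ⟨b₀, hb₀, hmin⟩ := D.first
  rintro ⟨h1, h2⟩
  obtain ⟨b, hb, hbq⟩ := hq
  have hin : a.1 < b.1 ∧ b.1 < a.2 := by
    rcases hbq with rfl | rfl
    · exact ⟨h1, h2⟩
    · exact (hcr b hb).2 ⟨h1, h2⟩
  -- The chords of `B` under `a` do not cross the others, so that `B` would lie under `a`; but the
  -- first chord of `B` starts before `a`.
  have hP := D.linked_left.eq_of_isolated (B.filter fun b => a.1 < b.1 ∧ b.1 < a.2)
    (Finset.filter_subset _ _) ⟨b, Finset.mem_filter.2 ⟨hb, hin⟩⟩ ?_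
  · have h3 := (Finset.mem_filter.1 (hP ▸ hb₀)).2
    have := hmin a haC hne
    omega
  · intro c hc d hd hdP k
    rw [Finset.mem_filter] at hc hdP
    have e1 := (hcr c hc.1).1 hc.2
    have e2 := hcr d hd
    have e3 : ¬ (a.1 < d.1 ∧ d.1 < a.2) := fun k => hdP ⟨hd, k⟩
    have e4 := hdist d hd
    unfold Cross RightNbr at k
    omega

/-- All end points of `A` but the first lie in one gap of `B`. -/
lemma lt_iff {a : ℕ × ℕ} (ha : a ∈ A) (hne : a ≠ ρ) {q r : ℕ} (hq : q ∈ endpoints B)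
    (hr : r = a.1 ∨ r = a.2) : r < q ↔ ρ.2 < q := by
  have hρC := D.mem_right D.root_mem
  obtain ⟨b, hb, hbq⟩ := hq
  have hq : q ∈ endpoints B := ⟨b, hb, hbq⟩
  have hbC := D.mem_left hb
  have hend : ∀ c ∈ A, q ≠ c.1 ∧ q ≠ c.2 := by
    intro c hc
    have hcC := D.mem_right hc
    constructor
    · intro e
      exact D.not_mem_both hb (D.sys.eq_of_endpoint hbC hcC hbq (Or.inl e) ▸ hc)
    · intro e
      exact D.not_mem_both hb (D.sys.eq_of_endpoint hbC hcC hbq (Or.inr e) ▸ hc)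
  have hside : ∀ c ∈ A, c ≠ ρ → (c.1 < q ↔ c.2 < q) := by
    intro c hc hcρ
    have h1 := D.not_between hc hcρ hq
    have h2 := hend c hc
    have h3 := D.sys.lt c (D.mem_right hc)
    omega
  by_contra hcon
  have hbad : ¬ (a.1 < q ↔ ρ.2 < q) := by
    rcases hr with rfl | rfl
    · exact hcon
    · rwa [hside a ha hne]
  -- The chords of `A` on the other side of `q` than the end of the root would be isolated.
  have hP := D.linked.eq_of_isolated (A.filter fun c => c ≠ ρ ∧ ¬ (c.1 < q ↔ ρ.2 < q))
    ((Finset.filter_subset _ _).trans D.subset_right) ⟨a, Finset.mem_filter.2 ⟨ha, hne, hbad⟩⟩ ?_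
  · exact (Finset.mem_filter.1 (hP ▸ hρC)).2.1 rfl
  · intro c hc d hd hdP k
    rw [Finset.mem_filter] at hc hdP
    obtain ⟨hcA, hcρ, hcq⟩ := hc
    have e1 := hside c hcA hcρ
    have e2 := hend c hcA
    have e3 := hend ρ D.root_mem
    rcases D.mem_or hd with hd | hd
    · exact D.not_cross d hd c hcA hcρ k.symm
    by_cases hdρ : d = ρ
    · subst hdρ
      have := D.root_lt c (D.mem_right hcA) hcρ
      unfold Cross RightNbr at k
      omega
    · have e4 := hside d hd hdρ
      have e5 : d.1 < q ↔ ρ.2 < q := by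
        by_contra e
        exact hdP ⟨hd, hdρ, e⟩
      have e6 := hend d hd
      unfold Cross RightNbr at k
      omega

lemma union_erase : B ∪ A.erase ρ = C.erase ρ := by
  ext c
  simp only [Finset.mem_union, Finset.mem_erase, ← D.union]
  constructor
  · rintro (h | h)
    · exact ⟨D.ne_root h, Or.inl h⟩
    · exact ⟨h.1, Or.inr h.2⟩
  · rintro ⟨h1, h | h⟩
    · exact Or.inl h
    · exact Or.inr ⟨h1, h⟩

lemma not_cross_erase : ∀ b ∈ B, ∀ a ∈ A.erase ρ, ¬ Cross b a := fun b hb a ha =>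
  D.not_cross b hb a (Finset.mem_of_mem_erase ha) (Finset.ne_of_mem_erase ha)

lemma sys_erase : IsSystem (B ∪ A.erase ρ) := D.union_erase ▸ D.sys.mono (Finset.erase_subset _ _)

lemma cycleFree_iff : CycleFree C ↔ (CycleFree B ∧ GoodGap B ρ.2) ∧ CycleFree A := by
  have hA : insert ρ (A.erase ρ) = A := Finset.insert_erase D.root_mem
  have hC : insert ρ (B ∪ A.erase ρ) = C := by
    rw [D.union_erase, Finset.insert_erase (D.mem_right D.root_mem)]
  have h1 := cycleFree_insert (ρ := ρ) (C := B ∪ A.erase ρ) (by rw [hC]; exact D.sys) (by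
    intro c hc
    rw [D.union_erase] at hc
    exact D.root_lt c (Finset.mem_of_mem_erase hc) (Finset.ne_of_mem_erase hc))
  have h2 := cycleFree_insert (ρ := ρ) (C := A.erase ρ) (by
    rw [hA]; exact D.sys.mono D.subset_right) (fun c hc =>
    D.root_lt c (D.mem_right (Finset.mem_of_mem_erase hc)) (Finset.ne_of_mem_erase hc))
  rw [hC] at h1
  rw [hA] at h2
  rw [h1, h2]
  constructor
  · rintro ⟨k1, k2⟩
    exact ⟨⟨k1.mono Finset.subset_union_left, k2.mono Finset.subset_union_left⟩,
      k1.mono Finset.subset_union_right, k2.mono Finset.subset_union_right⟩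
  · rintro ⟨⟨k1, k2⟩, k3, k4⟩
    exact ⟨k1.union D.sys_erase D.not_cross_erase k3, k2.union D.sys_erase D.not_cross_erase k4⟩

/-- The good gaps to the right of the end of the root. -/
lemma goodGap_iff {q : ℕ} (hq : ρ.2 ≤ q) : GoodGap C q ↔ GoodGap B q ∧ GoodGap A q := by
  constructor
  · exact fun h => ⟨h.mono D.subset_left, h.mono D.subset_right⟩
  · rintro ⟨h1, h2⟩
    have h3 := h1.union D.sys_erase D.not_cross_erase (h2.mono (Finset.erase_subset _ _))
    rw [D.union_erase] at h3
    intro e he k1 k2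
    have hne : e ≠ ρ := by
      rintro rfl
      omega
    obtain ⟨w, e1, e2, e3⟩ := h3 e (Finset.mem_erase.2 ⟨hne, he⟩) k1 k2
    refine ⟨w, e1, e2, fun d hd j1 j2 => ?_⟩
    by_cases hdρ : d = ρ
    · subst hdρ
      omega
    · exact e3 d (Finset.mem_erase.2 ⟨hdρ, hd⟩) j1 j2

/-- The gaps under the root are bad, except for the first one. -/
lemma not_goodGap {q : ℕ} (hq : q ∈ endpoints C) (h1 : ρ.1 < q) (h2 : q < ρ.2) :
    ¬ GoodGap C q := by
  intro h
  obtain ⟨w, k1, k2, k3⟩ := h ρ (D.mem_right D.root_mem) h1.le h2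
  obtain ⟨b₀, hb₀, hmin⟩ := D.first
  obtain ⟨b, hb, hb1, hb2⟩ := D.exists_cross
  have hb₀q : b₀.1 ≤ q := by
    obtain ⟨c, hc, hcq⟩ := hq
    have hcρ : c ≠ ρ := by
      rintro rfl
      omega
    have := hmin c hc hcρ
    have := D.sys.lt c hc
    omega
  obtain ⟨d, hd, e1, e2⟩ := D.linked_left.exists_cover (D.sys.mono D.subset_left) hb₀
    (hb₀q.trans k1) hb (lt_of_le_of_lt k2 hb2)
  have := k3 d (D.mem_left hd) (D.root_lt_left hd) e1
  omega

end Split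

end ChordDiagram

/-! ### The intersection order -/

namespace ChordDiagram

variable {C S : Finset (ℕ × ℕ)}

lemma mem_of_reachable {P : Finset (ℕ × ℕ)} (hP : ∀ c ∈ P, ∀ d ∈ C, d ∉ P → ¬ Cross c d)
    {u v : {c // c ∈ C}} (h : (intersectionGraph C).Reachable u v) (hu : u.1 ∈ P) : v.1 ∈ P := by
  obtain ⟨p⟩ := h
  induction p with
  | nil => exact hu
  | @cons u v w huv p ih =>
    refine ih ?_
    by_contra k
    exact hP u.1 hu v.1 v.2 k huv

lemma linked_of_connected (h : Connected C) : Linked C where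
  nonempty := by
    obtain ⟨c⟩ := h.nonempty
    exact ⟨c.1, c.2⟩
  eq_of_isolated P hPC hne hiso := by
    obtain ⟨c, hc⟩ := hne
    refine Finset.Subset.antisymm hPC fun d hd => ?_
    exact mem_of_reachable hiso (h.preconnected ⟨c, hPC hc⟩ ⟨d, hd⟩) hc

lemma not_cross_component (h : S.Nonempty) : ∀ c ∈ rootComponent S h, ∀ d ∈ S,
    d ∉ rootComponent S h → ¬ Cross c d := by
  classical
  intro c hc d hd hdn k
  obtain ⟨hcS, _, hr⟩ := Finset.mem_filter.1 hc
  apply hdn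
  refine Finset.mem_filter.2 ⟨hd, hd, hr.trans ?_⟩
  exact SimpleGraph.Adj.reachable k

lemma linked_rootComponent (h : S.Nonempty) : Linked (rootComponent S h) where
  nonempty := ⟨_, root_mem_rootComponent S h⟩
  eq_of_isolated P hP hne hiso := by
    classical
    have key : ∀ Q ⊆ rootComponent S h, root S h ∈ Q →
        (∀ c ∈ Q, ∀ d ∈ rootComponent S h, d ∉ Q → ¬ Cross c d) → Q = rootComponent S h := by
      intro Q hQ hr hQiso
      refine Finset.Subset.antisymm hQ fun c hc => ?_
      obtain ⟨_, _, hreach⟩ := Finset.mem_filter.1 hc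
      refine mem_of_reachable (fun a ha d hd hdn k => ?_) hreach hr
      by_cases hdc : d ∈ rootComponent S h
      · exact hQiso a ha d hdc hdn k
      · exact not_cross_component h a (hQ ha) d hd hdc k
    by_cases hr : root S h ∈ P
    · exact key P hP hr hiso
    · exfalso
      have := key (rootComponent S h \ P) Finset.sdiff_subset
        (Finset.mem_sdiff.2 ⟨root_mem_rootComponent S h, hr⟩) (fun c hc d hd hdn k => ?_)
      · obtain ⟨c, hc⟩ := hne
        exact (Finset.mem_sdiff.1 (this ▸ hP hc)).2 hc
      · have hdP : d ∈ P := by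
          by_contra k
          exact hdn (Finset.mem_sdiff.2 ⟨hd, k⟩)
        exact hiso d hdP c (Finset.mem_sdiff.1 hc).1 (Finset.mem_sdiff.1 hc).2 k.symm

lemma Linked.rootComponent_eq (h : Linked C) : rootComponent C h.nonempty = C :=
  h.eq_of_isolated _ (rootComponent_subset _ _) (linked_rootComponent _).nonempty
    (not_cross_component _)

/-- The component of the root chord is isolated, so that it is everything in a linked set. -/
lemma connected_iff : Connected C ↔ Linked C := by
  classical
  refine ⟨linked_of_connected, fun h => ?_⟩
  have key : ∀ c : {c // c ∈ C}, (intersectionGraph C).Reachable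
      ⟨root C h.nonempty, root_mem C h.nonempty⟩ c := by
    rintro ⟨c, hc⟩
    have hc' := hc
    rw [← h.rootComponent_eq] at hc'
    obtain ⟨_, _, hr⟩ := Finset.mem_filter.1 hc'
    exact hr
  have : Nonempty {c // c ∈ C} := ⟨⟨root C h.nonempty, root_mem C h.nonempty⟩⟩
  exact ⟨fun c d => (key c).symm.trans (key d)⟩

lemma root_le (h : S.Nonempty) {c : ℕ × ℕ} (hc : c ∈ S) : (root S h).1 ≤ c.1 :=
  (S.exists_min_image Prod.fst h).choose_spec.2 c hc

lemma root_eq (hS : IsSystem S) (h : S.Nonempty) {c : ℕ × ℕ} (hc : c ∈ S)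
    (hmin : ∀ d ∈ S, c.1 ≤ d.1) : root S h = c :=
  hS.source_inj _ (root_mem S h) _ hc (le_antisymm (root_le h hc) (hmin _ (root_mem S h)))

/-- Every connected set of at least two chords can be decomposed. -/
lemma exists_split (hC : IsSystem C) (hl : Linked C)
    (h : (C.erase (root C hl.nonempty)).Nonempty) :
    Split C (root C hl.nonempty) (rootComponent (C.erase (root C hl.nonempty)) h)
      (C \ rootComponent (C.erase (root C hl.nonempty)) h) where
  sys := hC
  linked := hl
  union := Finset.union_sdiff_of_subset ((rootComponent_subset _ h).trans (Finset.erase_subset _ _))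
  disj := Finset.disjoint_sdiff
  root_mem := Finset.mem_sdiff.2 ⟨root_mem _ _,
    fun k => Finset.notMem_erase _ _ (rootComponent_subset _ h k)⟩
  root_lt _ hc hne := lt_of_le_of_ne (root_le _ hc)
    fun e => hne (hC.source_inj _ (root_mem _ _) _ hc e).symm
  linked_left := linked_rootComponent h
  first := ⟨_, root_mem_rootComponent _ h,
    fun _ hc hne => root_le h (Finset.mem_erase.2 ⟨hne, hc⟩)⟩
  not_cross b hb a ha hne := not_cross_component h b hb a
    (Finset.mem_erase.2 ⟨hne, (Finset.mem_sdiff.1 ha).1⟩) (Finset.mem_sdiff.1 ha).2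

namespace Split

variable {ρ : ℕ × ℕ} {B A : Finset (ℕ × ℕ)} (D : Split C ρ B A)

include D

lemma root_eq : root C D.linked.nonempty = ρ :=
  ChordDiagram.root_eq D.sys _ (D.mem_right D.root_mem) fun d hd => by
    by_cases e : d = ρ
    · rw [e]
    · exact (D.root_lt d hd e).le

lemma erase_nonempty : (C.erase ρ).Nonempty := by
  obtain ⟨b, hb⟩ := D.linked_left.nonempty
  exact ⟨b, Finset.mem_erase.2 ⟨D.ne_root hb, D.mem_left hb⟩⟩

lemma root_erase : root (C.erase ρ) D.erase_nonempty = root B D.linked_left.nonempty := by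
  obtain ⟨b, hb, hmin⟩ := D.first
  rw [ChordDiagram.root_eq (D.sys.mono (Finset.erase_subset _ _)) D.erase_nonempty
      (Finset.mem_erase.2 ⟨D.ne_root hb, D.mem_left hb⟩)
      (fun d hd => hmin d (Finset.mem_of_mem_erase hd) (Finset.ne_of_mem_erase hd)),
    ChordDiagram.root_eq (D.sys.mono D.subset_left) D.linked_left.nonempty hb
      (fun d hd => hmin d (D.mem_left hd) (D.ne_root hd))]

lemma left_eq : rootComponent (C.erase ρ) D.erase_nonempty = B := by
  have hr : root (C.erase ρ) D.erase_nonempty ∈ B := by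
    rw [D.root_erase]
    exact ChordDiagram.root_mem _ _
  have hB : ∀ c ∈ B, ∀ d ∈ C.erase ρ, d ∉ B → ¬ Cross c d := by
    intro c hc d hd hdn
    exact D.not_cross c hc d ((D.mem_or (Finset.mem_of_mem_erase hd)).resolve_left hdn)
      (Finset.ne_of_mem_erase hd)
  have h1 := (linked_rootComponent D.erase_nonempty).eq_of_isolated
    (rootComponent (C.erase ρ) D.erase_nonempty ∩ B) Finset.inter_subset_left
    ⟨_, Finset.mem_inter.2 ⟨root_mem_rootComponent _ _, hr⟩⟩ (by
      intro c hc d hd hdn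
      refine hB c (Finset.mem_inter.1 hc).2 d (rootComponent_subset _ _ hd) fun k => ?_
      exact hdn (Finset.mem_inter.2 ⟨hd, k⟩))
  have h2 := D.linked_left.eq_of_isolated
    (rootComponent (C.erase ρ) D.erase_nonempty ∩ B) Finset.inter_subset_right
    ⟨_, Finset.mem_inter.2 ⟨root_mem_rootComponent _ _, hr⟩⟩ (by
      intro c hc d hd hdn
      refine not_cross_component D.erase_nonempty c (Finset.mem_inter.1 hc).1 d
        (Finset.mem_erase.2 ⟨D.ne_root hd, D.mem_left hd⟩) fun k => ?_
      exact hdn (Finset.mem_inter.2 ⟨k, hd⟩))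
  exact h1.symm.trans h2

lemma right_eq : C \ B = A := by
  ext c
  rw [Finset.mem_sdiff]
  exact ⟨fun h => (D.mem_or h.1).resolve_left h.2,
    fun h => ⟨D.mem_right h, fun k => D.not_mem_both k h⟩⟩

end Split

lemma intersectionOrder_of_nonempty (h : S.Nonempty) : intersectionOrder S =
    root S h :: (intersectionOrder ((rootComponent S h).erase (root S h)) ++
      intersectionOrder (S \ rootComponent S h)) := by
  rw [intersectionOrder, dif_pos h]

lemma intersectionOrder_empty : intersectionOrder ∅ = [] := by
  rw [intersectionOrder, dif_neg Finset.not_nonempty_empty]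

lemma mem_intersectionOrder {c : ℕ × ℕ} : c ∈ intersectionOrder S ↔ c ∈ S := by
  obtain ⟨k, hk⟩ : ∃ k, S.card = k := ⟨_, rfl⟩
  induction k using Nat.strong_induction_on generalizing S with
  | _ k ih =>
  rcases S.eq_empty_or_nonempty with rfl | h
  · simp [intersectionOrder_empty]
  have h1 : ((rootComponent S h).erase (root S h)).card < k := hk ▸
    lt_of_lt_of_le (Finset.card_erase_lt_of_mem (root_mem_rootComponent S h))
      (Finset.card_le_card (rootComponent_subset S h))
  have h2 : (S \ rootComponent S h).card < k := hk ▸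
    Finset.card_lt_card (Finset.sdiff_ssubset (rootComponent_subset S h)
      ⟨_, root_mem_rootComponent S h⟩)
  rw [intersectionOrder_of_nonempty h, List.mem_cons, List.mem_append, ih _ h1 rfl, ih _ h2 rfl,
    Finset.mem_erase, Finset.mem_sdiff]
  constructor
  · rintro (rfl | ⟨-, k⟩ | ⟨k, -⟩)
    · exact root_mem S h
    · exact rootComponent_subset S h k
    · exact k
  · intro hc
    by_cases e : c = root S h
    · exact Or.inl e
    by_cases k : c ∈ rootComponent S h
    · exact Or.inr (Or.inl ⟨e, k⟩)
    · exact Or.inr (Or.inr ⟨hc, k⟩)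

lemma Linked.intersectionOrder_eq (h : Linked C) : intersectionOrder C =
    root C h.nonempty :: intersectionOrder (C.erase (root C h.nonempty)) := by
  rw [intersectionOrder_of_nonempty h.nonempty, h.rootComponent_eq, Finset.sdiff_self,
    intersectionOrder_empty, List.append_nil]

lemma firstTerminal_singleton (c : ℕ × ℕ) : firstTerminal {c} = 1 := by
  classical
  have hl : Linked {c} :=
    ⟨⟨c, Finset.mem_singleton_self c⟩, fun P hP hne _ =>
      (Finset.subset_singleton_iff.1 hP).resolve_left hne.ne_empty⟩
  have hr : root {c} hl.nonempty = c := Finset.mem_singleton.1 (root_mem _ _)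
  have ht : Terminal {c} c := by
    intro d hd k
    rw [Finset.mem_singleton.1 hd] at k
    exact lt_irrefl _ k.1
  rw [firstTerminal, hl.intersectionOrder_eq, hr, List.findIdx_cons]
  simp [ht]

/-- The intersection order of `B` follows the root, and the terminal chords of `B` stay terminal. -/
lemma Split.firstTerminal_eq {ρ : ℕ × ℕ} {B A : Finset (ℕ × ℕ)} (D : Split C ρ B A) :
    firstTerminal C = firstTerminal B + 1 := by
  classical
  have h1 : intersectionOrder C = ρ :: (intersectionOrder B ++
      intersectionOrder (C.erase ρ \ B)) := by
    have hB := D.linked_left.intersectionOrder_eq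
    rw [D.linked.intersectionOrder_eq, D.root_eq, intersectionOrder_of_nonempty D.erase_nonempty,
      D.left_eq, D.root_erase, hB, List.cons_append]
  have hρ : ¬ Terminal C ρ := by
    obtain ⟨b, hb, k1, k2⟩ := D.exists_cross
    exact fun h => h b (D.mem_left hb) ⟨D.root_lt_left hb, k1, k2⟩
  have hT : ∀ b ∈ B, (Terminal C b ↔ Terminal B b) := by
    intro b hb
    refine ⟨fun h d hd => h d (D.mem_left hd), fun h d hd k => ?_⟩
    rcases D.mem_or hd with hd | hd
    · exact h d hd k
    · by_cases e : d = ρ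
      · subst e
        have := D.root_lt_left hb
        have := k.1
        omega
      · exact D.not_cross b hb d hd e (Or.inl k)
  have hex : ∃ b ∈ B, Terminal B b := by
    obtain ⟨b, hb, hmax⟩ := B.exists_max_image Prod.snd D.linked_left.nonempty
    exact ⟨b, hb, fun d hd k => absurd k.2.2 (not_lt.2 (hmax d hd))⟩
  have hfind : ∀ L : List (ℕ × ℕ), (∀ c ∈ L, c ∈ B) →
      L.findIdx (fun c => decide (Terminal C c)) = L.findIdx (fun c => decide (Terminal B c)) := by
    intro L
    induction L with
    | nil => exact fun _ => rfl
    | cons c L ih =>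
      intro hL
      rw [List.findIdx_cons, List.findIdx_cons, ih fun c hc => hL c (List.mem_cons_of_mem _ hc)]
      congr 1
      exact decide_eq_decide.2 (hT c (hL c List.mem_cons_self))
  have hlt : (intersectionOrder B).findIdx (fun c => decide (Terminal C c)) <
      (intersectionOrder B).length := by
    obtain ⟨b, hb, k⟩ := hex
    refine List.findIdx_lt_length_of_exists ⟨b, mem_intersectionOrder.2 hb, ?_⟩
    simpa using (hT b hb).2 k
  rw [firstTerminal, firstTerminal, h1, List.findIdx_cons, List.findIdx_append, if_pos hlt,
    hfind _ fun c hc => mem_intersectionOrder.1 hc]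
  simp [hρ]

end ChordDiagram

/-! ### Codes of connected systems -/

namespace ChordDiagram

variable {C : Finset (ℕ × ℕ)}

/-- The number of good gaps of `C`, not counting the first gap but counting the unbounded one. -/
noncomputable def width (C : Finset (ℕ × ℕ)) : ℕ :=
  {q | q ∈ endpoints C ∧ (∃ c ∈ C, c.1 < q) ∧ GoodGap C q}.ncard

/-- The number of good gaps of `C` which begin to the right of `y`, the unbounded one included. -/
noncomputable def rightGaps (C : Finset (ℕ × ℕ)) (y : ℕ) : ℕ :=
  {q | q ∈ endpoints C ∧ y < q ∧ GoodGap C q}.ncard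

/-- The connected set of chords `C` is described by the code: it is decomposed recursively until
only single chords are left. -/
inductive HasCode : Finset (ℕ × ℕ) → Code → Prop
  | leaf {C : Finset (ℕ × ℕ)} {c : ℕ × ℕ} (hC : C = {c}) (h : c.1 < c.2) : HasCode C Code.leaf
  | node {C B A : Finset (ℕ × ℕ)} {ρ : ℕ × ℕ} {b a : Code} {p : ℕ} (D : Split C ρ B A)
      (hp : p = rightGaps B ρ.2) (hB : HasCode B b) (hA : HasCode A a) :
      HasCode C (Code.node b a p)

lemma isSystem_singleton {c : ℕ × ℕ} (h : c.1 < c.2) : IsSystem {c} where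
  lt d hd := by rwa [Finset.mem_singleton.1 hd]
  source_inj d hd e he _ := by rw [Finset.mem_singleton.1 hd, Finset.mem_singleton.1 he]
  sink_inj d hd e he _ := by rw [Finset.mem_singleton.1 hd, Finset.mem_singleton.1 he]
  source_ne_sink d hd e he := by
    rw [Finset.mem_singleton.1 hd, Finset.mem_singleton.1 he]
    exact h.ne

lemma linked_singleton (c : ℕ × ℕ) : Linked {c} :=
  ⟨⟨c, Finset.mem_singleton_self c⟩, fun _ hP hne _ =>
    (Finset.subset_singleton_iff.1 hP).resolve_left hne.ne_empty⟩

lemma HasCode.isSystem {c : Code} (h : HasCode C c) : IsSystem C := by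
  cases h with
  | leaf hC h => exact hC ▸ isSystem_singleton h
  | node D => exact D.sys

lemma HasCode.linked {c : Code} (h : HasCode C c) : Linked C := by
  cases h with
  | leaf hC h => exact hC ▸ linked_singleton _
  | node D => exact D.linked

lemma exists_hasCode (hC : IsSystem C) (hl : Linked C) : ∃ c, HasCode C c := by
  obtain ⟨k, hk⟩ : ∃ k, C.card = k := ⟨_, rfl⟩
  induction k using Nat.strong_induction_on generalizing C with
  | _ k ih =>
  rcases (C.erase (root C hl.nonempty)).eq_empty_or_nonempty with h | h
  · have hr := root_mem C hl.nonempty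
    have hs := Finset.insert_erase hr
    rw [h] at hs
    exact ⟨_, HasCode.leaf hs.symm (hC.lt _ hr)⟩
  · have D := exists_split hC hl h
    have hcard := Finset.card_union_of_disjoint D.disj
    rw [D.union] at hcard
    have h1 := D.linked_left.nonempty.card_pos
    have h2 := D.linked_right.nonempty.card_pos
    obtain ⟨b, hb⟩ := ih _ (by omega) (hC.mono D.subset_left) D.linked_left rfl
    obtain ⟨a, ha⟩ := ih _ (by omega) (hC.mono D.subset_right) D.linked_right rfl
    exact ⟨_, HasCode.node D rfl hb ha⟩

lemma Split.ne_singleton {c ρ : ℕ × ℕ} {B A : Finset (ℕ × ℕ)} (D : Split C ρ B A) :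
    C ≠ {c} := by
  rintro rfl
  obtain ⟨b, hb⟩ := D.linked_left.nonempty
  have h1 := Finset.mem_singleton.1 (D.mem_left hb)
  have h2 := Finset.mem_singleton.1 (D.mem_right D.root_mem)
  exact D.ne_root hb (h1.trans h2.symm)

lemma Split.unique {ρ ρ' : ℕ × ℕ} {B A B' A' : Finset (ℕ × ℕ)} (D : Split C ρ B A)
    (D' : Split C ρ' B' A') : ρ' = ρ ∧ B' = B ∧ A' = A := by
  have h1 : ρ' = ρ := D'.root_eq.symm.trans D.root_eq
  subst h1
  have h2 : B' = B := D'.left_eq.symm.trans D.left_eq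
  subst h2
  exact ⟨rfl, rfl, D'.right_eq.symm.trans D.right_eq⟩

lemma HasCode.unique {c c' : Code} (h : HasCode C c) (h' : HasCode C c') : c = c' := by
  induction h generalizing c' with
  | leaf hC =>
    cases h' with
    | leaf => rfl
    | node D => exact (D.ne_singleton hC).elim
  | node D hp _ _ ihB ihA =>
    cases h' with
    | leaf hC => exact (D.ne_singleton hC).elim
    | node D' hp' hB' hA' =>
      obtain ⟨rfl, rfl, rfl⟩ := D.unique D'
      rw [ihB hB', ihA hA', hp, hp']

/-- Whether a gap is good does not depend on the position in the gap. -/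
lemma GoodGap.congr {q q' : ℕ} (h : GoodGap C q) (hq : ∀ r ∈ endpoints C, q < r ↔ q' < r) :
    GoodGap C q' := by
  intro e he h1 h2
  have e1 := hq _ (source_mem he)
  have e2 := hq _ (sink_mem he)
  obtain ⟨w, k1, k2, k3⟩ := h e he (by omega) (by omega)
  refine ⟨max w q', le_max_right _ _, max_le k2 h2.le, fun d hd j1 j2 => ?_⟩
  have e3 := hq _ (source_mem hd)
  have := k3 d hd j1 (by omega)
  omega

lemma Split.endpoints_disjoint {ρ : ℕ × ℕ} {B A : Finset (ℕ × ℕ)} (D : Split C ρ B A) {q : ℕ}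
    (hB : q ∈ endpoints B) : q ∉ endpoints A := by
  rintro ⟨a, ha, hqa⟩
  obtain ⟨b, hb, hqb⟩ := hB
  exact D.not_mem_both hb (D.sys.eq_of_endpoint (D.mem_left hb) (D.mem_right ha) hqb hqa ▸ ha)

lemma Split.endpoints_eq {ρ : ℕ × ℕ} {B A : Finset (ℕ × ℕ)} (D : Split C ρ B A) :
    endpoints C = endpoints B ∪ endpoints A := by rw [← D.union, endpoints_union]

lemma not_goodGap_under_root (hC : IsSystem C) (hl : Linked C) {ρ : ℕ × ℕ} (hρ : ρ ∈ C)
    (hmin : ∀ c ∈ C, ρ.1 ≤ c.1) {q : ℕ} (hq : q ∈ endpoints C) (h1 : ρ.1 < q) (h2 : q < ρ.2) :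
    ¬ GoodGap C q := by
  have hr : root C hl.nonempty = ρ := root_eq hC _ hρ hmin
  have hne : (C.erase (root C hl.nonempty)).Nonempty := by
    rw [hr]
    obtain ⟨c, hc, k⟩ := hq
    refine ⟨c, Finset.mem_erase.2 ⟨?_, hc⟩⟩
    rintro rfl
    omega
  obtain ⟨B, A, D⟩ : ∃ B A, Split C ρ B A := hr ▸ ⟨_, _, exists_split hC hl hne⟩
  exact D.not_goodGap hq h1 h2

/-- The good gaps of a top-cycle-free system are those of `A`, and those of `B` to the right of the
end of the root. -/
lemma Split.width_eq {ρ : ℕ × ℕ} {B A : Finset (ℕ × ℕ)} (D : Split C ρ B A) (hC : CycleFree C) :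
    width C = width A + rightGaps B ρ.2 := by
  have hgood := (D.cycleFree_iff.1 hC).1.2
  have hU : {q | q ∈ endpoints C ∧ (∃ c ∈ C, c.1 < q) ∧ GoodGap C q} =
      {q | q ∈ endpoints A ∧ (∃ c ∈ A, c.1 < q) ∧ GoodGap A q} ∪
        {q | q ∈ endpoints B ∧ ρ.2 < q ∧ GoodGap B q} := by
    ext q
    constructor
    · rintro ⟨hq, ⟨c, hc, hcq⟩, hg⟩
      have h1 : ρ.1 < q := by
        by_cases e : c = ρ
        · rwa [← e]
        · exact (D.root_lt c hc e).trans hcq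
      have h2 : ρ.2 ≤ q := by
        by_contra k
        exact D.not_goodGap hq h1 (by omega) hg
      have h3 := (D.goodGap_iff h2).1 hg
      rw [D.endpoints_eq] at hq
      rcases hq with hq | hq
      · refine Or.inr ⟨hq, lt_of_le_of_ne h2 fun e => ?_, h3.1⟩
        exact D.endpoints_disjoint hq (e ▸ sink_mem D.root_mem)
      · exact Or.inl ⟨hq, ⟨ρ, D.root_mem, h1⟩, h3.2⟩
    · rintro (⟨hq, ⟨c, hc, hcq⟩, hg⟩ | ⟨hq, hlt, hg⟩)
      · have hqC : q ∈ endpoints C := endpoints_mono D.subset_right hq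
        have h1 : ρ.1 < q := by
          by_cases e : c = ρ
          · rwa [← e]
          · exact (D.root_lt c (D.mem_right hc) e).trans hcq
        have h2 : ρ.2 ≤ q := by
          by_contra k
          refine not_goodGap_under_root (D.sys.mono D.subset_right) D.linked_right D.root_mem
            (fun c hc => ?_) hq h1 (by omega) hg
          by_cases e : c = ρ
          · rw [e]
          · exact (D.root_lt c (D.mem_right hc) e).le
        refine ⟨hqC, ⟨c, D.mem_right hc, hcq⟩, (D.goodGap_iff h2).2 ⟨hgood.congr ?_, hg⟩⟩
        intro r hr
        obtain ⟨a, ha, hqa⟩ := hq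
        by_cases e : a = ρ
        · subst e
          have : q = a.2 := by omega
          rw [this]
        · exact (D.lt_iff ha e hr hqa).symm
      · refine ⟨endpoints_mono D.subset_left hq, ⟨ρ, D.mem_right D.root_mem, ?_⟩,
          (D.goodGap_iff hlt.le).2 ⟨hg, fun e he k1 k2 => ?_⟩⟩
        · exact (D.sys.lt _ (D.mem_right D.root_mem)).trans hlt
        · exfalso
          by_cases eρ : e = ρ
          · subst eρ
            omega
          · have := (D.lt_iff he eρ hq (Or.inr rfl)).2 hlt
            omega
  have hd : Disjoint {q | q ∈ endpoints A ∧ (∃ c ∈ A, c.1 < q) ∧ GoodGap A q}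
      {q | q ∈ endpoints B ∧ ρ.2 < q ∧ GoodGap B q} := by
    rw [Set.disjoint_left]
    exact fun q h k => D.endpoints_disjoint k.1 h.1
  rw [width, hU, Set.ncard_union_eq hd ((endpoints_finite A).subset fun q h => h.1)
    ((endpoints_finite B).subset fun q h => h.1)]
  rfl

/-- The unbounded gap is good. -/
lemma Split.rightGaps_pos {ρ : ℕ × ℕ} {B A : Finset (ℕ × ℕ)} (D : Split C ρ B A) :
    1 ≤ rightGaps B ρ.2 := by
  obtain ⟨b, hb, hmax⟩ := B.exists_max_image Prod.snd D.linked_left.nonempty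
  obtain ⟨b', hb', -, hlt⟩ := D.exists_cross
  refine (Set.ncard_pos ((endpoints_finite B).subset fun q h => h.1)).2
    ⟨b.2, sink_mem hb, hlt.trans_le (hmax b' hb'), fun e he _ k => ?_⟩
  exact absurd k (not_lt.2 (hmax e he))

lemma Split.rightGaps_le {ρ : ℕ × ℕ} {B A : Finset (ℕ × ℕ)} (D : Split C ρ B A) :
    rightGaps B ρ.2 ≤ width B := by
  obtain ⟨b, hb, hlt, -⟩ := D.exists_cross
  refine Set.ncard_le_ncard ?_ ((endpoints_finite B).subset fun q h => h.1)
  exact fun q hq => ⟨hq.1, ⟨b, hb, hlt.trans hq.2.1⟩, hq.2.2⟩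

/-- The parameters of a code in terms of the chords. -/
lemma HasCode.spec {c : Code} (h : HasCode C c) (hC : CycleFree C) :
    c.Valid ∧ c.width = width C ∧ c.spine = firstTerminal C ∧ c.size = C.card := by
  induction h with
  | @leaf C c hc h =>
    subst hc
    refine ⟨trivial, ?_, ?_, ?_⟩
    · have : {q | q ∈ endpoints {c} ∧ (∃ d ∈ ({c} : Finset (ℕ × ℕ)), d.1 < q) ∧
          GoodGap {c} q} = {c.2} := by
        ext q
        constructor
        · rintro ⟨⟨d, hd, hq⟩, ⟨d', hd', hlt⟩, -⟩
          rw [Finset.mem_singleton] at hd hd'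
          subst hd hd'
          rcases hq with rfl | rfl
          · exact absurd hlt (lt_irrefl _)
          · rfl
        · rintro rfl
          refine ⟨⟨c, Finset.mem_singleton_self c, Or.inr rfl⟩, ⟨c, Finset.mem_singleton_self c, h⟩,
            fun e he _ k => ?_⟩
          rw [Finset.mem_singleton.1 he] at k
          exact absurd k (lt_irrefl _)
      rw [ChordDiagram.width, this, Set.ncard_singleton]
      rfl
    · rw [firstTerminal_singleton]
      rfl
    · rfl
  | @node C B A ρ b a p D hp hB hA ihB ihA =>
    have hs := D.cycleFree_iff.1 hC
    obtain ⟨vB, wB, sB, nB⟩ := ihB hs.1.1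
    obtain ⟨vA, wA, sA, nA⟩ := ihA hs.2
    refine ⟨⟨vB, vA, hp ▸ D.rightGaps_pos, hp ▸ wB ▸ D.rightGaps_le⟩, ?_, ?_, ?_⟩
    · rw [D.width_eq hC, ← wA, ← hp]
      rfl
    · rw [D.firstTerminal_eq, ← sB]
      rfl
    · rw [← D.union, Finset.card_union_of_disjoint D.disj, ← nB, ← nA]
      rfl

end ChordDiagram

/-! ### Relabelling the end points -/

namespace ChordDiagram

variable {C : Finset (ℕ × ℕ)} {f : ℕ → ℕ}

/-- The end points of the chords are relabelled by `f`. -/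
def relabel (f : ℕ → ℕ) (C : Finset (ℕ × ℕ)) : Finset (ℕ × ℕ) := C.image (Prod.map f f)

lemma mem_relabel {d : ℕ × ℕ} : d ∈ relabel f C ↔ ∃ c ∈ C, (f c.1, f c.2) = d :=
  Finset.mem_image

lemma map_mem_relabel {c : ℕ × ℕ} (h : c ∈ C) : (f c.1, f c.2) ∈ relabel f C :=
  mem_relabel.2 ⟨c, h, rfl⟩

lemma relabel_union {P Q : Finset (ℕ × ℕ)} : relabel f (P ∪ Q) = relabel f P ∪ relabel f Q :=
  Finset.image_union _ _

lemma endpoints_relabel : endpoints (relabel f C) = f '' endpoints C := by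
  ext q
  constructor
  · rintro ⟨d, hd, hq⟩
    obtain ⟨c, hc, rfl⟩ := mem_relabel.1 hd
    rcases hq with rfl | rfl
    · exact ⟨c.1, source_mem hc, rfl⟩
    · exact ⟨c.2, sink_mem hc, rfl⟩
  · rintro ⟨q, ⟨c, hc, rfl | rfl⟩, rfl⟩
    · exact source_mem (map_mem_relabel hc)
    · exact sink_mem (map_mem_relabel hc)

lemma relabel_congr {g : ℕ → ℕ} (h : Set.EqOn f g (endpoints C)) : relabel f C = relabel g C := by
  refine Finset.image_congr fun c hc => ?_
  exact Prod.ext (h (source_mem hc)) (h (sink_mem hc))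

section Mono

variable (hf : StrictMonoOn f (endpoints C))

include hf

lemma rightNbr_relabel_iff {c d : ℕ × ℕ} (hc : c ∈ C) (hd : d ∈ C) :
    RightNbr (f c.1, f c.2) (f d.1, f d.2) ↔ RightNbr c d :=
  and_congr (hf.lt_iff_lt (source_mem hc) (source_mem hd))
    (and_congr (hf.lt_iff_lt (source_mem hd) (sink_mem hc))
      (hf.lt_iff_lt (sink_mem hc) (sink_mem hd)))

lemma cross_relabel_iff {c d : ℕ × ℕ} (hc : c ∈ C) (hd : d ∈ C) :
    Cross (f c.1, f c.2) (f d.1, f d.2) ↔ Cross c d :=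
  or_congr (rightNbr_relabel_iff hf hc hd) (rightNbr_relabel_iff hf hd hc)

lemma relabel_inj {c d : ℕ × ℕ} (hc : c ∈ C) (hd : d ∈ C)
    (h : ((f c.1, f c.2) : ℕ × ℕ) = (f d.1, f d.2)) : c = d := by
  rw [Prod.mk.injEq] at h
  exact Prod.ext (hf.injOn (source_mem hc) (source_mem hd) h.1)
    (hf.injOn (sink_mem hc) (sink_mem hd) h.2)

lemma IsSystem.relabel (hC : IsSystem C) : IsSystem (relabel f C) where
  lt d hd := by
    obtain ⟨c, hc, rfl⟩ := mem_relabel.1 hd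
    exact hf (source_mem hc) (sink_mem hc) (hC.lt c hc)
  source_inj d hd d' hd' h := by
    obtain ⟨c, hc, rfl⟩ := mem_relabel.1 hd
    obtain ⟨c', hc', rfl⟩ := mem_relabel.1 hd'
    rw [hC.source_inj c hc c' hc' (hf.injOn (source_mem hc) (source_mem hc') h)]
  sink_inj d hd d' hd' h := by
    obtain ⟨c, hc, rfl⟩ := mem_relabel.1 hd
    obtain ⟨c', hc', rfl⟩ := mem_relabel.1 hd'
    rw [hC.sink_inj c hc c' hc' (hf.injOn (sink_mem hc) (sink_mem hc') h)]
  source_ne_sink d hd d' hd' h := by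
    obtain ⟨c, hc, rfl⟩ := mem_relabel.1 hd
    obtain ⟨c', hc', rfl⟩ := mem_relabel.1 hd'
    exact hC.source_ne_sink c hc c' hc' (hf.injOn (source_mem hc) (sink_mem hc') h)

lemma Linked.relabel (hC : Linked C) : Linked (relabel f C) where
  nonempty := hC.nonempty.image _
  eq_of_isolated P hP hne hiso := by
    have h := hC.eq_of_isolated (C.filter fun c => (f c.1, f c.2) ∈ P) (Finset.filter_subset _ _)
      ?_ ?_
    · refine Finset.Subset.antisymm hP fun d hd => ?_
      obtain ⟨c, hc, rfl⟩ := mem_relabel.1 hd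
      have hc' := hc
      rw [← h] at hc'
      exact (Finset.mem_filter.1 hc').2
    · obtain ⟨d, hd⟩ := hne
      obtain ⟨c, hc, rfl⟩ := mem_relabel.1 (hP hd)
      exact ⟨c, Finset.mem_filter.2 ⟨hc, hd⟩⟩
    · intro c hc d hd hdn k
      rw [Finset.mem_filter] at hc hdn
      exact hiso _ hc.2 _ (map_mem_relabel hd) (fun e => hdn ⟨hd, e⟩)
        ((cross_relabel_iff hf hc.1 hd).2 k)

omit hf in
lemma exists_uncovered_endpoint {q s t : ℕ} (hq : q ∈ endpoints C)
    (h : ∃ w, q ≤ w ∧ w ≤ t ∧ Uncovered C s w) :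
    ∃ w ∈ endpoints C, q ≤ w ∧ w ≤ t ∧ Uncovered C s w := by
  obtain ⟨w, h1, h2, h3⟩ := h
  obtain ⟨w', ⟨k1, k2⟩, hmax⟩ := Set.exists_max_image {r | r ∈ endpoints C ∧ r ≤ w} id
    ((endpoints_finite C).subset fun r hr => hr.1) ⟨q, hq, h1⟩
  refine ⟨w', k1, hmax q ⟨hq, h1⟩, k2.trans h2, fun d hd j1 j2 => ?_⟩
  exact hmax d.2 ⟨sink_mem hd, h3 d hd j1 (j2.trans k2)⟩

lemma uncovered_relabel_iff {s w : ℕ} (hs : s ∈ endpoints C) (hw : w ∈ endpoints C) :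
    Uncovered (relabel f C) (f s) (f w) ↔ Uncovered C s w := by
  constructor
  · intro h d hd h1 h2
    exact (hf.le_iff_le (sink_mem hd) hw).1 (h _ (map_mem_relabel hd)
      (hf hs (source_mem hd) h1) ((hf.le_iff_le (source_mem hd) hw).2 h2))
  · intro h d hd h1 h2
    obtain ⟨c, hc, rfl⟩ := mem_relabel.1 hd
    exact (hf.le_iff_le (sink_mem hc) hw).2 (h c hc
      ((hf.lt_iff_lt hs (source_mem hc)).1 h1) ((hf.le_iff_le (source_mem hc) hw).1 h2))

lemma exists_uncovered_relabel_iff {q s t : ℕ} (hq : q ∈ endpoints C) (hs : s ∈ endpoints C)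
    (ht : t ∈ endpoints C) :
    (∃ w, f q ≤ w ∧ w ≤ f t ∧ Uncovered (relabel f C) (f s) w) ↔
      ∃ w, q ≤ w ∧ w ≤ t ∧ Uncovered C s w := by
  constructor
  · intro h
    obtain ⟨w, hw, h1, h2, h3⟩ := exists_uncovered_endpoint
      (endpoints_relabel (f := f) ▸ Set.mem_image_of_mem f hq) h
    rw [endpoints_relabel] at hw
    obtain ⟨w, hw, rfl⟩ := hw
    exact ⟨w, (hf.le_iff_le hq hw).1 h1, (hf.le_iff_le hw ht).1 h2,
      (uncovered_relabel_iff hf hs hw).1 h3⟩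
  · intro h
    obtain ⟨w, hw, h1, h2, h3⟩ := exists_uncovered_endpoint hq h
    exact ⟨f w, (hf.le_iff_le hq hw).2 h1, (hf.le_iff_le hw ht).2 h2,
      (uncovered_relabel_iff hf hs hw).2 h3⟩

lemma goodGap_relabel_iff {q : ℕ} (hq : q ∈ endpoints C) :
    GoodGap (relabel f C) (f q) ↔ GoodGap C q := by
  constructor
  · intro h e he h1 h2
    exact (exists_uncovered_relabel_iff hf hq (source_mem he) (sink_mem he)).1
      (h _ (map_mem_relabel he) ((hf.le_iff_le (source_mem he) hq).2 h1) (hf hq (sink_mem he) h2))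
  · intro h d hd h1 h2
    obtain ⟨e, he, rfl⟩ := mem_relabel.1 hd
    exact (exists_uncovered_relabel_iff hf hq (source_mem he) (sink_mem he)).2
      (h e he ((hf.le_iff_le (source_mem he) hq).1 h1) ((hf.lt_iff_lt hq (sink_mem he)).1 h2))

lemma CycleFree.relabel (h : CycleFree C) : CycleFree (relabel f C) := by
  intro c' hc' e' he' hce
  obtain ⟨c, hc, rfl⟩ := mem_relabel.1 hc'
  obtain ⟨e, he, rfl⟩ := mem_relabel.1 he'
  exact (exists_uncovered_relabel_iff hf (sink_mem hc) (source_mem he) (sink_mem he)).2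
    (h c hc e he ((rightNbr_relabel_iff hf hc he).1 hce))

lemma rightGaps_relabel {y y' : ℕ} (h : ∀ q ∈ endpoints C, y < q ↔ y' < f q) :
    rightGaps (relabel f C) y' = rightGaps C y := by
  have e : {q | q ∈ endpoints (relabel f C) ∧ y' < q ∧ GoodGap (relabel f C) q} =
      f '' {q | q ∈ endpoints C ∧ y < q ∧ GoodGap C q} := by
    ext q
    constructor
    · rintro ⟨h1, h2, h3⟩
      rw [endpoints_relabel] at h1
      obtain ⟨q, hq, rfl⟩ := h1
      exact ⟨q, ⟨hq, (h q hq).2 h2, (goodGap_relabel_iff hf hq).1 h3⟩, rfl⟩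
    · rintro ⟨q, ⟨hq, h2, h3⟩, rfl⟩
      exact ⟨endpoints_relabel (f := f) ▸ Set.mem_image_of_mem f hq, (h q hq).1 h2,
        (goodGap_relabel_iff hf hq).2 h3⟩
  rw [rightGaps, e, Set.InjOn.ncard_image (hf.injOn.mono fun q hq => hq.1)]
  rfl

lemma Split.relabel {ρ : ℕ × ℕ} {B A : Finset (ℕ × ℕ)} (D : Split C ρ B A) :
    Split (relabel f C) (f ρ.1, f ρ.2) (relabel f B) (relabel f A) where
  sys := D.sys.relabel hf
  linked := D.linked.relabel hf
  union := by rw [← relabel_union, D.union]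
  disj := by
    rw [Finset.disjoint_left]
    intro d hd hd'
    obtain ⟨b, hb, rfl⟩ := mem_relabel.1 hd
    obtain ⟨a, ha, e⟩ := mem_relabel.1 hd'
    exact D.not_mem_both hb (relabel_inj hf (D.mem_right ha) (D.mem_left hb) e ▸ ha)
  root_mem := map_mem_relabel D.root_mem
  root_lt d hd hne := by
    obtain ⟨c, hc, rfl⟩ := mem_relabel.1 hd
    refine hf (source_mem (D.mem_right D.root_mem)) (source_mem hc) (D.root_lt c hc ?_)
    rintro rfl
    exact hne rfl
  linked_left := D.linked_left.relabel (hf.mono (endpoints_mono D.subset_left))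
  first := by
    obtain ⟨b, hb, hmin⟩ := D.first
    refine ⟨_, map_mem_relabel hb, fun d hd hne => ?_⟩
    obtain ⟨c, hc, rfl⟩ := mem_relabel.1 hd
    refine (hf.le_iff_le (source_mem (D.mem_left hb)) (source_mem hc)).2 (hmin c hc ?_)
    rintro rfl
    exact hne rfl
  not_cross d hd d' hd' hne k := by
    obtain ⟨b, hb, rfl⟩ := mem_relabel.1 hd
    obtain ⟨a, ha, rfl⟩ := mem_relabel.1 hd'
    refine D.not_cross b hb a ha ?_ ((cross_relabel_iff hf (D.mem_left hb) (D.mem_right ha)).1 k)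
    rintro rfl
    exact hne rfl

end Mono

lemma HasCode.relabel {c : Code} (h : HasCode C c) (hf : StrictMonoOn f (endpoints C)) :
    HasCode (relabel f C) c := by
  induction h with
  | @leaf C c hC h =>
    subst hC
    exact HasCode.leaf (c := (f c.1, f c.2)) (Finset.image_singleton _ _)
      (hf (source_mem (Finset.mem_singleton_self c)) (sink_mem (Finset.mem_singleton_self c)) h)
  | @node C B A ρ b a p D hp _ _ ihB ihA =>
    have hB := hf.mono (endpoints_mono D.subset_left)
    refine HasCode.node (D.relabel hf) ?_ (ihB hB) (ihA (hf.mono (endpoints_mono D.subset_right)))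
    rw [hp, rightGaps_relabel hB]
    exact fun q hq => (hf.lt_iff_lt (sink_mem (D.mem_right D.root_mem))
      (endpoints_mono D.subset_left hq)).symm

/-- An upper part of a set `E` of points is determined by the number of points of `G` in it, if it
ends immediately after a point of `G`. -/
lemma upper_subset {E G : Set ℕ} (hE : E.Finite) {U V : ℕ → Prop}
    (hU : ∀ a ∈ E, ∀ b ∈ E, a ≤ b → U a → U b)
    (hV : ∀ a ∈ E, ∀ b ∈ E, a ≤ b → V a → V b)
    (hG : ∀ b ∈ E, ¬ V b → ∃ w ∈ E, b ≤ w ∧ w ∈ G ∧ ¬ V w)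
    (hcard : {q | q ∈ E ∧ U q ∧ q ∈ G}.ncard ≤ {q | q ∈ E ∧ V q ∧ q ∈ G}.ncard) :
    ∀ b ∈ E, U b → V b := by
  intro b hb hUb
  by_contra hVb
  obtain ⟨w, hw, hbw, hwG, hVw⟩ := hG b hb hVb
  have hUw := hU b hb w hw hbw hUb
  refine absurd (Set.ncard_lt_ncard ⟨fun q hq => ?_, fun hs => ?_⟩
    (hE.subset fun q hq => hq.1)) (not_lt.2 hcard)
  · refine ⟨hq.1, hU w hw q hq.1 ?_ hUw, hq.2.2⟩
    by_contra hlt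
    exact hVw (hV q hq.1 w hw (by omega) hq.2.1)
  · exact hVw (hs ⟨hw, hUw, hwG⟩).2.1

lemma exists_goodGap_le {q y : ℕ} (hy : GoodGap C y) (hq : q ∈ endpoints C) (hqy : q ≤ y) :
    ∃ w ∈ endpoints C, q ≤ w ∧ GoodGap C w ∧ w ≤ y := by
  obtain ⟨w, ⟨k1, k2⟩, hmax⟩ := Set.exists_max_image {r | r ∈ endpoints C ∧ r ≤ y} id
    ((endpoints_finite C).subset fun r hr => hr.1) ⟨q, hq, hqy⟩
  refine ⟨w, k1, hmax q ⟨hq, hqy⟩, hy.congr fun r hr => ?_, k2⟩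
  constructor
  · omega
  · intro hlt
    by_contra k
    have : r ≤ w := hmax r ⟨hr, by omega⟩
    omega

/-- Two top-cycle-free systems with the same code differ only by a relabelling. -/
lemma HasCode.exists_relabel {c : Code} (h : HasCode C c) (hC : CycleFree C)
    {C' : Finset (ℕ × ℕ)} (h' : HasCode C' c) (hC' : CycleFree C') :
    ∃ f : ℕ → ℕ, StrictMonoOn f (endpoints C) ∧ ChordDiagram.relabel f C = C' := by
  classical
  induction h generalizing C' with
  | @leaf C c hc h =>
    cases h' with
    | @leaf _ c' hc' h' =>
    subst hc hc'
    refine ⟨fun q => if q ≤ c.1 then c'.1 else c'.2, ?_, ?_⟩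
    · rintro x ⟨d, hd, hx⟩ y ⟨d', hd', hy⟩ hxy
      rw [Finset.mem_singleton] at hd hd'
      subst hd hd'
      change (if _ then _ else _) < (if _ then _ else _)
      rw [if_pos (by omega), if_neg (by omega)]
      exact h'
    · refine (Finset.image_singleton _ _).trans ?_
      rw [Prod.map, if_pos le_rfl, if_neg (by omega)]
  | @node C B A ρ b a p D hp hB hA ihB ihA =>
    cases h' with
    | @node _ B' A' ρ' _ _ _ D' hp' hB' hA' =>
    have hs := D.cycleFree_iff.1 hC
    have hs' := D'.cycleFree_iff.1 hC'
    obtain ⟨g, hg, hgB⟩ := ihB hs.1.1 hB' hs'.1.1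
    obtain ⟨k, hk, hkA⟩ := ihA hs.2 hA' hs'.2
    -- The root is mapped to the root.
    have hρ : (k ρ.1, k ρ.2) = ρ' := by
      obtain ⟨c, hc, hcρ⟩ := mem_relabel.1 (hkA.symm ▸ D'.root_mem : ρ' ∈ ChordDiagram.relabel k A)
      by_cases e : c = ρ
      · rw [← e, hcρ]
      · by_contra hne
        have h1 := hk (source_mem D.root_mem) (source_mem hc) (D.root_lt c (D.mem_right hc) e)
        have h2 := D'.root_lt _ (D'.mem_right (hkA ▸ map_mem_relabel D.root_mem)) hne
        rw [← hcρ] at h2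
        exact absurd h1 (not_lt.2 h2.le)
    -- The gaps of `B` that contain the end of the root correspond to each other.
    have hgB_mem : ∀ q ∈ endpoints B, g q ∈ endpoints B' := by
      intro q hq
      rw [← hgB, endpoints_relabel]
      exact Set.mem_image_of_mem g hq
    have hcount : {q | q ∈ endpoints B ∧ ρ.2 < q ∧ q ∈ {q | GoodGap B q}}.ncard =
        {q | q ∈ endpoints B ∧ ρ'.2 < g q ∧ q ∈ {q | GoodGap B q}}.ncard := by
      have e : {q | q ∈ endpoints B' ∧ ρ'.2 < q ∧ GoodGap B' q} =
          g '' {q | q ∈ endpoints B ∧ ρ'.2 < g q ∧ q ∈ {q | GoodGap B q}} := by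
        ext q
        constructor
        · rintro ⟨h1, h2, h3⟩
          rw [← hgB, endpoints_relabel] at h1
          obtain ⟨q, hq, rfl⟩ := h1
          rw [← hgB] at h3
          exact ⟨q, ⟨hq, h2, (goodGap_relabel_iff hg hq).1 h3⟩, rfl⟩
        · rintro ⟨q, ⟨hq, h2, h3⟩, rfl⟩
          refine ⟨hgB_mem q hq, h2, ?_⟩
          rw [← hgB]
          exact (goodGap_relabel_iff hg hq).2 h3
      have hinj : Set.InjOn g {q | q ∈ endpoints B ∧ ρ'.2 < g q ∧ q ∈ {q | GoodGap B q}} :=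
        hg.injOn.mono fun q hq => hq.1
      have h2 := hinj.ncard_image
      rw [← e] at h2
      exact (hp.symm.trans hp').trans h2
    have hup : ∀ a ∈ endpoints B, ∀ b ∈ endpoints B, a ≤ b → ρ'.2 < g a → ρ'.2 < g b :=
      fun a ha b hb hab hlt => hlt.trans_le ((hg.le_iff_le ha hb).2 hab)
    have hgap : ∀ q ∈ endpoints B, ρ.2 < q ↔ ρ'.2 < g q := by
      intro q hq
      constructor
      · refine upper_subset (G := {q | GoodGap B q}) (endpoints_finite B) (U := fun q => ρ.2 < q)
          (V := fun q => ρ'.2 < g q) (fun a _ b _ hab hlt => lt_of_lt_of_le hlt hab) hup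
          (fun b hb hVb => ?_) hcount.le q hq
        obtain ⟨w, hw, h1, h2, h3⟩ := exists_goodGap_le hs'.1.2 (hgB_mem b hb) (not_lt.1 hVb)
        rw [← hgB, endpoints_relabel] at hw
        obtain ⟨w, hw, rfl⟩ := hw
        rw [← hgB] at h2
        exact ⟨w, hw, (hg.le_iff_le hb hw).1 h1, (goodGap_relabel_iff hg hw).1 h2, not_lt.2 h3⟩
      · refine upper_subset (G := {q | GoodGap B q}) (endpoints_finite B)
          (U := fun q => ρ'.2 < g q) (V := fun q => ρ.2 < q) hup
          (fun a _ b _ hab hlt => lt_of_lt_of_le hlt hab) (fun b hb hVb => ?_) hcount.ge q hq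
        obtain ⟨w, hw, h1, h2, h3⟩ := exists_goodGap_le hs.1.2 hb (not_lt.1 hVb)
        exact ⟨w, hw, h1, h2, not_lt.2 h3⟩
    -- The relabellings of the two parts fit together.
    have hkA_mem : ∀ q ∈ endpoints A, k q ∈ endpoints A' := by
      intro q hq
      rw [← hkA, endpoints_relabel]
      exact Set.mem_image_of_mem k hq
    have hcmp : ∀ q ∈ endpoints A, ∀ r ∈ endpoints B, q < r ↔ k q < g r := by
      rintro q ⟨c, hc, hq⟩ r hr
      have hr' := hgB_mem r hr
      have hρr : ρ.1 < r := by
        obtain ⟨d, hd, k⟩ := hr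
        have := D.root_lt_left hd
        have := D.sys.lt d (D.mem_left hd)
        omega
      have hρr' : ρ'.1 < g r := by
        obtain ⟨d, hd, k⟩ := hr'
        have := D'.root_lt_left hd
        have := D'.sys.lt d (D'.mem_left hd)
        omega
      have hgr := hgap r hr
      by_cases e : c = ρ
      · subst e
        rcases hq with rfl | rfl
        · rw [← hρ] at hρr'
          exact iff_of_true hρr hρr'
        · rw [hgr, ← hρ]
      · have h1 := D.lt_iff hc e hr hq
        have hne : (k c.1, k c.2) ≠ ρ' := by
          rw [← hρ]
          exact fun k' => e (relabel_inj hk hc D.root_mem k')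
        have h2 := D'.lt_iff (a := (k c.1, k c.2)) (hkA ▸ map_mem_relabel hc) hne hr'
          (r := k q) (by rcases hq with rfl | rfl <;> simp)
        rw [h1, h2, hgr]
    let f : ℕ → ℕ := fun q => if q ∈ endpoints B then g q else k q
    have fB : Set.EqOn f g (endpoints B) := fun q hq => if_pos hq
    have fA : Set.EqOn f k (endpoints A) := fun q hq =>
      if_neg fun hq' => D.endpoints_disjoint hq' hq
    refine ⟨f, ?_, ?_⟩
    · intro x hx y hy hxy
      rw [D.endpoints_eq] at hx hy
      rcases hx with hx | hx <;> rcases hy with hy | hy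
      · rw [fB hx, fB hy]
        exact hg hx hy hxy
      · rw [fB hx, fA hy]
        refine lt_of_le_of_ne (not_lt.1 fun hlt => ?_) fun e => ?_
        · exact absurd ((hcmp y hy x hx).2 hlt) (not_lt.2 hxy.le)
        · exact D'.endpoints_disjoint (hgB_mem x hx) (e ▸ hkA_mem y hy)
      · rw [fA hx, fB hy]
        exact (hcmp x hx y hy).1 hxy
      · rw [fA hx, fA hy]
        exact hk hx hy hxy
    · rw [← D.union, relabel_union, relabel_congr fB, relabel_congr fA, hgB, hkA, D'.union]

end ChordDiagram

/-! ### Construction of a system with a given code -/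

namespace ChordDiagram

variable {C B A : Finset (ℕ × ℕ)} {f : ℕ → ℕ}

lemma Linked.union (hB : Linked B) (hA : Linked A) (h : ∃ b ∈ B, ∃ a ∈ A, Cross b a) :
    Linked (B ∪ A) where
  nonempty := hB.nonempty.mono Finset.subset_union_left
  eq_of_isolated P hP hne hiso := by
    classical
    have key : ∀ Q ⊆ B ∪ A, Linked Q → (P ∩ Q).Nonempty → Q ⊆ P := by
      intro Q hQ hl hPQ
      have := hl.eq_of_isolated (P ∩ Q) Finset.inter_subset_right hPQ ?_
      · exact Finset.inter_eq_right.1 this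
      · intro c hc d hd hdn k
        exact hiso c (Finset.mem_inter.1 hc).1 d (hQ hd)
          (fun hdP => hdn (Finset.mem_inter.2 ⟨hdP, hd⟩)) k
    have keyB := key B Finset.subset_union_left hB
    have keyA := key A Finset.subset_union_right hA
    obtain ⟨b, hb, a, ha, hba⟩ := h
    have hBA : B ⊆ P ∧ A ⊆ P := by
      obtain ⟨c, hc⟩ := hne
      rcases Finset.mem_union.1 (hP hc) with k | k
      · have h1 := keyB ⟨c, Finset.mem_inter.2 ⟨hc, k⟩⟩
        refine ⟨h1, keyA ⟨a, Finset.mem_inter.2 ⟨?_, ha⟩⟩⟩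
        by_contra haP
        exact hiso b (h1 hb) a (Finset.mem_union_right _ ha) haP hba
      · have h1 := keyA ⟨c, Finset.mem_inter.2 ⟨hc, k⟩⟩
        refine ⟨keyB ⟨b, Finset.mem_inter.2 ⟨?_, hb⟩⟩, h1⟩
        by_contra hbP
        exact hiso a (h1 ha) b (Finset.mem_union_left _ hb) hbP hba.symm
    exact Finset.Subset.antisymm hP (Finset.union_subset hBA.1 hBA.2)

lemma IsSystem.union (hB : IsSystem B) (hA : IsSystem A)
    (h : ∀ q ∈ endpoints B, q ∉ endpoints A) : IsSystem (B ∪ A) where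
  lt c hc := (Finset.mem_union.1 hc).elim (hB.lt c) (hA.lt c)
  source_inj c hc d hd e := by
    rcases Finset.mem_union.1 hc with hc | hc <;> rcases Finset.mem_union.1 hd with hd | hd
    · exact hB.source_inj c hc d hd e
    · exact (h _ (source_mem hc) (e ▸ source_mem hd)).elim
    · exact (h _ (source_mem hd) (e ▸ source_mem hc)).elim
    · exact hA.source_inj c hc d hd e
  sink_inj c hc d hd e := by
    rcases Finset.mem_union.1 hc with hc | hc <;> rcases Finset.mem_union.1 hd with hd | hd
    · exact hB.sink_inj c hc d hd e
    · exact (h _ (sink_mem hc) (e ▸ sink_mem hd)).elim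
    · exact (h _ (sink_mem hd) (e ▸ sink_mem hc)).elim
    · exact hA.sink_inj c hc d hd e
  source_ne_sink c hc d hd e := by
    rcases Finset.mem_union.1 hc with hc | hc <;> rcases Finset.mem_union.1 hd with hd | hd
    · exact hB.source_ne_sink c hc d hd e
    · exact h _ (source_mem hc) (e ▸ sink_mem hd)
    · exact h _ (sink_mem hd) (e ▸ source_mem hc)
    · exact hA.source_ne_sink c hc d hd e

/-- Two connected systems are combined by putting all end points of `A` except for the first one
into the gap `(l, r)` of `B`, and the first one to the left of `B`. -/
lemma Split.of_gap {ρ : ℕ × ℕ} {l r : ℕ} (hB : IsSystem B) (hA : IsSystem A) (lB : Linked B)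
    (lA : Linked A) (hρ : ρ ∈ A) (hBq : ∀ q ∈ endpoints B, ρ.1 < q ∧ (q ≤ l ∨ r ≤ q))
    (hAs : ∀ a ∈ A, a ≠ ρ → l < a.1) (hAt : ∀ a ∈ A, l < a.2 ∧ a.2 < r)
    (h1 : ∃ q ∈ endpoints B, q ≤ l) (h2 : ∃ q ∈ endpoints B, r ≤ q) :
    Split (B ∪ A) ρ B A := by
  have hρt := hAt ρ hρ
  have hdis : ∀ q ∈ endpoints B, q ∉ endpoints A := by
    rintro q hq ⟨a, ha, hqa⟩
    have e1 := hBq q hq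
    have e2 := hAt a ha
    have e3 := hA.lt a ha
    by_cases e : a = ρ
    · subst e
      omega
    · have := hAs a ha e
      omega
  have hs := hB.union hA hdis
  have hdisj : Disjoint B A := by
    rw [Finset.disjoint_left]
    exact fun c hc hc' => hdis _ (source_mem hc) (source_mem hc')
  obtain ⟨b₁, hb₁, hb₁l⟩ : ∃ b ∈ B, b.1 ≤ l := by
    obtain ⟨q, ⟨b, hb, hqb⟩, hq⟩ := h1
    have := hB.lt b hb
    exact ⟨b, hb, by omega⟩
  obtain ⟨b₂, hb₂, hb₂r⟩ : ∃ b ∈ B, r ≤ b.2 := by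
    obtain ⟨q, ⟨b, hb, hqb⟩, hq⟩ := h2
    have := hB.lt b hb
    exact ⟨b, hb, by omega⟩
  obtain ⟨d, hd, hdl, hdr⟩ := lB.exists_cover hB hb₁ hb₁l hb₂ (by omega : l < b₂.2)
  have hl : ρ.1 < l := (hBq _ (source_mem hb₁)).1.trans_le hb₁l
  refine ⟨hs, lB.union lA ⟨d, hd, ρ, hρ, Or.inr ⟨(hBq _ (source_mem hd)).1, by omega, ?_⟩⟩, rfl,
    hdisj, hρ, fun c hc hne => ?_, lB, ?_, fun b hb a ha hne k => ?_⟩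
  · have := hBq _ (sink_mem hd)
    omega
  · rcases Finset.mem_union.1 hc with k | k
    · exact (hBq _ (source_mem k)).1
    · exact hl.trans (hAs c k hne)
  · obtain ⟨b, hb, hmin⟩ := B.exists_min_image Prod.fst lB.nonempty
    refine ⟨b, hb, fun c hc hne => ?_⟩
    rcases Finset.mem_union.1 hc with k | k
    · exact hmin c k
    · exact ((hmin b₁ hb₁).trans hb₁l).trans (hAs c k hne).le
  · have e1 := hBq _ (source_mem hb)
    have e2 := hBq _ (sink_mem hb)
    have e3 := hAs a ha hne
    have e4 := hAt a ha
    have e5 := hA.lt a ha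
    unfold Cross RightNbr at k
    omega

lemma exists_card_filter_lt_eq (T : Finset ℕ) {p : ℕ} (hp : p < T.card) :
    ∃ u ∈ T, (T.filter fun q => u < q).card = p := by
  induction T using Finset.induction_on_min with
  | empty => simp at hp
  | insert a s ha ih =>
    have has : a ∉ s := fun h => lt_irrefl _ (ha a h)
    rw [Finset.card_insert_of_notMem has] at hp
    by_cases h : p < s.card
    · obtain ⟨u, hu, hc⟩ := ih h
      refine ⟨u, Finset.mem_insert_of_mem hu, ?_⟩
      rw [Finset.filter_insert, if_neg (ha u hu).le.not_gt, hc]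
    · refine ⟨a, Finset.mem_insert_self _ _, ?_⟩
      rw [Finset.filter_insert, if_neg (lt_irrefl _), Finset.filter_true_of_mem ha]
      omega

/-- Every number of good gaps up to the width occurs to the right of some good gap: the first gap is
good, too. -/
lemma exists_rightGaps_eq (hC : C.Nonempty) {p : ℕ} (hp : p ≤ width C) :
    ∃ u ∈ endpoints C, GoodGap C u ∧ rightGaps C u = p := by
  classical
  have hfin : {q | q ∈ endpoints C ∧ GoodGap C q}.Finite :=
    (endpoints_finite C).subset fun q h => h.1
  obtain ⟨m, hm, hmin⟩ := C.exists_min_image Prod.fst hC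
  have hgm : GoodGap C m.1 := by
    intro e he _ h2
    refine ⟨m.1, le_rfl, h2.le, fun d _ k1 k2 => ?_⟩
    have := hmin e he
    omega
  have hlt : width C < hfin.toFinset.card := by
    rw [width, ← Set.ncard_eq_toFinset_card _ hfin]
    refine Set.ncard_lt_ncard ⟨fun q hq => ⟨hq.1, hq.2.2⟩, fun h => ?_⟩ hfin
    obtain ⟨c, hc, hcm⟩ := (h ⟨source_mem hm, hgm⟩).2.1
    exact absurd hcm (not_lt.2 (hmin c hc))
  obtain ⟨u, hu, hc⟩ := exists_card_filter_lt_eq hfin.toFinset (hp.trans_lt hlt)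
  rw [Set.Finite.mem_toFinset] at hu
  refine ⟨u, hu.1, hu.2, ?_⟩
  rw [rightGaps, ← hc, ← Set.ncard_coe_finset]
  congr 1
  ext q
  simp only [Finset.coe_filter, Set.Finite.mem_toFinset, Set.mem_ofPred_eq]
  tauto

/-- Every valid code describes a top-cycle-free system. -/
lemma exists_cycleFree_hasCode {c : Code} (hc : c.Valid) : ∃ C, CycleFree C ∧ HasCode C c := by
  classical
  induction c with
  | leaf =>
    refine ⟨{(0, 1)}, fun c hc e he k => ?_, HasCode.leaf (c := (0, 1)) rfl one_pos⟩
    rw [Finset.mem_singleton.1 hc, Finset.mem_singleton.1 he] at k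
    exact absurd k.1 (lt_irrefl _)
  | node b a p ihb iha =>
    obtain ⟨vb, va, hp1, hp⟩ := hc
    obtain ⟨B, hB, hBb⟩ := ihb vb
    obtain ⟨A, hA, hAa⟩ := iha va
    rw [(hBb.spec hB).2.1] at hp
    obtain ⟨u, hu, hgu, hup⟩ := exists_rightGaps_eq hBb.linked.nonempty hp
    obtain ⟨ρ, hρ, hmin⟩ := A.exists_min_image Prod.fst hAa.linked.nonempty
    obtain ⟨s, hs⟩ := (endpoints_finite A).bddAbove
    have hs : ∀ q ∈ endpoints A, q ≤ s := fun q hq => hs hq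
    obtain ⟨q₀, hq₀, huq₀⟩ : ∃ q ∈ endpoints B, u < q := by
      by_contra! hcon
      have : {q | q ∈ endpoints B ∧ u < q ∧ GoodGap B q} = ∅ :=
        Set.eq_empty_of_forall_notMem fun q hq => absurd hq.2.1 (not_lt.2 (hcon q hq.1))
      rw [rightGaps, this, Set.ncard_empty] at hup
      omega
    -- `B` is torn apart at the good gap after `u`, and `A` is inserted there.
    obtain ⟨fB, hfB⟩ : ∃ fB : ℕ → ℕ, ∀ q, fB q = if q ≤ u then q + 1 else q + (s + 1) :=
      ⟨_, fun _ => rfl⟩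
    obtain ⟨fA, hfA⟩ : ∃ fA : ℕ → ℕ, ∀ q, fA q = if q = ρ.1 then 0 else q + u + 1 :=
      ⟨_, fun _ => rfl⟩
    have hfB_low : ∀ q, q ≤ u → fB q = q + 1 := fun q h => by rw [hfB, if_pos h]
    have hfB_high : ∀ q, u < q → fB q = q + (s + 1) := fun q h => by
      rw [hfB, if_neg (not_le.2 h)]
    have hfA_root : fA ρ.1 = 0 := by rw [hfA, if_pos rfl]
    have hfA_other : ∀ q, q ≠ ρ.1 → fA q = q + u + 1 := fun q h => by rw [hfA, if_neg h]
    have mB : StrictMonoOn fB (endpoints B) := by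
      intro x _ y _ hxy
      rcases le_or_gt x u with h | h <;> rcases le_or_gt y u with k | k
      · rw [hfB_low x h, hfB_low y k]; omega
      · rw [hfB_low x h, hfB_high y k]; omega
      · omega
      · rw [hfB_high x h, hfB_high y k]; omega
    have hmin' : ∀ q ∈ endpoints A, ρ.1 ≤ q := by
      rintro q ⟨a, ha, hq⟩
      have := hmin a ha
      have := hAa.isSystem.lt a ha
      omega
    have mA : StrictMonoOn fA (endpoints A) := by
      intro x hx y _ hxy
      have := hmin' x hx
      rw [hfA_other y (by omega)]
      by_cases h : x = ρ.1
      · rw [h, hfA_root]; omega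
      · rw [hfA_other x h]; omega
    have hsink : ∀ a ∈ A, fA a.2 = a.2 + u + 1 := fun a ha => hfA_other _ fun e =>
      hAa.isSystem.source_ne_sink ρ hρ a ha e.symm
    have D : Split (relabel fB B ∪ relabel fA A) (fA ρ.1, fA ρ.2) (relabel fB B)
        (relabel fA A) := by
      refine Split.of_gap (l := u + 1) (r := u + s + 2) (hBb.isSystem.relabel mB)
        (hAa.isSystem.relabel mA) (hBb.linked.relabel mB) (hAa.linked.relabel mA)
        (map_mem_relabel hρ) ?_ ?_ ?_ ?_ ?_
      · intro q hq
        rw [endpoints_relabel] at hq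
        obtain ⟨q, -, rfl⟩ := hq
        rw [hfA_root]
        rcases le_or_gt q u with h | h
        · rw [hfB_low q h]; omega
        · rw [hfB_high q h]; omega
      · intro d hd hne
        obtain ⟨a, ha, rfl⟩ := mem_relabel.1 hd
        have : a.1 ≠ ρ.1 := by
          intro e
          rw [hAa.isSystem.source_inj a ha ρ hρ e] at hne
          exact hne rfl
        have := hmin a ha
        change u + 1 < fA a.1
        rw [hfA_other _ (by omega)]
        omega
      · intro d hd
        obtain ⟨a, ha, rfl⟩ := mem_relabel.1 hd
        have := hs _ (sink_mem ha)
        have := hAa.isSystem.lt a ha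
        change u + 1 < fA a.2 ∧ fA a.2 < _
        rw [hsink a ha]
        omega
      · refine ⟨fB u, ?_, (hfB_low u le_rfl).le⟩
        rw [endpoints_relabel]
        exact Set.mem_image_of_mem _ hu
      · refine ⟨fB q₀, ?_, ?_⟩
        · rw [endpoints_relabel]
          exact Set.mem_image_of_mem _ hq₀
        · rw [hfB_high q₀ huq₀]
          omega
    have hcmp : ∀ q ∈ endpoints B, u < q ↔ fA ρ.2 < fB q := by
      intro q _
      have := hs _ (sink_mem hρ)
      rw [hsink ρ hρ]
      rcases le_or_gt q u with h | h
      · rw [hfB_low q h]; omega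
      · rw [hfB_high q h]; omega
    refine ⟨_, D.cycleFree_iff.2 ⟨⟨hB.relabel mB, ?_⟩, hA.relabel mA⟩,
      HasCode.node D ?_ (hBb.relabel mB) (hAa.relabel mA)⟩
    · refine ((goodGap_relabel_iff mB hu).2 hgu).congr fun r hr => ?_
      rw [endpoints_relabel] at hr
      obtain ⟨q, hq, rfl⟩ := hr
      rw [← hcmp q hq, mB.lt_iff_lt hu hq]
    · rw [rightGaps_relabel mB hcmp, hup]

end ChordDiagram

/-! ### Chord diagrams as normalized systems -/

namespace ChordDiagram

variable {C : Finset (ℕ × ℕ)} {n : ℕ}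

lemma IsSystem.ncard_endpoints (hC : IsSystem C) : (endpoints C).ncard = 2 * C.card := by
  classical
  rw [endpoints_eq_coe, Set.ncard_coe_finset, Finset.card_union_of_disjoint,
    Finset.card_image_of_injOn,
    Finset.card_image_of_injOn, two_mul]
  · exact fun c hc d hd e => hC.sink_inj c hc d hd e
  · exact fun c hc d hd e => hC.source_inj c hc d hd e
  · rw [Finset.disjoint_left]
    intro q hq hq'
    obtain ⟨c, hc, rfl⟩ := Finset.mem_image.1 hq
    obtain ⟨d, hd, e⟩ := Finset.mem_image.1 hq'
    exact hC.source_ne_sink c hc d hd e.symm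

namespace IsDiagram

variable (h : IsDiagram n C)

include h

lemma eq_of_endpoint {c d : ℕ × ℕ} (hc : c ∈ C) (hd : d ∈ C) {k : ℕ} (hck : c.1 = k ∨ c.2 = k)
    (hdk : d.1 = k ∨ d.2 = k) : c = d := by
  have hk : k ∈ Set.Icc 1 (2 * n) := by
    rcases hck with rfl | rfl
    · exact (h.mem_Icc c hc).1
    · exact (h.mem_Icc c hc).2
  exact (h.matching k hk).unique ⟨hc, hck⟩ ⟨hd, hdk⟩

lemma isSystem : IsSystem C where
  lt := h.lt
  source_inj _ hc _ hd e := h.eq_of_endpoint hc hd (Or.inl rfl) (Or.inl e.symm)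
  sink_inj _ hc _ hd e := h.eq_of_endpoint hc hd (Or.inr rfl) (Or.inr e.symm)
  source_ne_sink c hc d hd e := by
    have k := h.eq_of_endpoint hc hd (Or.inl rfl) (Or.inr e.symm)
    subst k
    exact absurd e (h.lt c hc).ne

lemma endpoints_eq : endpoints C = Set.Icc 1 (2 * n) := by
  ext k
  constructor
  · rintro ⟨c, hc, rfl | rfl⟩
    · exact (h.mem_Icc c hc).1
    · exact (h.mem_Icc c hc).2
  · intro hk
    obtain ⟨c, hc, k1 | k1⟩ := (h.matching k hk).exists
    · exact ⟨c, hc, Or.inl k1.symm⟩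
    · exact ⟨c, hc, Or.inr k1.symm⟩

lemma card_eq : C.card = n := by
  have h1 := h.isSystem.ncard_endpoints
  rw [h.endpoints_eq, ← Finset.coe_Icc, Set.ncard_coe_finset, Nat.card_Icc] at h1
  omega

end IsDiagram

/-- Every system becomes a diagram when its end points are relabelled by their ranks. -/
lemma IsSystem.exists_isDiagram (hC : IsSystem C) :
    ∃ f : ℕ → ℕ, StrictMonoOn f (endpoints C) ∧ IsDiagram C.card (ChordDiagram.relabel f C) := by
  classical
  obtain ⟨E, hE⟩ : ∃ E : Finset ℕ, ∀ q, q ∈ E ↔ q ∈ endpoints C :=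
    ⟨(endpoints_finite C).toFinset, fun q => Set.Finite.mem_toFinset _⟩
  have hcard : E.card = 2 * C.card := by
    rw [← hC.ncard_endpoints, ← Set.ncard_coe_finset]
    congr 1
    ext q
    exact hE q
  obtain ⟨f, hf⟩ : ∃ f : ℕ → ℕ, ∀ q, f q = (E.filter fun r => r ≤ q).card := ⟨_, fun _ => rfl⟩
  have mf : StrictMonoOn f (endpoints C) := by
    intro x _ y hy hxy
    rw [hf, hf]
    refine Finset.card_lt_card ⟨fun r hr => ?_, fun h => ?_⟩
    · rw [Finset.mem_filter] at hr ⊢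
      exact ⟨hr.1, hr.2.trans hxy.le⟩
    · have := h (Finset.mem_filter.2 ⟨(hE y).2 hy, le_rfl⟩)
      exact absurd (Finset.mem_filter.1 this).2 (not_le.2 hxy)
  have hmaps : ∀ q ∈ endpoints C, f q ∈ Finset.Icc 1 (2 * C.card) := by
    intro q hq
    rw [Finset.mem_Icc, hf, ← hcard]
    exact ⟨Finset.card_pos.2 ⟨q, Finset.mem_filter.2 ⟨(hE q).2 hq, le_rfl⟩⟩,
      Finset.card_le_card (Finset.filter_subset _ _)⟩
  have himage : E.image f = Finset.Icc 1 (2 * C.card) := by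
    refine Finset.eq_of_subset_of_card_le (Finset.image_subset_iff.2 fun q hq =>
      hmaps q ((hE q).1 hq)) ?_
    rw [Finset.card_image_of_injOn fun x hx y hy => mf.injOn ((hE x).1 hx) ((hE y).1 hy), hcard,
      Nat.card_Icc]
    omega
  have hs := hC.relabel mf
  refine ⟨f, mf, hs.lt, fun d hd => ?_, fun k hk => ?_⟩
  · obtain ⟨c, hc, rfl⟩ := mem_relabel.1 hd
    exact ⟨Finset.mem_Icc.1 (hmaps _ (source_mem hc)), Finset.mem_Icc.1 (hmaps _ (sink_mem hc))⟩
  · rw [← Finset.coe_Icc, Finset.mem_coe, ← himage] at hk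
    obtain ⟨q, hq, rfl⟩ := Finset.mem_image.1 hk
    obtain ⟨c, hc, hqc⟩ := (hE q).1 hq
    refine ⟨_, ⟨map_mem_relabel hc, ?_⟩, ?_⟩
    · rcases hqc with rfl | rfl
      · exact Or.inl rfl
      · exact Or.inr rfl
    · rintro d ⟨hd, hdq⟩
      refine hs.eq_of_endpoint hd (map_mem_relabel hc) (q := f q) ?_ ?_
      · rcases hdq with k | k
        · exact Or.inl k.symm
        · exact Or.inr k.symm
      · rcases hqc with rfl | rfl
        · exact Or.inl rfl
        · exact Or.inr rfl

/-- A strictly monotone map of `1, …, N` to itself is the identity. -/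
lemma eq_self_of_strictMonoOn_Icc {f : ℕ → ℕ} {N : ℕ} (hf : StrictMonoOn f (Set.Icc 1 N))
    (hmaps : ∀ x ∈ Set.Icc 1 N, f x ∈ Set.Icc 1 N) : Set.EqOn f id (Set.Icc 1 N) := by
  have h1 : ∀ x, 1 ≤ x → x ≤ N → x ≤ f x := by
    intro x hx
    induction x, hx using Nat.le_induction with
    | base => exact fun hN => (hmaps 1 ⟨le_rfl, hN⟩).1
    | succ x hx ih =>
      intro hN
      have := hf ⟨hx, by omega⟩ ⟨by omega, hN⟩ (Nat.lt_add_one x)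
      have := ih (by omega)
      omega
  have h2 : ∀ d x, x + d = N → 1 ≤ x → f x ≤ x := by
    intro d
    induction d with
    | zero => exact fun x hx h => (hmaps x ⟨h, by omega⟩).2.trans (by omega)
    | succ d ih =>
      intro x hx h
      have := ih (x + 1) (by omega) (by omega)
      have := hf ⟨h, by omega⟩ ⟨by omega, by omega⟩ (Nat.lt_add_one x)
      omega
  intro x hx
  obtain ⟨k1, k2⟩ := hx
  exact le_antisymm (h2 (N - x) x (by omega) k1) (h1 x k1 k2)

/-- A top-cycle-free diagram is determined by its code. -/
lemma IsDiagram.eq_of_hasCode {C' : Finset (ℕ × ℕ)} (h : IsDiagram n C) (h' : IsDiagram n C')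
    (hC : CycleFree C) (hC' : CycleFree C') {c : Code} (hc : HasCode C c) (hc' : HasCode C' c) :
    C = C' := by
  obtain ⟨f, hf, rfl⟩ := hc.exists_relabel hC hc' hC'
  have hmaps : ∀ x ∈ Set.Icc 1 (2 * n), f x ∈ Set.Icc 1 (2 * n) := by
    intro x hx
    rw [← h'.endpoints_eq, endpoints_relabel, h.endpoints_eq]
    exact Set.mem_image_of_mem f hx
  have hid := eq_self_of_strictMonoOn_Icc (h.endpoints_eq ▸ hf) hmaps
  rw [← h.endpoints_eq] at hid
  rw [relabel_congr hid, relabel, Prod.map_id, Finset.image_id]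

/-- The connected top-cycle-free diagrams correspond to the valid codes. -/
lemma exists_equiv_code (n i : ℕ) :
    Nonempty (TopCycleFreeDiagrams n i ≃ {c : Code // c.Valid ∧ c.size = n ∧ c.spine = i}) := by
  have hex : ∀ C : TopCycleFreeDiagrams n i, ∃ c, HasCode C.1 c := fun C =>
    exists_hasCode C.2.1.isSystem (connected_iff.1 C.2.2.1)
  have hfree : ∀ C : TopCycleFreeDiagrams n i, CycleFree C.1 := fun C =>
    (topCycleFree_iff C.2.1.isSystem).1 C.2.2.2.1
  choose code hcode using hex
  refine ⟨Equiv.ofBijective (fun C => ⟨code C, ?_⟩) ⟨fun C C' h => ?_, ?_⟩⟩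
  · obtain ⟨h1, -, h2, h3⟩ := (hcode C).spec (hfree C)
    exact ⟨h1, h3.trans C.2.1.card_eq, h2.trans C.2.2.2.2⟩
  · have h : code C = code C' := congrArg Subtype.val h
    exact Subtype.ext (C.2.1.eq_of_hasCode C'.2.1 (hfree C) (hfree C') (hcode C)
      (h ▸ hcode C'))
  · rintro ⟨c, hc, hn, hi⟩
    obtain ⟨C, hC, hCc⟩ := exists_cycleFree_hasCode hc
    obtain ⟨f, hf, hd⟩ := hCc.isSystem.exists_isDiagram
    obtain ⟨-, -, h2, h3⟩ := (hCc.relabel hf).spec (hC.relabel hf)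
    rw [← (hCc.spec hC).2.2.2, hn] at hd
    have hfree' := hC.relabel hf
    refine ⟨⟨relabel f C, hd, connected_iff.2 (hCc.linked.relabel hf),
      (topCycleFree_iff hd.isSystem).2 hfree', h2.symm.trans hi⟩, Subtype.ext ?_⟩
    exact (hcode _).unique (hCc.relabel hf)

lemma finite_topCycleFreeDiagrams (n i : ℕ) : Finite (TopCycleFreeDiagrams n i) :=
  have := Code.finite_valid n i
  (exists_equiv_code n i).elim fun e => Finite.of_equiv _ e.symm

lemma card_topCycleFreeDiagrams (n i : ℕ) :
    Nat.card (TopCycleFreeDiagrams n i) = Code.count n i :=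
  (exists_equiv_code n i).elim fun e => (Nat.card_congr e).trans (Code.card_valid n i)

end ChordDiagram

open ChordDiagram RootedMap in
theorem corollary7p4 (n i : ℕ) (hn : 2 ≤ n) (hi : 1 ≤ i) (hin : i ≤ n) :
    Finite (TopCycleFreeDiagrams n i) ∧ Finite (PlanarBridgelessMaps n i) ∧
    (2 ≤ i →
      (Nat.card (TopCycleFreeDiagrams n i) : ℚ) =
        2 * (2 * i - 1).factorial * (4 * n - 2 * i - 3).factorial /
          ((i - 2).factorial * i.factorial * (n - i).factorial * (3 * n - i - 1).factorial) ∧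
      (Nat.card (PlanarBridgelessMaps n i) : ℚ) =
        2 * (2 * i - 1).factorial * (4 * n - 2 * i - 3).factorial /
          ((i - 2).factorial * i.factorial * (n - i).factorial * (3 * n - i - 1).factorial)) ∧
    (Nat.card (TopCycleFreeDiagrams n i) : ℚ) =
      ((i : ℚ) - 1) / ((4 * (n : ℚ) - 2 * i - 1) * (2 * (n : ℚ) - i - 1)) *
        (2 * i - 1).choose i * (4 * n - 2 * i - 1).choose (n - i) ∧
    (Nat.card (PlanarBridgelessMaps n i) : ℚ) =
      ((i : ℚ) - 1) / ((4 * (n : ℚ) - 2 * i - 1) * (2 * (n : ℚ) - i - 1)) *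
        (2 * i - 1).choose i * (4 * n - 2 * i - 1).choose (n - i) := by
  have hC := Code.count_eq hn hi hin
  refine ⟨finite_topCycleFreeDiagrams n i, finite_planarBridgelessMaps n i, fun hi' => ?_, ?_, ?_⟩
  · have hF := Code.count_eq_factorial hn hi' hin
    rw [card_topCycleFreeDiagrams, card_planarBridgelessMaps]
    exact ⟨hF, hF⟩
  · rw [card_topCycleFreeDiagrams]
    exact hC
  · rw [card_planarBridgelessMaps]
    exact hC
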